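/- Setting. Let $(A,\mu_1,\mu_2)$ be a graded unital differential graded algebra over $\mathbb Z_2=\mathbb Z/2$ with $\mu_1$ of degree $-1$, and let $I\subset A$ be the subring spanned by a finite complete family of non-zero orthogonal idempotents of degree $0$ with $\mu_1(I)=0$ (for example $A=\mathcal B\Gamma_n$ with its ring of idempotents $\mathcal I_n$). (The grading may be by any abelian group with a fixed element that plays the role of $1$.) For a $\mathbb Z_2$-vector space $W$ let $\mathbb F_W$ be the field of fractions of the symmetric algebra of $W$, $A_W=A\otimes_{\mathbb Z_2}\mathbb F_W$ and $I_W=I\otimes_{\mathbb Z_2}\mathbb F_W$, with $\mu_{W,1},\mu_{W,2}$ extended $\mathbb F_W$-linearly. A linear injection $\varphi:W\hookrightarrow W'$ induces a field embedding $\mathbb F_W\to\mathbb F_{W'}$; extension of scalars along it turns right $A_\infty$ modules $(M,\{m_i\})$ over $A_W$ into right $A_\infty$ modules $\mathcal F_\varphi(M)$ over $A_{W'}$, and left type $D$ structures $(N,\delta)$ over $A_W$ into left type $D$ structures $\mathcal G_\varphi(N)$ over $A_{W'}$. All modules are graded, with $m_i$ of degree $i-2$ and $\delta$ of degree $-1$;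 morphisms of type $D$ structures have degree $0$ and homotopies have degree $+1$. Type $D$ structures $N$ over $A_W$ and $N'$ over $A_{W'}$ are stably homotopy equivalent if there are a $\mathbb Z_2$-vector space $W''$ and linear injections $\varphi:W\hookrightarrow W''$, $\varphi':W'\hookrightarrow W''$ such that $\mathcal G_\varphi(N)$ and $\mathcal G_{\varphi'}(N')$ are homotopy equivalent type $D$ structures over $A_{W''}$. Chain complexes $C$ over $\mathbb F_W$ and $C'$ over $\mathbb F_{W'}$ are stably chain homotopic if there are such $W'',\varphi,\varphi'$ for which $C\otimes_\varphi\mathbb F_{W''}$ and $C'\otimes_{\varphi'}\mathbb F_{W''}$ are (graded) chain homotopy equivalent over $\mathbb F_{W''}$. For $M$ over $A_{\widetilde W}$ and $N$ over $A_W$, put $V=\widetilde W\oplus W$ with its canonical injections $\varphi:\widetilde W\to V$, $\varphi':W\to V$, and let $M\boxtimes^*N=\mathcal F_\varphi(M)\otimes_{I_V}\mathcal G_{\varphi'}(N)$ with $$\partial^*=\sum_{k\ge0}\bigl(\mathcal F_\varphi(m_{k+1})\otimes \mathbb I\bigr)\circ(\mathbb I\otimes\Delta_k),\qquad \Delta_0=\mathbb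 I,\quad \Delta_{k+1}=(\mathbb I^{\otimes k}\otimes\mathcal G_{\varphi'}(\delta))\circ\Delta_k .$$ Call $M$ bounded if for every $x\in M$ one has $m_{k+1}(x\otimes a_1\otimes\cdots\otimes a_k)=0$ for all sufficiently large $k$ and all $a_1,\dots,a_k$. Call $N$ bounded if for every $y\in N$ the iterates $\Delta_k(y)$ of $\delta$ vanish for all sufficiently large $k$. Call $M$ strictly unital if $m_2(x\otimes1)=x$ for all $x\in M$, and, for $n>2$, $m_n(x\otimes a_1\otimes\cdots\otimes a_{n-1})=0$ whenever some $a_i=1$. Theorem. Let $W$, $W'$ and $\widetilde W$ be vector spaces over $\mathbb Z_2$. Let $(M,\{m_i\})$ be a strictly unital right $A_\infty$ module over $(A_{\widetilde W},I_{\widetilde W})$, and let $(N,\delta)$ and $(N',\delta')$ be type $D$ structures over $(A_W,I_W)$ and $(A_{W'},I_{W'})$ respectively. Assume that $M$ is bounded, or that both $N$ and $N'$ are bounded. If $N$ and $N'$ are stably homotopy equivalent, then $(M\boxtimes^*N,\partial^*)$ and $(M\boxtimes^*N',\partial^*)$ are chain complexes, and they are stably chain homotopic. -/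

import Mathlib

open scoped TensorProduct

universe u

noncomputable section

namespace StablePairing

/-! ### The fields `F_W` -/

/-- `F_W`: the field of fractions of the symmetric algebra of the `ℤ/2`-vector space `W`. -/
def FField (W : Type*) [AddCommGroup W] [Module (ZMod 2) W] : Type _ :=
  FractionRing (SymmetricAlgebra (ZMod 2) W)

section FField

variable (W : Type*) [AddCommGroup W] [Module (ZMod 2) W]

instance : Field (FField W) :=
  inferInstanceAs (Field (FractionRing (SymmetricAlgebra (ZMod 2) W)))

instance : Algebra (SymmetricAlgebra (ZMod 2) W) (FField W) :=
  inferInstanceAs (Algebra _ (FractionRing (SymmetricAlgebra (ZMod 2) W)))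

instance : IsFractionRing (SymmetricAlgebra (ZMod 2) W) (FField W) :=
  inferInstanceAs (IsFractionRing _ (FractionRing (SymmetricAlgebra (ZMod 2) W)))

instance : Algebra (ZMod 2) (FField W) :=
  inferInstanceAs (Algebra (ZMod 2) (FractionRing (SymmetricAlgebra (ZMod 2) W)))

end FField

section FMap

variable {W W' : Type*} [AddCommGroup W] [Module (ZMod 2) W] [AddCommGroup W'] [Module (ZMod 2) W']

/-- The algebra map of symmetric algebras induced by a linear map. -/
def symMap (φ : W →ₗ[ZMod 2] W') :
    SymmetricAlgebra (ZMod 2) W →ₐ[ZMod 2] SymmetricAlgebra (ZMod 2) W' :=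
  SymmetricAlgebra.lift (SymmetricAlgebra.ι (ZMod 2) W' ∘ₗ φ)

theorem symMap_injective (φ : W →ₗ[ZMod 2] W') (hφ : Function.Injective φ) :
    Function.Injective (symMap φ) := by
  obtain ⟨ψ, hψ⟩ := φ.exists_leftInverse_of_injective (LinearMap.ker_eq_bot.2 hφ)
  have h : (symMap ψ).comp (symMap φ) = AlgHom.id (ZMod 2) _ := by
    apply SymmetricAlgebra.algHom_ext
    ext x
    have hx : ψ (φ x) = x := LinearMap.congr_fun hψ x
    simp [symMap, hx]
  intro a b hab
  have h1 := congrArg (symMap ψ) hab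
  have h2 : ∀ c, symMap ψ (symMap φ c) = c := fun c => AlgHom.congr_fun h c
  rwa [h2, h2] at h1

/-- The field embedding `F_W → F_{W'}` induced by a linear injection `φ : W → W'`. -/
def fieldMap (φ : W →ₗ[ZMod 2] W') (hφ : Function.Injective φ) : FField W →+* FField W' :=
  IsFractionRing.map (A := SymmetricAlgebra (ZMod 2) W) (B := SymmetricAlgebra (ZMod 2) W')
    (K := FField W) (L := FField W') (j := (symMap φ).toRingHom) (symMap_injective φ hφ)

end FMap

/-! ### Gradings and tensor products over the ring of idempotents -/

/-- `V` is the direct sum of the subspaces `gr g`. -/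
def IsGrading {Γ K V : Type*} [Field K] [AddCommGroup V] [Module K V]
    (gr : Γ → Submodule K V) : Prop :=
  iSupIndep gr ∧ ⨆ g, gr g = ⊤

/-- The total grading on `M ⊗ N`: the degree `k` part is the sum of the `M_i ⊗ N_j`, `i + j = k`. -/
def tensorGr {Γ K M N : Type*} [AddCommGroup Γ] [Field K] [AddCommGroup M] [Module K M]
    [AddCommGroup N] [Module K N] (gM : Γ → Submodule K M) (gN : Γ → Submodule K N) (k : Γ) :
    Submodule K (M ⊗[K] N) :=
  ⨆ (i : Γ) (j : Γ) (_ : i + j = k), LinearMap.range (TensorProduct.mapIncl (gM i) (gN j))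

/-- For a ring of idempotents `I = ⨁ᵢ K eᵢ`, a right `I`-module `M` (on which `eᵢ` acts by `p i`)
and a left `I`-module `N` (on which `eᵢ` acts by `q i`), the operator
`x ⊗ y ↦ ∑ᵢ x eᵢ ⊗ eᵢ y` on `M ⊗_K N`. -/
def tensorProj {ι K M N : Type*} [Fintype ι] [Field K] [AddCommGroup M] [Module K M]
    [AddCommGroup N] [Module K N] (p : ι → Module.End K M) (q : ι → Module.End K N) :
    M ⊗[K] N →ₗ[K] M ⊗[K] N :=
  ∑ i, TensorProduct.map (p i) (q i)

/-- `M ⊗_I N` for a ring of idempotents `I = ⨁ᵢ K eᵢ`, realized as the subspace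
`⨁ᵢ M eᵢ ⊗_K eᵢ N` of `M ⊗_K N`. The class of `x ⊗ y` is `∑ᵢ x eᵢ ⊗ eᵢ y`; that this is the usual
quotient of `M ⊗_K N` by the relations `x eᵢ ⊗ y = x ⊗ eᵢ y` is `ker_tensorProj` below. -/
def tensorI {ι K M N : Type*} [Fintype ι] [Field K] [AddCommGroup M] [Module K M]
    [AddCommGroup N] [Module K N] (p : ι → Module.End K M) (q : ι → Module.End K N) :
    Submodule K (M ⊗[K] N) :=
  LinearMap.range (tensorProj p q)

/-- The kernel of the surjection `M ⊗_K N → tensorI p q` is spanned by the relations that define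
the tensor product over `I`. -/
theorem ker_tensorProj {ι K M N : Type*} [Fintype ι] [Field K] [AddCommGroup M] [Module K M]
    [AddCommGroup N] [Module K N] (p : ι → Module.End K M) (q : ι → Module.End K N)
    (hp : CompleteOrthogonalIdempotents p) (hq : CompleteOrthogonalIdempotents q) :
    LinearMap.ker (tensorProj p q) =
      Submodule.span K {t | ∃ i x y, t = p i x ⊗ₜ[K] y - x ⊗ₜ[K] q i y} := by
  classical
  set R := Submodule.span K {t | ∃ i x y, t = p i x ⊗ₜ[K] y - x ⊗ₜ[K] q i y} with hR
  have hqq : ∀ i y, q i (q i y) = q i y := fun i y => LinearMap.congr_fun (hq.idem i) y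
  apply le_antisymm
  · have key : ∀ t, t - tensorProj p q t ∈ R := by
      intro t
      induction t using TensorProduct.induction_on with
      | zero => simp
      | add a b ha hb =>
        have := R.add_mem ha hb
        rwa [map_add, add_sub_add_comm]
      | tmul x y =>
        have h1 : x ⊗ₜ[K] y - tensorProj p q (x ⊗ₜ[K] y) =
            -∑ i, (p i x ⊗ₜ[K] q i y - x ⊗ₜ[K] q i (q i y)) := by
          have hc : ∑ i, x ⊗ₜ[K] q i y = x ⊗ₜ[K] y := by
            rw [← TensorProduct.tmul_sum]
            have := LinearMap.congr_fun hq.complete y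
            simp only [LinearMap.sum_apply] at this
            rw [this]; rfl
          simp only [hqq, Finset.sum_sub_distrib, hc]
          simp [tensorProj]
        rw [h1]
        exact R.neg_mem (R.sum_mem fun i _ => Submodule.subset_span ⟨i, x, q i y, rfl⟩)
    intro t ht
    have := key t
    rwa [LinearMap.mem_ker.1 ht, sub_zero] at this
  · rw [hR, Submodule.span_le]
    rintro _ ⟨i, x, y, rfl⟩
    have e1 : tensorProj p q (p i x ⊗ₜ[K] y) = p i x ⊗ₜ[K] q i y := by
      simp only [tensorProj, LinearMap.sum_apply, TensorProduct.map_tmul]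
      rw [Finset.sum_eq_single i]
      · rw [show p i (p i x) = p i x from LinearMap.congr_fun (hp.idem i) x]
      · intro j _ hj
        rw [show p j (p i x) = 0 from LinearMap.congr_fun (hp.ortho hj) x, TensorProduct.zero_tmul]
      · simp
    have e2 : tensorProj p q (x ⊗ₜ[K] q i y) = p i x ⊗ₜ[K] q i y := by
      simp only [tensorProj, LinearMap.sum_apply, TensorProduct.map_tmul]
      rw [Finset.sum_eq_single i]
      · rw [hqq]
      · intro j _ hj
        rw [show q j (q i y) = 0 from LinearMap.congr_fun (hq.ortho hj) y, TensorProduct.tmul_zero]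
      · simp
    simp [e1, e2]

/-! ### Differential graded algebras with idempotents, and their extension of scalars -/

/-- A unital differential graded algebra `(A, μ₁, μ₂)` over `ℤ/2` with a subring of idempotents
`I = ⨁ᵢ ℤ/2 eᵢ`. The grading group `Γ` is any abelian group; `s : Γ` is the unit of degree shift,
so that differentials have degree `-s` (for `Γ = ℤ`, `s = 1` this is the usual convention). -/
structure DGA (Γ : Type*) [AddCommGroup Γ] (s : Γ) where
  /-- the underlying algebra `A` -/
  carrier : Type*
  [ring : Ring carrier]
  [algebra : Algebra (ZMod 2) carrier]
  /-- the grading -/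
  gr : Γ → Submodule (ZMod 2) carrier
  isGrading : IsGrading gr
  one_mem : (1 : carrier) ∈ gr 0
  mul_mem : ∀ {i j a b}, a ∈ gr i → b ∈ gr j → a * b ∈ gr (i + j)
  /-- the differential `μ₁` -/
  d : carrier →ₗ[ZMod 2] carrier
  d_mem : ∀ {i a}, a ∈ gr i → d a ∈ gr (i - s)
  d_d : ∀ a, d (d a) = 0
  leibniz : ∀ a b, d (a * b) = d a * b + a * d b
  /-- the index set of the basis of `I` -/
  idx : Type*
  [fintypeIdx : Fintype idx]
  /-- the basis of `I` -/
  e : idx → carrier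
  e_ne_zero : ∀ i, e i ≠ 0
  e_idem : CompleteOrthogonalIdempotents e
  e_mem : ∀ i, e i ∈ gr 0
  d_e : ∀ i, d (e i) = 0

attribute [instance] DGA.ring DGA.algebra DGA.fintypeIdx

section Structures

variable {Γ : Type*} [AddCommGroup Γ] {s : Γ}

namespace DGA

variable (A : DGA Γ s) (K : Type*) [Field K] [Algebra (ZMod 2) K]

/-- `A_K = K ⊗ A`, for `K = F_W` the algebra `A_W`. -/
abbrev ext : Type _ := K ⊗[ZMod 2] A.carrier

/-- The differential `μ_{W,1}` of `A_W`. -/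
def dExt : A.ext K →ₗ[K] A.ext K := A.d.baseChange K

/-- The grading of `A_W`. -/
def grExt (g : Γ) : Submodule K (A.ext K) := (A.gr g).baseChange K

/-- The idempotents spanning `I_W = F_W ⊗ I`. -/
def eExt (i : A.idx) : A.ext K := 1 ⊗ₜ A.e i

/-- Right multiplication by the idempotents on `A_W`. -/
def eRight (i : A.idx) : Module.End K (A.ext K) := LinearMap.mulRight K (A.eExt K i)

/-- Left multiplication by the idempotents on `A_W`. -/
def eLeft (i : A.idx) : Module.End K (A.ext K) := LinearMap.mulLeft K (A.eExt K i)

end DGA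

/-! ### Type D structures -/

/-- The data of a type `D` structure over `A_K`: a graded `K`-space `N`, the operators by which the
idempotents `eᵢ` act from the left, and `δ : N → A_K ⊗ N`. The laws are in `DData.IsTypeD`. -/
structure DData (A : DGA Γ s) (K : Type*) [Field K] [Algebra (ZMod 2) K] where
  /-- the underlying space `N` -/
  carrier : Type*
  [addCommGroup : AddCommGroup carrier]
  [module : Module K carrier]
  /-- the grading -/
  gr : Γ → Submodule K carrier
  /-- the left action of the idempotents -/
  proj : A.idx → Module.End K carrier
  /-- the structure map -/
  δ : carrier →ₗ[K] A.ext K ⊗[K] carrier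

attribute [instance] DData.addCommGroup DData.module

namespace DData

variable {A : DGA Γ s} {K : Type*} [Field K] [Algebra (ZMod 2) K]

/-- `f : N → A_W ⊗_{I_W} N'` is an `I_W`-linear map into the tensor product over `I_W`,
homogeneous of degree `c`. -/
structure IsGradedMap (N N' : DData A K) (c : Γ) (f : N.carrier →ₗ[K] A.ext K ⊗[K] N'.carrier) :
    Prop where
  mem_tensorI : ∀ x, f x ∈ tensorI (A.eRight K) N'.proj
  map_proj : ∀ i x, f (N.proj i x) = (A.eLeft K i).rTensor N'.carrier (f x)
  degree : ∀ g, ∀ x ∈ N.gr g, f x ∈ tensorGr (A.grExt K) N'.gr (g + c)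

/-- `(μ₂ ⊗ 1)(1 ⊗ g) f`. -/
def comp {N N' N'' : DData A K} (g : N'.carrier →ₗ[K] A.ext K ⊗[K] N''.carrier)
    (f : N.carrier →ₗ[K] A.ext K ⊗[K] N'.carrier) : N.carrier →ₗ[K] A.ext K ⊗[K] N''.carrier :=
  (LinearMap.mul' K (A.ext K)).rTensor N''.carrier ∘ₗ
    (TensorProduct.assoc K (A.ext K) (A.ext K) N''.carrier).symm.toLinearMap ∘ₗ
      g.lTensor (A.ext K) ∘ₗ f

/-- `(μ₂ ⊗ 1)(1 ⊗ δ') f + (μ₂ ⊗ 1)(1 ⊗ f) δ + (μ₁ ⊗ 1) f`. -/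
def diff {N N' : DData A K} (f : N.carrier →ₗ[K] A.ext K ⊗[K] N'.carrier) :
    N.carrier →ₗ[K] A.ext K ⊗[K] N'.carrier :=
  comp N'.δ f + comp f N.δ + (A.dExt K).rTensor N'.carrier ∘ₗ f

/-- The laws of a (left) type `D` structure. -/
structure IsTypeD (N : DData A K) : Prop where
  isGrading : IsGrading N.gr
  proj_idem : CompleteOrthogonalIdempotents N.proj
  proj_mem : ∀ i g, ∀ x ∈ N.gr g, N.proj i x ∈ N.gr g
  isGradedMap : IsGradedMap N N (-s) N.δ
  structure_eq : comp N.δ N.δ + (A.dExt K).rTensor N.carrier ∘ₗ N.δ = 0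

/-- Morphisms of type `D` structures. -/
structure IsHom (N N' : DData A K) (ψ : N.carrier →ₗ[K] A.ext K ⊗[K] N'.carrier) : Prop where
  isGradedMap : IsGradedMap N N' 0 ψ
  diff_eq : diff ψ = 0

/-- Homotopy of maps `N → A_W ⊗_{I_W} N'`. -/
def Homotopic (N N' : DData A K) (ψ φ : N.carrier →ₗ[K] A.ext K ⊗[K] N'.carrier) : Prop :=
  ∃ H : N.carrier →ₗ[K] A.ext K ⊗[K] N'.carrier, IsGradedMap N N' s H ∧ ψ + φ = diff H

/-- The identity morphism `x ↦ 1 ⊗ x`, as an element of `A_W ⊗_{I_W} N`. -/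
def idHom (N : DData A K) : N.carrier →ₗ[K] A.ext K ⊗[K] N.carrier :=
  tensorProj (A.eRight K) N.proj ∘ₗ TensorProduct.mk K (A.ext K) N.carrier 1

/-- Homotopy equivalence in the category of type `D` structures over `A_K`. -/
def HomotopyEquivalent (N N' : DData A K) : Prop :=
  ∃ (ψ : N.carrier →ₗ[K] A.ext K ⊗[K] N'.carrier) (φ : N'.carrier →ₗ[K] A.ext K ⊗[K] N.carrier),
    IsHom N N' ψ ∧ IsHom N' N φ ∧
      Homotopic N N (comp φ ψ) (idHom N) ∧ Homotopic N' N' (comp ψ φ) (idHom N')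

end DData

/-! ### A∞ modules -/

/-- The data of a right `A∞` module over `A_K`: a graded `K`-space `M`, the operators by which the
idempotents `eᵢ` act from the right, and the operations `m_{k+1} : M ⊗ A_K^{⊗ k} → M`, `k ≥ 0`,
packed as one map `m` on `M ⊗ T(A_K)`, where `T(A_K) = ⨁ₖ A_K^{⊗ k}` is the tensor algebra.
The laws are in `AData.IsAInfty`. -/
structure AData (A : DGA Γ s) (K : Type*) [Field K] [Algebra (ZMod 2) K] where
  /-- the underlying space `M` -/
  carrier : Type*
  [addCommGroup : AddCommGroup carrier]
  [module : Module K carrier]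
  /-- the grading -/
  gr : Γ → Submodule K carrier
  /-- the right action of the idempotents -/
  proj : A.idx → Module.End K carrier
  /-- the operations -/
  m : carrier →ₗ[K] TensorAlgebra K (A.ext K) →ₗ[K] carrier

attribute [instance] AData.addCommGroup AData.module

namespace AData

variable {A : DGA Γ s} {K : Type*} [Field K] [Algebra (ZMod 2) K]

/-- `op x [a₁, …, aₖ] = m_{k+1}(x ⊗ a₁ ⊗ ⋯ ⊗ aₖ)`. -/
def op (M : AData A K) (x : M.carrier) (l : List (A.ext K)) : M.carrier :=
  M.m x (l.map (TensorAlgebra.ι K)).prod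

/-- The laws of a right `A∞` module: each `m_{k+1}` is an `I_W`-linear map
`M ⊗_{I_W} A_W^{⊗ k} → M` (tensor powers over `I_W`) of degree `(k - 1) s`, and the `A∞` relations
hold. -/
structure IsAInfty (M : AData A K) : Prop where
  isGrading : IsGrading M.gr
  proj_idem : CompleteOrthogonalIdempotents M.proj
  proj_mem : ∀ i g, ∀ x ∈ M.gr g, M.proj i x ∈ M.gr g
  balanced_left : ∀ x i a l, M.op (M.proj i x) (a :: l) = M.op x (A.eExt K i * a :: l)
  balanced : ∀ x l i a b l',
    M.op x (l ++ a * A.eExt K i :: b :: l') = M.op x (l ++ a :: A.eExt K i * b :: l')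
  map_proj_one : ∀ x i, M.op (M.proj i x) [] = M.proj i (M.op x [])
  map_proj : ∀ x l a i, M.op x (l ++ [a * A.eExt K i]) = M.proj i (M.op x (l ++ [a]))
  degree : ∀ g, ∀ x ∈ M.gr g, ∀ l : List (Γ × A.ext K), (∀ p ∈ l, p.2 ∈ A.grExt K p.1) →
    M.op x (l.map Prod.snd) ∈ M.gr (g + (l.map Prod.fst).sum + ((l.length : ℤ) - 1) • s)
  relation : ∀ (x : M.carrier) (l : List (A.ext K)),
    (∑ j ∈ Finset.range (l.length + 1), M.op (M.op x (l.take j)) (l.drop j)) +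
      (∑ j : Fin l.length, M.op x (l.take j ++ A.dExt K l[j] :: l.drop (j + 1))) +
      (∑ j : Fin (l.length - 1),
        M.op x (l.take j ++ (l[(j : ℕ)] * l[(j : ℕ) + 1]) :: l.drop (j + 2))) = 0

/-- Strict unitality. -/
structure StrictlyUnital (M : AData A K) : Prop where
  op_one : ∀ x, M.op x [1] = x
  op_eq_zero : ∀ x (l : List (A.ext K)), 2 ≤ l.length → 1 ∈ l → M.op x l = 0

/-- For every `x`, the operations `m_{k+1}(x ⊗ ⋯)` vanish for all large `k`. -/
def Bounded (M : AData A K) : Prop :=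
  ∀ x, ∃ n, ∀ l : List (A.ext K), n ≤ l.length → M.op x l = 0

end AData

namespace DData

variable {A : DGA Γ s} {K : Type*} [Field K] [Algebra (ZMod 2) K]

/-- The iterates `Δₖ : N → A_K^{⊗ k} ⊗ N ⊆ T(A_K) ⊗ N`: `Δ₀ = 1` and
`Δ_{n+1} = (1^{⊗ n} ⊗ δ) Δₙ`. -/
def Δ (N : DData A K) : ℕ → N.carrier →ₗ[K] TensorAlgebra K (A.ext K) ⊗[K] N.carrier
  | 0 => TensorProduct.mk K (TensorAlgebra K (A.ext K)) N.carrier 1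
  | n + 1 =>
    (LinearMap.mul' K (TensorAlgebra K (A.ext K)) ∘ₗ
        (TensorAlgebra.ι K).lTensor (TensorAlgebra K (A.ext K))).rTensor N.carrier ∘ₗ
      (TensorProduct.assoc K (TensorAlgebra K (A.ext K)) (A.ext K) N.carrier).symm.toLinearMap ∘ₗ
        N.δ.lTensor (TensorAlgebra K (A.ext K)) ∘ₗ N.Δ n

/-- For every `y`, the iterates `Δₖ y` vanish for all large `k`. -/
def Bounded (N : DData A K) : Prop :=
  ∀ y, ∃ n, ∀ k, n ≤ k → N.Δ k y = 0

end DData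

/-! ### Complexes -/

/-- A graded space with an endomorphism; the laws of a chain complex are in `CData.IsComplex`. -/
structure CData (Γ : Type*) (K : Type*) [Field K] where
  /-- the underlying space -/
  carrier : Type*
  [addCommGroup : AddCommGroup carrier]
  [module : Module K carrier]
  /-- the grading -/
  gr : Γ → Submodule K carrier
  /-- the differential -/
  d : carrier →ₗ[K] carrier

attribute [instance] CData.addCommGroup CData.module

namespace CData

variable {K : Type*} [Field K]

/-- Homogeneous maps of degree `c`. -/
def IsHomogeneous (C C' : CData Γ K) (c : Γ) (f : C.carrier →ₗ[K] C'.carrier) : Prop :=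
  ∀ g, ∀ x ∈ C.gr g, f x ∈ C'.gr (g + c)

/-- The laws of a chain complex with differential of degree `-s`. -/
structure IsComplex (s : Γ) (C : CData Γ K) : Prop where
  isGrading : IsGrading C.gr
  degree : IsHomogeneous C C (-s) C.d
  d_d : C.d ∘ₗ C.d = 0

/-- Chain homotopy equivalence (over a field of characteristic two). -/
def HomotopyEquivalent (s : Γ) (C C' : CData Γ K) : Prop :=
  ∃ (f : C.carrier →ₗ[K] C'.carrier) (g : C'.carrier →ₗ[K] C.carrier)
    (h : C.carrier →ₗ[K] C.carrier) (h' : C'.carrier →ₗ[K] C'.carrier),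
    IsHomogeneous C C' 0 f ∧ IsHomogeneous C' C 0 g ∧
      IsHomogeneous C C s h ∧ IsHomogeneous C' C' s h' ∧
      C'.d ∘ₗ f = f ∘ₗ C.d ∧ C.d ∘ₗ g = g ∘ₗ C'.d ∧
      g ∘ₗ f + LinearMap.id = C.d ∘ₗ h + h ∘ₗ C.d ∧
      f ∘ₗ g + LinearMap.id = C'.d ∘ₗ h' + h' ∘ₗ C'.d

end CData

/-! ### Pairing over one field -/

open Classical in
/-- The pointwise sum of a pointwise finite family of linear maps (zero if the family is not
pointwise finite). -/
def linearSum {K V V' : Type*} [Field K] [AddCommGroup V] [Module K V] [AddCommGroup V']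
    [Module K V'] (f : ℕ → V →ₗ[K] V') : V →ₗ[K] V' :=
  if h : ∀ v, (Function.support fun k => f k v).Finite then
    { toFun := fun v => ∑ᶠ k, f k v
      map_add' := fun v w => by
        simp only [map_add]
        exact finsum_add_distrib (h v) (h w)
      map_smul' := fun c v => by
        simp only [map_smul, RingHom.id_apply]
        exact (smul_finsum c _).symm }
  else 0

section Box

variable {A : DGA Γ s} {K : Type*} [Field K] [Algebra (ZMod 2) K]

/-- `(m_{k+1} ⊗ 1_N)(1_M ⊗ Δₖ)` on `M ⊗_K N`. -/
def boxTerm (M : AData A K) (N : DData A K) (k : ℕ) :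
    M.carrier ⊗[K] N.carrier →ₗ[K] M.carrier ⊗[K] N.carrier :=
  (TensorProduct.lift M.m).rTensor N.carrier ∘ₗ
    (TensorProduct.assoc K M.carrier (TensorAlgebra K (A.ext K)) N.carrier).symm.toLinearMap ∘ₗ
      (N.Δ k).lTensor M.carrier

/-- `(M ⊠ N, ∂)`: the space `M ⊗_{I_W} N` with `∂ = ∑ₖ (m_{k+1} ⊗ 1_N)(1_M ⊗ Δₖ)`. By
`I_W`-linearity of the operations this sum maps the subspace `M ⊗_{I_W} N` of `M ⊗_K N` to itself,
and there the projection `rangeRestrict` only records this. -/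
abbrev box (M : AData A K) (N : DData A K) : CData Γ K where
  carrier := tensorI M.proj N.proj
  gr g := (tensorGr M.gr N.gr g).comap (tensorI M.proj N.proj).subtype
  d := (tensorProj M.proj N.proj).rangeRestrict ∘ₗ linearSum (boxTerm M N) ∘ₗ
    (tensorI M.proj N.proj).subtype

end Box

/-! ### Extension of scalars along a field extension -/

section BaseChange

variable {A : DGA Γ s} {K : Type*} [Field K] [Algebra (ZMod 2) K]
  (L : Type*) [Field L] [Algebra (ZMod 2) L] [Algebra K L] [IsScalarTower (ZMod 2) K L]

/-- The canonical isomorphism `A_L ≅ L ⊗_K A_K`. -/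
def DGA.extEquiv (A : DGA Γ s) (K : Type*) [Field K] [Algebra (ZMod 2) K] (L : Type*) [Field L]
    [Algebra (ZMod 2) L] [Algebra K L] [IsScalarTower (ZMod 2) K L] :
    L ⊗[K] A.ext K ≃ₗ[L] A.ext L :=
  TensorProduct.AlgebraTensorModule.cancelBaseChange (ZMod 2) K L L A.carrier

/-- `(L ⊗_K N, δ ⊗ 1_L)`. -/
abbrev DData.baseChange (N : DData A K) : DData A L where
  carrier := L ⊗[K] N.carrier
  gr g := (N.gr g).baseChange L
  proj i := (N.proj i).baseChange L
  δ := (A.extEquiv K L).toLinearMap.rTensor (L ⊗[K] N.carrier) ∘ₗ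
    (TensorProduct.AlgebraTensorModule.distribBaseChange K L (A.ext K) N.carrier).toLinearMap ∘ₗ
      N.δ.baseChange L

/-- The algebra map `T_L(A_L) → L ⊗_K T_K(A_K)`, the inverse of the canonical map. -/
def DGA.tensorAlgebraMap (A : DGA Γ s) (K : Type*) [Field K] [Algebra (ZMod 2) K] (L : Type*)
    [Field L] [Algebra (ZMod 2) L] [Algebra K L] [IsScalarTower (ZMod 2) K L] :
    TensorAlgebra L (A.ext L) →ₐ[L] L ⊗[K] TensorAlgebra K (A.ext K) :=
  TensorAlgebra.lift L
    ((TensorAlgebra.ι K : A.ext K →ₗ[K] TensorAlgebra K (A.ext K)).baseChange L ∘ₗ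
      (A.extEquiv K L).symm.toLinearMap)

/-- `L ⊗_K M` with the operations
`(r ⊗ x) ⊗ (r₁ ⊗ a₁) ⊗ ⋯ ⊗ (rₖ ⊗ aₖ) ↦ r r₁ ⋯ rₖ ⊗ m_{k+1}(x ⊗ a₁ ⊗ ⋯ ⊗ aₖ)`. -/
abbrev AData.baseChange (M : AData A K) : AData A L where
  carrier := L ⊗[K] M.carrier
  gr g := (M.gr g).baseChange L
  proj i := (M.proj i).baseChange L
  m := (TensorProduct.curry ((TensorProduct.lift M.m).baseChange L ∘ₗ
    (TensorProduct.AlgebraTensorModule.distribBaseChange K L M.carrier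
      (TensorAlgebra K (A.ext K))).symm.toLinearMap)).compl₂ (A.tensorAlgebraMap K L).toLinearMap

/-- `(L ⊗_K C, ∂ ⊗ 1_L)`. -/
abbrev CData.baseChange {K : Type*} [Field K] (L : Type*) [Field L] [Algebra K L] (C : CData Γ K) :
    CData Γ L where
  carrier := L ⊗[K] C.carrier
  gr g := (C.gr g).baseChange L
  d := C.d.baseChange L

end BaseChange

/-! ### Extension of scalars along linear injections, stable equivalences, and the pairing -/

section Stable

variable {A : DGA Γ s} {W W' : Type*} [AddCommGroup W] [Module (ZMod 2) W]
  [AddCommGroup W'] [Module (ZMod 2) W']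

theorem isScalarTower_zmod {K L : Type*} [Field K] [Field L] [Algebra (ZMod 2) K]
    [Algebra (ZMod 2) L] [Algebra K L] : IsScalarTower (ZMod 2) K L :=
  IsScalarTower.of_algebraMap_eq' (Subsingleton.elim _ _)

/-- The functor `F_φ` on the data of `A∞` modules. -/
abbrev AData.extend (φ : W →ₗ[ZMod 2] W') (hφ : Function.Injective φ) (M : AData A (FField W)) :
    AData A (FField W') :=
  letI : Algebra (FField W) (FField W') := (fieldMap φ hφ).toAlgebra
  haveI : IsScalarTower (ZMod 2) (FField W) (FField W') := isScalarTower_zmod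
  M.baseChange (FField W')

/-- The functor `G_φ` on the data of type `D` structures. -/
abbrev DData.extend (φ : W →ₗ[ZMod 2] W') (hφ : Function.Injective φ) (N : DData A (FField W)) :
    DData A (FField W') :=
  letI : Algebra (FField W) (FField W') := (fieldMap φ hφ).toAlgebra
  haveI : IsScalarTower (ZMod 2) (FField W) (FField W') := isScalarTower_zmod
  N.baseChange (FField W')

/-- `C ⊗_φ F_{W'}`. -/
abbrev CData.extend (φ : W →ₗ[ZMod 2] W') (hφ : Function.Injective φ) (C : CData Γ (FField W)) :
    CData Γ (FField W') :=
  letI : Algebra (FField W) (FField W') := (fieldMap φ hφ).toAlgebra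
  C.baseChange (FField W')

/-- `M ⊠* N` over `F_{W ⊕ W'}`, for `M` over `A_W` and `N` over `A_{W'}`. -/
abbrev boxStar (M : AData A (FField W)) (N : DData A (FField W')) : CData Γ (FField (W × W')) :=
  box (M.extend (LinearMap.inl (ZMod 2) W W') LinearMap.inl_injective)
    (N.extend (LinearMap.inr (ZMod 2) W W') LinearMap.inr_injective)

end Stable

section StableEquivalence


variable {A : DGA Γ s} {W W' : Type u} [AddCommGroup W] [Module (ZMod 2) W]
  [AddCommGroup W'] [Module (ZMod 2) W']

/-- Stable homotopy equivalence of type `D` structures over `A_W` and `A_{W'}`. -/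
def DData.StablyHomotopyEquivalent (N : DData A (FField W)) (N' : DData A (FField W')) : Prop :=
  ∃ (W'' : Type u) (_ : AddCommGroup W'') (_ : Module (ZMod 2) W'')
    (φ : W →ₗ[ZMod 2] W'') (φ' : W' →ₗ[ZMod 2] W'')
    (hφ : Function.Injective φ) (hφ' : Function.Injective φ'),
    DData.HomotopyEquivalent (N.extend φ hφ) (N'.extend φ' hφ')

/-- Stable chain homotopy equivalence of complexes over `F_W` and `F_{W'}`. -/
def CData.StablyHomotopyEquivalent (s : Γ) (C : CData Γ (FField W)) (C' : CData Γ (FField W')) :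
    Prop :=
  ∃ (W'' : Type u) (_ : AddCommGroup W'') (_ : Module (ZMod 2) W'')
    (φ : W →ₗ[ZMod 2] W'') (φ' : W' →ₗ[ZMod 2] W'')
    (hφ : Function.Injective φ) (hφ' : Function.Injective φ'),
    CData.HomotopyEquivalent s (C.extend φ hφ) (C'.extend φ' hφ')

end StableEquivalence

end Structures

end StablePairing

end

/-! The proof rests on one formula for the square of the box operator that needs no type `D`
equation, and on applying it to cones.

For fixed x in M the operations form one function on words, a₁⋯aₖ ↦ m_{k+1}(x ⊗ a₁ ⊗ ⋯ ⊗ aₖ), linear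
in every letter; the box operator feeds it the letters produced by iterating δ. Paired with words of
length n + 1, the `A∞` relation has three parts. Splitting the word gives the degree n + 1 part of
∂². Differentiating a letter inserts (μ₁ ⊗ 1)δ once among n + 1 letters. Multiplying neighbours
inserts (μ₂ ⊗ 1)(1 ⊗ δ)δ once among n letters. Adding the insertion of (μ₁ ⊗ 1)δ among n letters
twice, which is harmless in characteristic two, turns this into Q(n+1) + Q(n) plus an insertion of
the curvature of δ. The Q terms telescope and boundedness removes the last one. So ∂² is the sum of
all insertions of the curvature (`linearSum_linearSum`, `boxD_boxD`), for an arbitrary map δ.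

For a type `D` structure the curvature is zero, so ∂² = 0. The cone of a map f has a triangular
structure map whose curvature has the differential of f as its off-diagonal entry
(`curvature_cone`). If f is a morphism ψ, the cone is flat, and the off-diagonal entry of its box
operator is a chain map (`coneEntry_comm`). If ψ is a homotopy equivalence with inverse φ and
homotopies H, H', then the matrix with rows (H, φ) and (0, H') on the cone of ψ has as differential
the identity plus one corner entry (`diff_coneHomotopy`). The cone of that matrix is curved, and its
curvature is the identity morphism plus the corner. Strict unitality reduces the insertions of the
identity to the projection onto M ⊗_I N (`sum_insertTerm_idHom`), so the entry k of its box operator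
satisfies ∂k + k∂ = 1 up to a corner (`exists_coneEntry_of_diff`). Three entries of k are the
inverse chain map and the two homotopies; the corner affects none of their equations
(`box_homotopyEquivalent`). Functoriality of the pairing under composition is never needed.

For the stable statement, extensions of scalars are described by semilinear maps j which carry bases
to bases (`IsExt`). Every law, morphism and bound passes along such a j, and extensions along the
same embedding are isomorphic. If N and N' become equivalent over W₁, the space W₀ ⊕ W₁ serves for
the pairings: extending M ⊠* N along id ⊕ φ gives M ⊠* G_φ(N) (`exists_isIso_boxStar_extend`), and
there the unstable result applies. -/

noncomputable section

namespace StablePairing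

/-! ### Functions on words that are linear in every letter. -/

section Words

variable (K B M : Type*) [Field K] [Ring B] [Algebra K B] [AddCommGroup M] [Module K M]

/-- Functions on words in `B` that are linear in every letter. -/
def wordMaps : Submodule K (List B → M) where
  carrier := {F | (∀ l a b l', F (l ++ (a + b) :: l') = F (l ++ a :: l') + F (l ++ b :: l')) ∧
    ∀ l (c : K) a l', F (l ++ (c • a) :: l') = c • F (l ++ a :: l')}
  add_mem' := by
    rintro F G ⟨hF, hF'⟩ ⟨hG, hG'⟩
    refine ⟨fun l a b l' => ?_, fun l c a l' => ?_⟩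
    · simp only [Pi.add_apply, hF, hG]; abel
    · simp only [Pi.add_apply, hF', hG', smul_add]
  zero_mem' := by simp
  smul_mem' := by
    rintro r F ⟨hF, hF'⟩
    refine ⟨fun l a b l' => ?_, fun l c a l' => ?_⟩
    · simp only [Pi.smul_apply, hF, smul_add]
    · simp only [Pi.smul_apply, hF', smul_comm r c]

variable {K B M}

namespace wordMaps

theorem map_add_letter (F : wordMaps K B M) (l : List B) (a b : B) (l' : List B) :
    F.1 (l ++ (a + b) :: l') = F.1 (l ++ a :: l') + F.1 (l ++ b :: l') := F.2.1 l a b l'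

theorem map_smul_letter (F : wordMaps K B M) (l : List B) (c : K) (a : B) (l' : List B) :
    F.1 (l ++ (c • a) :: l') = c • F.1 (l ++ a :: l') := F.2.2 l c a l'

/-- Evaluation at a word. -/
def evalAt (l : List B) : wordMaps K B M →ₗ[K] M := LinearMap.proj l ∘ₗ (wordMaps K B M).subtype

@[simp] theorem evalAt_apply (l : List B) (F : wordMaps K B M) : evalAt l F = F.1 l := rfl

/-- Insertion of a first letter. -/
def shift : wordMaps K B M →ₗ[K] B →ₗ[K] wordMaps K B M :=
  LinearMap.mk₂ K (fun F a => ⟨fun l => F.1 (a :: l), fun l b c l' => F.2.1 (a :: l) b c l',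
      fun l c b l' => F.2.2 (a :: l) c b l'⟩)
    (fun _ _ _ => rfl) (fun _ _ _ => rfl)
    (fun F a b => Subtype.ext (funext fun l => F.2.1 [] a b l))
    (fun c F a => Subtype.ext (funext fun l => F.2.2 [] c a l))

@[simp] theorem shift_apply (F : wordMaps K B M) (a : B) (l : List B) :
    (shift F a).1 l = F.1 (a :: l) := rfl

/-- The sum of the values of `F` at the words obtained by applying `d` to one letter. -/
def derivAt (d : B →ₗ[K] B) : List B → wordMaps K B M →ₗ[K] M
  | [] => 0
  | a :: l => evalAt (d a :: l) + derivAt d l ∘ₗ shift.flip a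

/-- The sum of the values of `F` at the words obtained by multiplying two adjacent letters. -/
def mulAt : List B → wordMaps K B M →ₗ[K] M
  | [] => 0
  | [_] => 0
  | a :: b :: l => evalAt ((a * b) :: l) + mulAt (b :: l) ∘ₗ shift.flip a

/-- The sum over the splittings of a word of the values of `op` after `F`. -/
def splitAt (op : M →ₗ[K] wordMaps K B M) : List B → wordMaps K B M →ₗ[K] M
  | [] => evalAt [] ∘ₗ op ∘ₗ evalAt []
  | a :: l => evalAt (a :: l) ∘ₗ op ∘ₗ evalAt [] + splitAt op l ∘ₗ shift.flip a

/-- With its companions for splitting and multiplication, this makes the `A∞` relation an equation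
between word maps. It can then be paired with iterates of δ, and it can be checked on letters that
span. -/
theorem derivAt_mem (d : B →ₗ[K] B) (F : wordMaps K B M) :
    (fun l => derivAt d l F) ∈ wordMaps K B M := by
  refine ⟨fun l a b l' => ?_, fun l c a l' => ?_⟩
  · induction l generalizing F with
    | nil =>
      have := F.2.1 [] (d a) (d b) l'
      simp only [List.nil_append] at this
      simp [derivAt, this]; abel
    | cons e l ih =>
      have := F.2.1 (d e :: l) a b l'
      simp only [List.cons_append] at this
      simp [derivAt, this, ih]; abel
  · induction l generalizing F with
    | nil =>
      have := F.2.2 [] c (d a) l'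
      simp only [List.nil_append] at this
      simp [derivAt, this]
    | cons e l ih =>
      have := F.2.2 (d e :: l) c a l'
      simp only [List.cons_append] at this
      simp [derivAt, this, ih]

theorem splitAt_mem (op : M →ₗ[K] wordMaps K B M) (F : wordMaps K B M) :
    (fun l => splitAt op l F) ∈ wordMaps K B M := by
  refine ⟨fun l a b l' => ?_, fun l c a l' => ?_⟩
  · induction l generalizing F with
    | nil =>
      have := (op (F.1 [])).2.1 [] a b l'
      simp only [List.nil_append] at this
      simp [splitAt, this]; abel
    | cons e l ih =>
      have := (op (F.1 [])).2.1 (e :: l) a b l'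
      simp only [List.cons_append] at this
      simp [splitAt, this, ih]; abel
  · induction l generalizing F with
    | nil =>
      have := (op (F.1 [])).2.2 [] c a l'
      simp only [List.nil_append] at this
      simp [splitAt, this]
    | cons e l ih =>
      have := (op (F.1 [])).2.2 (e :: l) c a l'
      simp only [List.cons_append] at this
      simp [splitAt, this, ih]

/-- The varying letter can be either factor of a product with a neighbour, hence the case
distinctions on the adjacent letter. -/
theorem mulAt_mem (F : wordMaps K B M) :
    (fun l => mulAt l F) ∈ wordMaps K B M := by
  refine ⟨fun l a b l' => ?_, fun l c a l' => ?_⟩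
  · induction l generalizing F with
    | nil =>
      cases l' with
      | nil => simp [mulAt]
      | cons f l' =>
        have := F.2.1 [] (a * f) (b * f) l'
        simp only [List.nil_append] at this
        simp [mulAt, add_mul, this]; abel
    | cons e l ih =>
      cases l with
      | nil =>
        have := F.2.1 [] (e * a) (e * b) l'
        have ih' := ih (shift F e)
        simp only [List.nil_append] at this ih'
        simp [mulAt, mul_add, this, ih']; abel
      | cons f l =>
        have := F.2.1 ((e * f) :: l) a b l'
        have ih' := ih (shift F e)
        simp only [List.cons_append] at this ih'
        simp [mulAt, this, ih']; abel
  · induction l generalizing F with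
    | nil =>
      cases l' with
      | nil => simp [mulAt]
      | cons f l' =>
        have := F.2.2 [] c (a * f) l'
        simp only [List.nil_append] at this
        simp [mulAt, this]
    | cons e l ih =>
      cases l with
      | nil =>
        have := F.2.2 [] c (e * a) l'
        have ih' := ih (shift F e)
        simp only [List.nil_append] at this ih'
        simp [mulAt, this, ih']
      | cons f l =>
        have := F.2.2 ((e * f) :: l) c a l'
        have ih' := ih (shift F e)
        simp only [List.cons_append] at this ih'
        simp [mulAt, this, ih']

/-- `derivAt` as a word map. -/
def deriv (d : B →ₗ[K] B) (F : wordMaps K B M) : wordMaps K B M := ⟨_, derivAt_mem d F⟩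

/-- `mulAt` as a word map. -/
def mul (F : wordMaps K B M) : wordMaps K B M := ⟨_, mulAt_mem F⟩

/-- `splitAt` as a word map. -/
def split (op : M →ₗ[K] wordMaps K B M) (F : wordMaps K B M) : wordMaps K B M :=
  ⟨_, splitAt_mem op F⟩

/-- This and the next two identities drive all inductions on the number of letters. Multiplication
needs two shifts because a product consumes two letters. -/
theorem shift_deriv (d : B →ₗ[K] B) (F : wordMaps K B M) (a : B) :
    shift (deriv d F) a = shift F (d a) + deriv d (shift F a) := rfl

theorem shift_split (op : M →ₗ[K] wordMaps K B M) (F : wordMaps K B M) (a : B) :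
    shift (split op F) a = shift (op (F.1 [])) a + split op (shift F a) := rfl

theorem shift_shift_mul (F : wordMaps K B M) (a b : B) :
    shift (shift (mul F) a) b = shift F (a * b) + shift (mul (shift F a)) b := rfl

theorem derivAt_eq_sum (d : B →ₗ[K] B) (l : List B) (F : wordMaps K B M) :
    derivAt d l F = ∑ j : Fin l.length, F.1 (l.take j ++ d l[j] :: l.drop (j + 1)) := by
  induction l generalizing F with
  | nil => simp [derivAt]
  | cons a l ih => simp [derivAt, ih, Fin.sum_univ_succ]

theorem mulAt_eq_sum (l : List B) (F : wordMaps K B M) :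
    mulAt l F = ∑ j : Fin (l.length - 1),
      F.1 (l.take j ++ (l[(j : ℕ)] * l[(j : ℕ) + 1]) :: l.drop (j + 2)) := by
  induction l generalizing F with
  | nil => simp [mulAt]
  | cons a l ih =>
    cases l with
    | nil => simp [mulAt]
    | cons b l =>
      have := ih (shift F a)
      simp only [List.length_cons] at this ⊢
      simp [mulAt, this, Fin.sum_univ_succ]

theorem splitAt_eq_sum (op : M →ₗ[K] wordMaps K B M) (l : List B) (F : wordMaps K B M) :
    splitAt op l F = ∑ j ∈ Finset.range (l.length + 1), (op (F.1 (l.take j))).1 (l.drop j) := by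
  induction l generalizing F with
  | nil => simp [splitAt]
  | cons a l ih =>
    rw [List.length_cons, Finset.sum_range_succ']
    simp [splitAt, ih, add_comm]

end wordMaps

open wordMaps

/-! ### Pairing word maps with the iterates of a structure map. -/

section Along

variable {N N' N'' X : Type*} [AddCommGroup N] [Module K N] [AddCommGroup N'] [Module K N']
  [AddCommGroup N''] [Module K N''] [AddCommGroup X] [Module K X]

/-- The map `a ⊗ y ↦ Φ (F (a :: ·)) y`. -/
def contract (Φ : wordMaps K B M →ₗ[K] N →ₗ[K] X) (F : wordMaps K B M) : B ⊗[K] N →ₗ[K] X :=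
  TensorProduct.lift (Φ ∘ₗ shift F)

@[simp] theorem contract_tmul (Φ : wordMaps K B M →ₗ[K] N →ₗ[K] X) (F : wordMaps K B M) (a : B)
    (y : N) : contract Φ F (a ⊗ₜ y) = Φ (shift F a) y := rfl

/-- Feed the letter produced by `g` to a word map, and continue with `Φ`. -/
def along (g : N →ₗ[K] B ⊗[K] N') (Φ : wordMaps K B M →ₗ[K] N' →ₗ[K] X) :
    wordMaps K B M →ₗ[K] N →ₗ[K] X :=
  LinearMap.mk₂ K (fun F y => contract Φ F (g y))
    (fun F G y => by
      have : contract Φ (F + G) = contract Φ F + contract Φ G := by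
        ext a z; simp
      simp [this])
    (fun c F y => by
      have : contract Φ (c • F) = c • contract Φ F := by
        ext a z; simp
      simp [this])
    (fun F y z => by simp) (fun c F y => by simp)

theorem along_apply (g : N →ₗ[K] B ⊗[K] N') (Φ : wordMaps K B M →ₗ[K] N' →ₗ[K] X)
    (F : wordMaps K B M) (y : N) : along g Φ F y = contract Φ F (g y) := rfl

theorem along_add_left (g h : N →ₗ[K] B ⊗[K] N') (Φ : wordMaps K B M →ₗ[K] N' →ₗ[K] X) :
    along (g + h) Φ = along g Φ + along h Φ := by
  ext F y; simp [along_apply]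

theorem along_add_right (g : N →ₗ[K] B ⊗[K] N') (Φ Ψ : wordMaps K B M →ₗ[K] N' →ₗ[K] X) :
    along g (Φ + Ψ) = along g Φ + along g Ψ := by
  ext F y
  have : contract (Φ + Ψ) F = contract Φ F + contract Ψ F := by ext a z; simp
  simp [along_apply, this]

theorem along_zero_right (g : N →ₗ[K] B ⊗[K] N') :
    along g (0 : wordMaps K B M →ₗ[K] N' →ₗ[K] X) = 0 := by
  ext F y
  have : contract (0 : wordMaps K B M →ₗ[K] N' →ₗ[K] X) F = 0 := by ext a z; simp
  simp [along_apply, this]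

theorem along_zero_left (Φ : wordMaps K B M →ₗ[K] N' →ₗ[K] X) :
    along (0 : N →ₗ[K] B ⊗[K] N') Φ = 0 := by
  ext F y; simp [along_apply]

/-- Evaluation of a word map on the words of length `n` produced by iterating `δ`. -/
def iterEval (M : Type*) [AddCommGroup M] [Module K M] (δ : N →ₗ[K] B ⊗[K] N) :
    ℕ → wordMaps K B M →ₗ[K] N →ₗ[K] M ⊗[K] N
  | 0 => TensorProduct.mk K M N ∘ₗ evalAt []
  | n + 1 => along δ (iterEval M δ n)

/-- Evaluation of a word map on the words of length `n` produced by iterating `δ`, then applying `c`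
once, and then iterating `δ'`. -/
def insertEval (M : Type*) [AddCommGroup M] [Module K M] (δ : N →ₗ[K] B ⊗[K] N)
    (c : N →ₗ[K] B ⊗[K] N') (δ' : N' →ₗ[K] B ⊗[K] N') :
    ℕ → wordMaps K B M →ₗ[K] N →ₗ[K] M ⊗[K] N'
  | 0 => 0
  | n + 1 => along c (iterEval M δ' n) + along δ (insertEval M δ c δ' n)

theorem iterEval_zero (δ : N →ₗ[K] B ⊗[K] N) (F : wordMaps K B M) (y : N) :
    iterEval M δ 0 F y = F.1 [] ⊗ₜ y := rfl

theorem iterEval_succ (δ : N →ₗ[K] B ⊗[K] N) (n : ℕ) (F : wordMaps K B M) (y : N) :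
    iterEval M δ (n + 1) F y = contract (iterEval M δ n) F (δ y) := rfl

theorem insertEval_zero (δ : N →ₗ[K] B ⊗[K] N)
    (c : N →ₗ[K] B ⊗[K] N') (δ' : N' →ₗ[K] B ⊗[K] N') (F : wordMaps K B M) (y : N) :
    insertEval M δ c δ' 0 F y = 0 := rfl

theorem insertEval_succ (δ : N →ₗ[K] B ⊗[K] N)
    (c : N →ₗ[K] B ⊗[K] N') (δ' : N' →ₗ[K] B ⊗[K] N') (n : ℕ) (F : wordMaps K B M) (y : N) :
    insertEval M δ c δ' (n + 1) F y =
      contract (iterEval M δ' n) F (c y) + contract (insertEval M δ c δ' n) F (δ y) := rfl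

theorem insertEval_add (δ : N →ₗ[K] B ⊗[K] N)
    (c e : N →ₗ[K] B ⊗[K] N') (δ' : N' →ₗ[K] B ⊗[K] N') (n : ℕ) :
    insertEval M δ (c + e) δ' n = insertEval M δ c δ' n + insertEval M δ e δ' n := by
  induction n with
  | zero => simp [insertEval]
  | succ n ih => simp only [insertEval, ih, along_add_left, along_add_right]; abel

theorem insertEval_zero_middle (δ : N →ₗ[K] B ⊗[K] N) (δ' : N' →ₗ[K] B ⊗[K] N') (n : ℕ) :
    insertEval M δ 0 δ' n = 0 := by
  induction n with
  | zero => rfl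
  | succ n ih => simp only [insertEval, ih, along_zero_left, along_zero_right, add_zero]

theorem contract_congr {Φ Ψ : wordMaps K B M →ₗ[K] N →ₗ[K] X} {F G : wordMaps K B M}
    (h : ∀ a y, Φ (shift F a) y = Ψ (shift G a) y) (t : B ⊗[K] N) :
    contract Φ F t = contract Ψ G t := by
  induction t using TensorProduct.induction_on with
  | zero => simp
  | tmul a y => simp [h]
  | add s t hs ht => simp [hs, ht]

/-- `(μ₂ ⊗ 1)(1 ⊗ g) f`. -/
def mulComp (g : N' →ₗ[K] B ⊗[K] N'') (f : N →ₗ[K] B ⊗[K] N') : N →ₗ[K] B ⊗[K] N'' :=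
  (LinearMap.mul' K B).rTensor N'' ∘ₗ (TensorProduct.assoc K B B N'').symm.toLinearMap ∘ₗ
    g.lTensor B ∘ₗ f

/-- Each letter comes from one application of δ, so applying d to it replaces that application by (d
⊗ 1)δ. -/
theorem iterEval_deriv (d : B →ₗ[K] B) (δ : N →ₗ[K] B ⊗[K] N) (n : ℕ) (F : wordMaps K B M)
    (y : N) :
    iterEval M δ n (wordMaps.deriv d F) y = insertEval M δ (d.rTensor N ∘ₗ δ) δ n F y := by
  induction n generalizing F y with
  | zero => simp [iterEval_zero, wordMaps.deriv, derivAt, insertEval_zero]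
  | succ n ih =>
    rw [iterEval_succ, insertEval_succ, LinearMap.comp_apply]
    generalize δ y = t
    induction t using TensorProduct.induction_on with
    | zero => simp
    | tmul a y => simp [shift_deriv, ih]
    | add s t hs ht => simp only [map_add, hs, ht]; abel

theorem iterEval_shift_mul (δ : N →ₗ[K] B ⊗[K] N) (n : ℕ) (F : wordMaps K B M) (a : B) (y : N) :
    iterEval M δ (n + 1) (shift (mul F) a) y =
      contract (iterEval M δ n) F ((LinearMap.mul' K B).rTensor N
        ((TensorProduct.assoc K B B N).symm (a ⊗ₜ δ y))) +
      iterEval M δ (n + 1) (mul (shift F a)) y := by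
  rw [iterEval_succ, iterEval_succ]
  generalize δ y = t
  induction t using TensorProduct.induction_on with
  | zero => simp
  | tmul b z => simp [shift_shift_mul]
  | add s t hs ht => simp only [map_add, hs, ht, TensorProduct.tmul_add]; abel

/-- Neighbouring letters come from consecutive applications of δ; multiplying them merges the two
applications into one. The drop from n + 1 letters to n is the source of the telescoping later on.
-/
theorem iterEval_mul (δ : N →ₗ[K] B ⊗[K] N) (n : ℕ) (F : wordMaps K B M) (y : N) :
    iterEval M δ (n + 1) (mul F) y = insertEval M δ (mulComp δ δ) δ n F y := by
  induction n generalizing F y with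
  | zero =>
    rw [iterEval_succ, insertEval_zero]
    generalize δ y = t
    induction t using TensorProduct.induction_on with
    | zero => simp
    | tmul a y => simp [iterEval_zero, mul, mulAt]
    | add s t hs ht => simp only [map_add, hs, ht, add_zero]
  | succ n ih =>
    rw [iterEval_succ, insertEval_succ, mulComp]
    simp only [LinearMap.comp_apply, LinearEquiv.coe_coe]
    generalize δ y = t
    induction t using TensorProduct.induction_on with
    | zero => simp
    | tmul a y =>
      rw [contract_tmul, iterEval_shift_mul, ih, LinearMap.lTensor_tmul, contract_tmul]
      rfl
    | add s t hs ht => simp only [map_add, hs, ht]; abel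

/-- The first l iterates feed the inner operation, and the remaining ones start from the element of
N reached at the cut. Hence splitting words corresponds to composing terms of the box operator. -/
theorem iterEval_split (op : M →ₗ[K] wordMaps K B M) (δ : N →ₗ[K] B ⊗[K] N) (n : ℕ)
    (F : wordMaps K B M) (y : N) :
    iterEval M δ n (split op F) y = ∑ l ∈ Finset.range (n + 1),
      TensorProduct.lift (iterEval M δ (n - l) ∘ₗ op) (iterEval M δ l F y) := by
  induction n generalizing F y with
  | zero => simp [iterEval_zero, split, splitAt]
  | succ n ih =>
    rw [Finset.sum_range_succ']
    simp only [iterEval_succ, iterEval_zero, TensorProduct.lift.tmul, LinearMap.comp_apply,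
      Nat.sub_zero, Nat.add_sub_add_right]
    generalize δ y = t
    induction t using TensorProduct.induction_on with
    | zero => simp
    | tmul a y =>
      simp only [contract_tmul, shift_split, map_add, LinearMap.add_apply, ih]
      exact add_comm _ _
    | add s t hs ht =>
      simp only [map_add, hs, ht, Finset.sum_add_distrib]; abel

/-- Naturality of `iterEval` for strict maps. -/
theorem iterEval_map {δ : N →ₗ[K] B ⊗[K] N} {δ' : N' →ₗ[K] B ⊗[K] N'} (f : N →ₗ[K] N')
    (hf : ∀ y, δ' (f y) = f.lTensor B (δ y)) (n : ℕ) (F : wordMaps K B M) (y : N) :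
    iterEval M δ' n F (f y) = f.lTensor M (iterEval M δ n F y) := by
  induction n generalizing F y with
  | zero => simp [iterEval_zero]
  | succ n ih =>
    rw [iterEval_succ, iterEval_succ, hf]
    generalize δ y = t
    induction t using TensorProduct.induction_on with
    | zero => simp
    | tmul a y => simp [ih]
    | add s t hs ht => simp only [map_add, hs, ht]

/-- An inserted map that factors through a strict quotient on the left and a strict subobject on
the right. -/
theorem insertEval_map {X Y Z U : Type*} [AddCommGroup X] [Module K X] [AddCommGroup Y] [Module K Y]
    [AddCommGroup Z] [Module K Z] [AddCommGroup U] [Module K U]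
    {δX : X →ₗ[K] B ⊗[K] X} {δY : Y →ₗ[K] B ⊗[K] Y} {δZ : Z →ₗ[K] B ⊗[K] Z}
    {δU : U →ₗ[K] B ⊗[K] U} (p : X →ₗ[K] Y) (hp : ∀ y, δY (p y) = p.lTensor B (δX y))
    (i : Z →ₗ[K] U) (hi : ∀ y, δU (i y) = i.lTensor B (δZ y)) (c : Y →ₗ[K] B ⊗[K] Z)
    (n : ℕ) (F : wordMaps K B M) (x : X) :
    insertEval M δX (i.lTensor B ∘ₗ c ∘ₗ p) δU n F x =
      i.lTensor M (insertEval M δY c δZ n F (p x)) := by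
  induction n generalizing F x with
  | zero => simp [insertEval_zero]
  | succ n ih =>
    rw [insertEval_succ, insertEval_succ, map_add]
    congr 1
    · simp only [LinearMap.comp_apply]
      generalize c (p x) = t
      induction t using TensorProduct.induction_on with
      | zero => simp
      | tmul a y => simp [iterEval_map i hi]
      | add s t hs ht => simp only [map_add, hs, ht]
    · rw [hp]
      generalize δX x = t
      induction t using TensorProduct.induction_on with
      | zero => simp
      | tmul a y => simp [ih]
      | add s t hs ht => simp only [map_add, hs, ht]

theorem iterEval_eq_zero (δ : N →ₗ[K] B ⊗[K] N) (n : ℕ) (F : wordMaps K B M)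
    (hF : ∀ l : List B, l.length = n → F.1 l = 0) : iterEval M δ n F = 0 := by
  induction n generalizing F with
  | zero => ext y; simp [iterEval_zero, hF]
  | succ n ih =>
    ext y
    rw [iterEval_succ, contract_congr (Ψ := 0) (G := F)
      (fun a y => by rw [ih (shift F a) fun l hl => hF (a :: l) (by simp [hl])]; rfl)]
    generalize δ y = t
    induction t using TensorProduct.induction_on with
    | zero => simp
    | tmul a y => simp
    | add s t hs ht => simp_all

theorem contract_zero (F : wordMaps K B M) (t : B ⊗[K] N) :
    contract (0 : wordMaps K B M →ₗ[K] N →ₗ[K] X) F t = 0 := by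
  induction t using TensorProduct.induction_on with
  | zero => simp
  | tmul a y => simp
  | add s t hs ht => simp_all

theorem contract_eq_zero {Φ : wordMaps K B M →ₗ[K] N →ₗ[K] X} {F : wordMaps K B M}
    (h : ∀ a y, Φ (shift F a) y = 0) (t : B ⊗[K] N) : contract Φ F t = 0 := by
  rw [contract_congr (Ψ := 0) (G := F) (by simpa using h), contract_zero]

/-- Only values on words of length n enter, the inserted letter included. This is how boundedness of
M is used. -/
theorem insertEval_eq_zero (δ : N →ₗ[K] B ⊗[K] N) (c : N →ₗ[K] B ⊗[K] N')
    (δ' : N' →ₗ[K] B ⊗[K] N') (n : ℕ) (F : wordMaps K B M)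
    (hF : ∀ l : List B, l.length = n → F.1 l = 0) : insertEval M δ c δ' n F = 0 := by
  induction n generalizing F with
  | zero => rfl
  | succ n ih =>
    ext y
    have h : ∀ (a : B) (l : List B), l.length = n → (shift F a).1 l = 0 :=
      fun a l hl => hF (a :: l) (by simp [hl])
    rw [insertEval_succ, contract_eq_zero (fun a y => ?_), contract_eq_zero (fun a y => ?_)]
    · simp
    · rw [ih _ (h a)]; rfl
    · rw [iterEval_eq_zero _ _ _ (h a)]; rfl

/-- Insertion of a letter on which the word map vanishes. -/
theorem insertEval_letters_eq_zero {ι : Type*} [Fintype ι] (e : ι → B) (q : ι → N →ₗ[K] N')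
    (δ : N →ₗ[K] B ⊗[K] N) {c : N →ₗ[K] B ⊗[K] N'} (hc : ∀ y, c y = ∑ i, e i ⊗ₜ q i y)
    (δ' : N' →ₗ[K] B ⊗[K] N') (n : ℕ) (F : wordMaps K B M)
    (hF : ∀ l l' i, l.length + l'.length + 1 = n → F.1 (l ++ e i :: l') = 0) :
    insertEval M δ c δ' n F = 0 := by
  induction n generalizing F with
  | zero => rfl
  | succ n ih =>
    ext y
    rw [insertEval_succ, hc, map_sum, Finset.sum_eq_zero, contract_eq_zero (fun a y => ?_)]
    · simp
    · rw [ih]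
      · rfl
      · intro l l' i h
        exact hF (a :: l) l' i (by simp only [List.length_cons]; omega)
    · intro i _
      rw [contract_tmul, iterEval_eq_zero]
      · rfl
      · intro l hl
        exact hF [] l i (by simp [hl])

/-- The curvature `δ² + μ₁ δ`. -/
def curvature (d : B →ₗ[K] B) (δ : N →ₗ[K] B ⊗[K] N) : N →ₗ[K] B ⊗[K] N :=
  mulComp δ δ + d.rTensor N ∘ₗ δ

/-- The `A∞` relation, paired with the iterates of `δ`. -/
theorem sum_lift_iterEval [CharP K 2] (op : M →ₗ[K] wordMaps K B M) (d : B →ₗ[K] B)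
    (hop : ∀ x l, splitAt op l (op x) + derivAt d l (op x) + mulAt l (op x) = 0)
    (δ : N →ₗ[K] B ⊗[K] N) (n : ℕ) (x : M) (y : N) :
    ∑ l ∈ Finset.range (n + 1 + 1),
      TensorProduct.lift (iterEval M δ (n + 1 - l) ∘ₗ op) (iterEval M δ l (op x) y) =
    insertEval M δ (d.rTensor N ∘ₗ δ) δ (n + 1) (op x) y +
      insertEval M δ (d.rTensor N ∘ₗ δ) δ n (op x) y +
      insertEval M δ (curvature d δ) δ n (op x) y := by
  have h : split op (op x) + wordMaps.deriv d (op x) + wordMaps.mul (op x) = 0 :=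
    Subtype.ext (funext (hop x))
  have h2 := congrArg (fun F => iterEval M δ (n + 1) F y) h
  simp only [map_add, LinearMap.add_apply, map_zero, LinearMap.zero_apply, iterEval_split,
    iterEval_deriv, iterEval_mul] at h2
  have hchar : ∀ v : M ⊗[K] N, v + v = 0 := fun v => by
    rw [← two_smul K, CharTwo.two_eq_zero, zero_smul]
  rw [curvature, insertEval_add, LinearMap.add_apply, LinearMap.add_apply]
  generalize ∑ l ∈ Finset.range (n + 1 + 1),
      TensorProduct.lift (iterEval M δ (n + 1 - l) ∘ₗ op) (iterEval M δ l (op x) y) = S at *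
  generalize insertEval M δ (d.rTensor N ∘ₗ δ) δ n (op x) y = D0
  generalize insertEval M δ (d.rTensor N ∘ₗ δ) δ (n + 1) (op x) y = D1 at *
  generalize insertEval M δ (mulComp δ δ) δ n (op x) y = P at *
  -- `D0` occurs twice on the right: once alone, for the telescoping, and once to complete `P` to
  -- the insertion of the whole curvature. The doubled terms vanish in characteristic two.
  calc S = (S + D1 + P) + (D1 + D0 + (P + D0)) - (D1 + D1) - (P + P) - (D0 + D0) := by abel
    _ = _ := by rw [h2, hchar, hchar, hchar]; abel

end Along

end Words

/-! ### Pointwise finite sums and the telescoping argument. -/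

section LinearSum

variable {K V V' : Type*} [Field K] [AddCommGroup V] [Module K V] [AddCommGroup V'] [Module K V']

/-- Pointwise eventually zero families of linear maps. -/
def EventuallyZero (f : ℕ → V →ₗ[K] V') : Prop := ∀ v, ∃ n, ∀ k, n ≤ k → f k v = 0

theorem EventuallyZero.support_subset {f : ℕ → V →ₗ[K] V'} {v : V} {n : ℕ}
    (h : ∀ k, n ≤ k → f k v = 0) : (Function.support fun k => f k v) ⊆ Finset.range n := by
  intro k hk
  by_contra hk'
  exact hk (h k (by simpa using hk'))

theorem linearSum_eq_sum {f : ℕ → V →ₗ[K] V'} (hf : EventuallyZero f) {v : V} {n : ℕ}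
    (h : ∀ k, n ≤ k → f k v = 0) : linearSum f v = ∑ k ∈ Finset.range n, f k v := by
  have h1 : ∀ v, (Function.support fun k => f k v).Finite := fun v => by
    obtain ⟨m, hm⟩ := hf v
    exact (Finset.finite_toSet _).subset (EventuallyZero.support_subset hm)
  rw [linearSum, dif_pos h1]
  exact finsum_eq_sum_of_support_subset _ (EventuallyZero.support_subset h)

theorem linearSum_mem {f : ℕ → V →ₗ[K] V'} (hf : EventuallyZero f) {v : V} {p : Submodule K V'}
    (h : ∀ k, f k v ∈ p) : linearSum f v ∈ p := by
  obtain ⟨n, hn⟩ := hf v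
  rw [linearSum_eq_sum hf hn]
  exact p.sum_mem fun k _ => h k

/-- Naturality of pointwise finite sums, for additive maps. -/
theorem linearSum_natural {L U U' : Type*} [Field L] [AddCommGroup U] [Module L U]
    [AddCommGroup U'] [Module L U'] {f : ℕ → V →ₗ[K] V'} {g : ℕ → U →ₗ[L] U'}
    (hf : EventuallyZero f) (hg : EventuallyZero g) (a : V → U) (b : V' →+ U')
    (h : ∀ k v, g k (a v) = b (f k v)) (v : V) : linearSum g (a v) = b (linearSum f v) := by
  obtain ⟨n, hn⟩ := hf v
  rw [linearSum_eq_sum hf hn, linearSum_eq_sum hg (n := n), map_sum]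
  · simp [h]
  · intro k hk
    rw [h, hn k hk, map_zero]

theorem EventuallyZero.exists_forall_finset {f : ℕ → V →ₗ[K] V'} (hf : EventuallyZero f)
    {ι : Type*} (s : Finset ι) (v : ι → V) : ∃ n, ∀ k, n ≤ k → ∀ i ∈ s, f k (v i) = 0 := by
  classical
  choose n hn using hf
  refine ⟨s.sup fun i => n (v i), fun k hk i hi => hn _ _ (le_trans ?_ hk)⟩
  exact Finset.le_sup (f := fun i => n (v i)) hi

/-- Summing `hrel` over n cancels each Q(n) against its second occurrence, so only the last Q
survives, and it vanishes far out. No convergence of the C terms is assumed: the conclusion says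
that their partial sums stabilize. -/
theorem linearSum_linearSum [CharP K 2] {f Q C : ℕ → V →ₗ[K] V} (hf : EventuallyZero f)
    (hQ : EventuallyZero Q) (hQ0 : Q 0 = 0) (h0 : ∀ v, f 0 (f 0 v) = 0)
    (hrel : ∀ n v, ∑ l ∈ Finset.range (n + 1 + 1), f (n + 1 - l) (f l v) =
      Q (n + 1) v + Q n v + C n v) (v : V) :
    ∃ n, ∀ k, n ≤ k → linearSum f (linearSum f v) = ∑ i ∈ Finset.range k, C i v := by
  have hchar : ∀ v : V, v + v = 0 := fun v => by
    rw [← two_smul K, CharTwo.two_eq_zero, zero_smul]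
  have htel : ∀ n, ∑ m ∈ Finset.range (n + 1), ∑ l ∈ Finset.range (m + 1), f (m - l) (f l v) =
      Q n v + ∑ i ∈ Finset.range n, C i v := by
    intro n
    induction n with
    | zero => simp [h0, hQ0]
    | succ n ih =>
      rw [Finset.sum_range_succ, ih, hrel, Finset.sum_range_succ]
      calc _ = Q (n + 1) v + (∑ i ∈ Finset.range n, C i v + C n v) + (Q n v + Q n v) := by abel
        _ = _ := by rw [hchar, add_zero]
  obtain ⟨r1, h1⟩ := hf v
  -- One bound for the outer map, valid for all of the finitely many inner values f l v that can be
  -- nonzero.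
  obtain ⟨r2, h2⟩ := hf.exists_forall_finset (Finset.range r1) (fun l => f l v)
  obtain ⟨r3, h3⟩ := hQ v
  refine ⟨max (r1 + r2) r3, fun n hn => ?_⟩
  have e1 := htel n
  rw [h3 n ((le_max_right _ _).trans hn), zero_add] at e1
  -- The antidiagonals with index at most n form a triangle. For n ≥ r1 + r2 it contains the
  -- rectangle that carries all nonzero terms f k (f l v).
  rw [← e1, Finset.sum_range_diag_flip (n + 1) fun l k => f k (f l v), linearSum_eq_sum hf h1,
    map_sum]
  have hn1 : r1 + r2 ≤ n := (le_max_left _ _).trans hn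
  refine Eq.trans ?_ (Finset.sum_subset (s₁ := Finset.range r1) ?_ ?_)
  · refine Finset.sum_congr rfl fun l hl => ?_
    apply linearSum_eq_sum hf
    intro k hk
    have := Finset.mem_range.1 hl
    exact h2 k (by omega) l hl
  · intro l hl
    have := Finset.mem_range.1 hl
    exact Finset.mem_range.2 (by omega)
  · intro l _ hl
    rw [h1 l (by simpa using hl)]
    simp

theorem EventuallyZero.of_tmul {U : Type*} [AddCommGroup U] [Module K U] {f : ℕ → V ⊗[K] V' →ₗ[K] U}
    (h : ∀ x y, ∃ n, ∀ k, n ≤ k → f k (x ⊗ₜ y) = 0) : EventuallyZero f := by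
  intro v
  induction v using TensorProduct.induction_on with
  | zero => exact ⟨0, fun k _ => map_zero _⟩
  | tmul x y => exact h x y
  | add z w hz hw =>
    obtain ⟨n, hn⟩ := hz
    obtain ⟨m, hm⟩ := hw
    refine ⟨max n m, fun k hk => ?_⟩
    rw [map_add, hn k (le_trans (le_max_left _ _) hk),
      hm k (le_trans (le_max_right _ _) hk), add_zero]

end LinearSum

/-! ### Words in the tensor algebra, extended at either end. -/

section Append

variable {K B N N' M : Type*} [Field K] [Ring B] [Algebra K B] [AddCommGroup N] [Module K N]
  [AddCommGroup N'] [Module K N'] [AddCommGroup M] [Module K M]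

open wordMaps

/-- The map `t ⊗ y ↦ t f(y)` which appends the letter produced by `f`. -/
def append (f : N →ₗ[K] B ⊗[K] N') :
    TensorAlgebra K B ⊗[K] N →ₗ[K] TensorAlgebra K B ⊗[K] N' :=
  (LinearMap.mul' K (TensorAlgebra K B) ∘ₗ
      (TensorAlgebra.ι K).lTensor (TensorAlgebra K B)).rTensor N' ∘ₗ
    (TensorProduct.assoc K (TensorAlgebra K B) B N').symm.toLinearMap ∘ₗ
      f.lTensor (TensorAlgebra K B)

/-- The map `a ⊗ y ↦ a Φ(y)`. -/
def prepend (Φ : N →ₗ[K] TensorAlgebra K B ⊗[K] N') :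
    B ⊗[K] N →ₗ[K] TensorAlgebra K B ⊗[K] N' :=
  TensorProduct.lift (LinearMap.mk₂ K
    (fun a y => (LinearMap.mulLeft K (TensorAlgebra.ι K a)).rTensor N' (Φ y))
    (fun a b y => by
      have : LinearMap.mulLeft K (TensorAlgebra.ι K (a + b)) =
        LinearMap.mulLeft K (TensorAlgebra.ι K a) + LinearMap.mulLeft K (TensorAlgebra.ι K b) := by
        ext; simp [add_mul]
      rw [this, LinearMap.rTensor_add, LinearMap.add_apply])
    (fun c a y => by
      have : LinearMap.mulLeft K (TensorAlgebra.ι K (c • a)) =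
        c • LinearMap.mulLeft K (TensorAlgebra.ι K a) := by
        ext; simp
      rw [this, LinearMap.rTensor_smul, LinearMap.smul_apply])
    (fun a y z => by simp) (fun c a y => by simp))

@[simp] theorem prepend_tmul (Φ : N →ₗ[K] TensorAlgebra K B ⊗[K] N') (a : B) (y : N) :
    prepend Φ (a ⊗ₜ y) = (LinearMap.mulLeft K (TensorAlgebra.ι K a)).rTensor N' (Φ y) := rfl

theorem prepend_add (Φ Ψ : N →ₗ[K] TensorAlgebra K B ⊗[K] N') :
    prepend (Φ + Ψ) = prepend Φ + prepend Ψ := by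
  ext a y; simp

theorem prepend_zero : prepend (0 : N →ₗ[K] TensorAlgebra K B ⊗[K] N') = 0 := by
  ext a y; simp

theorem append_mulLeft (f : N →ₗ[K] B ⊗[K] N') (t : TensorAlgebra K B)
    (z : TensorAlgebra K B ⊗[K] N) :
    append f ((LinearMap.mulLeft K t).rTensor N z) =
      (LinearMap.mulLeft K t).rTensor N' (append f z) := by
  induction z using TensorProduct.induction_on with
  | zero => simp
  | tmul u y =>
    simp only [append, LinearMap.comp_apply, LinearMap.rTensor_tmul, LinearMap.lTensor_tmul]
    generalize f y = w
    induction w using TensorProduct.induction_on with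
    | zero => simp
    | tmul a y => simp [mul_assoc]
    | add s t hs ht => simp only [map_add, TensorProduct.tmul_add, hs, ht]
  | add s t hs ht => simp only [map_add, hs, ht]

/-- The two operations act on opposite ends of the word, so they commute by associativity of the
product in the tensor algebra. -/
theorem append_prepend (f : N' →ₗ[K] B ⊗[K] M) (Φ : N →ₗ[K] TensorAlgebra K B ⊗[K] N')
    (w : B ⊗[K] N) : append f (prepend Φ w) = prepend (append f ∘ₗ Φ) w := by
  induction w using TensorProduct.induction_on with
  | zero => simp
  | tmul a y => simp [append_mulLeft]
  | add s t hs ht => simp only [map_add, hs, ht]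

theorem append_one (f : N →ₗ[K] B ⊗[K] N') (y : N) :
    append f ((1 : TensorAlgebra K B) ⊗ₜ[K] y) =
      prepend (TensorProduct.mk K (TensorAlgebra K B) N' 1) (f y) := by
  simp only [append, LinearMap.comp_apply, LinearMap.lTensor_tmul]
  generalize f y = w
  induction w using TensorProduct.induction_on with
  | zero => simp
  | tmul a y => simp
  | add s t hs ht => simp only [map_add, TensorProduct.tmul_add, hs, ht]

/-- The word map given by a linear map on the tensor algebra. -/
def wordMap : (TensorAlgebra K B →ₗ[K] M) →ₗ[K] wordMaps K B M where
  toFun G := ⟨fun l => G (l.map (TensorAlgebra.ι K)).prod,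
    fun l a b l' => by simp [mul_add, add_mul], fun l c a l' => by simp⟩
  map_add' _ _ := rfl
  map_smul' _ _ := rfl

theorem wordMap_apply (G : TensorAlgebra K B →ₗ[K] M) (l : List B) :
    (wordMap G).1 l = G (l.map (TensorAlgebra.ι K)).prod := rfl

theorem shift_wordMap (G : TensorAlgebra K B →ₗ[K] M) (a : B) :
    shift (wordMap G) a = wordMap (G ∘ₗ LinearMap.mulLeft K (TensorAlgebra.ι K a)) :=
  Subtype.ext (funext fun l => by simp [wordMap_apply])

theorem rTensor_prepend {Φ : N →ₗ[K] TensorAlgebra K B ⊗[K] N'}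
    {Ψ : wordMaps K B M →ₗ[K] N →ₗ[K] M ⊗[K] N'}
    (h : ∀ (G : TensorAlgebra K B →ₗ[K] M) y, G.rTensor N' (Φ y) = Ψ (wordMap G) y)
    (G : TensorAlgebra K B →ₗ[K] M) (w : B ⊗[K] N) :
    G.rTensor N' (prepend Φ w) = contract Ψ (wordMap G) w := by
  induction w using TensorProduct.induction_on with
  | zero => simp
  | tmul a y => simp [shift_wordMap, ← h, LinearMap.rTensor_comp_apply]
  | add s t hs ht => simp only [map_add, hs, ht]

end Append

/-! ### The box operator and its square. -/

section Structures

variable {Γ : Type*} [AddCommGroup Γ] {s : Γ} {A : DGA Γ s} {K : Type*} [Field K]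
  [Algebra (ZMod 2) K]

namespace DData

variable (N : DData A K)

theorem Δ_zero_apply (y : N.carrier) : N.Δ 0 y = 1 ⊗ₜ y := rfl

theorem Δ_succ (n : ℕ) : N.Δ (n + 1) = append N.δ ∘ₗ N.Δ n := rfl

/-- The definition of `Δ` adds letters on the right, while `iterEval` reads them from the left. This
reconciles the two recursions. -/
theorem Δ_succ_left (n : ℕ) (y : N.carrier) : N.Δ (n + 1) y = prepend (N.Δ n) (N.δ y) := by
  induction n with
  | zero => exact append_one N.δ y
  | succ n ih => rw [Δ_succ, LinearMap.comp_apply, ih, append_prepend, Δ_succ]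

/-- The iterates of `δ`, with one application of `c` inserted. -/
def insertΔ (c : N.carrier →ₗ[K] A.ext K ⊗[K] N.carrier) :
    ℕ → N.carrier →ₗ[K] TensorAlgebra K (A.ext K) ⊗[K] N.carrier
  | 0 => 0
  | n + 1 => append N.δ ∘ₗ insertΔ c n + append c ∘ₗ N.Δ n

theorem append_Δ (c : N.carrier →ₗ[K] A.ext K ⊗[K] N.carrier) (n : ℕ) (y : N.carrier) :
    append c (N.Δ (n + 1) y) = prepend (append c ∘ₗ N.Δ n) (N.δ y) := by
  rw [Δ_succ_left, append_prepend]

theorem insertΔ_succ_left (c : N.carrier →ₗ[K] A.ext K ⊗[K] N.carrier) (n : ℕ) (y : N.carrier) :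
    N.insertΔ c (n + 1) y = prepend (N.Δ n) (c y) + prepend (N.insertΔ c n) (N.δ y) := by
  induction n with
  | zero =>
    simp only [insertΔ, LinearMap.comp_zero, zero_add, LinearMap.comp_apply, prepend_zero,
      LinearMap.zero_apply, add_zero]
    exact append_one c y
  | succ n ih =>
    rw [insertΔ, LinearMap.add_apply, LinearMap.comp_apply, LinearMap.comp_apply, ih, map_add,
      append_prepend, append_prepend, append_Δ, insertΔ, prepend_add, Δ_succ, LinearMap.add_apply]
    abel

variable {M : Type*} [AddCommGroup M] [Module K M]

theorem rTensor_Δ (n : ℕ) (G : TensorAlgebra K (A.ext K) →ₗ[K] M) (y : N.carrier) :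
    G.rTensor N.carrier (N.Δ n y) = iterEval M N.δ n (wordMap G) y := by
  induction n generalizing G y with
  | zero => simp [Δ_zero_apply, iterEval_zero, wordMap_apply]
  | succ n ih => rw [Δ_succ_left, iterEval_succ, rTensor_prepend ih]

/-- Boundedness of N concerns the tensors Δₖ(y) themselves; through this identity it also reaches
the insertion terms, which are defined by evaluating word maps. -/
theorem rTensor_insertΔ (c : N.carrier →ₗ[K] A.ext K ⊗[K] N.carrier) (n : ℕ)
    (G : TensorAlgebra K (A.ext K) →ₗ[K] M) (y : N.carrier) :
    G.rTensor N.carrier (N.insertΔ c n y) = insertEval M N.δ c N.δ n (wordMap G) y := by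
  induction n generalizing G y with
  | zero => simp [insertΔ, insertEval_zero]
  | succ n ih =>
    rw [insertΔ_succ_left, insertEval_succ, map_add, rTensor_prepend ih,
      rTensor_prepend (N.rTensor_Δ n)]

variable {N}

theorem append_iterate_tmul (n : ℕ) (t : TensorAlgebra K (A.ext K)) (y : N.carrier) :
    (append N.δ)^[n] (t ⊗ₜ y) = (LinearMap.mulLeft K t).rTensor N.carrier (N.Δ n y) := by
  induction n with
  | zero => simp [Δ_zero_apply]
  | succ n ih => rw [Function.iterate_succ_apply', ih, Δ_succ, LinearMap.comp_apply, append_mulLeft]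

/-- On t ⊗ y the iterates are t · Δₖ(y), and a tensor is a finite sum of such, so a maximum of
finitely many bounds suffices. -/
theorem Bounded.append_iterate (h : N.Bounded) (z : TensorAlgebra K (A.ext K) ⊗[K] N.carrier) :
    ∃ n, ∀ k, n ≤ k → (append N.δ)^[k] z = 0 := by
  induction z using TensorProduct.induction_on with
  | zero => exact ⟨0, fun k _ => Function.iterate_fixed (map_zero _) k⟩
  | tmul t y =>
    obtain ⟨n, hn⟩ := h y
    exact ⟨n, fun k hk => by rw [append_iterate_tmul, hn k hk, map_zero]⟩
  | add z w hz hw =>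
    obtain ⟨n, hn⟩ := hz
    obtain ⟨m, hm⟩ := hw
    refine ⟨max n m, fun k hk => ?_⟩
    rw [iterate_map_add, hn k (le_trans (le_max_left _ _) hk),
      hm k (le_trans (le_max_right _ _) hk), add_zero]

/-- Once Δₙ(y) = 0, the map c has nothing left to act on. The later terms are iterates of δ on one
fixed tensor, and these die out. -/
theorem Bounded.insertΔ (h : N.Bounded) (c : N.carrier →ₗ[K] A.ext K ⊗[K] N.carrier)
    (y : N.carrier) : ∃ n, ∀ k, n ≤ k → N.insertΔ c k y = 0 := by
  obtain ⟨n, hn⟩ := h y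
  have key : ∀ k, N.insertΔ c (n + k) y = (append N.δ)^[k] (N.insertΔ c n y) := by
    intro k
    induction k with
    | zero => rfl
    | succ k ih =>
      rw [← Nat.add_assoc, DData.insertΔ, LinearMap.add_apply, LinearMap.comp_apply,
        LinearMap.comp_apply, hn (n + k) (by omega), map_zero, add_zero, ih,
        Function.iterate_succ_apply']
  obtain ⟨m, hm⟩ := h.append_iterate (N.insertΔ c n y)
  refine ⟨n + m, fun k hk => ?_⟩
  obtain ⟨j, rfl⟩ := Nat.exists_eq_add_of_le (show n ≤ k by omega)
  rw [key, hm j (by omega)]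

end DData

namespace AData

variable (M : AData A K)

/-- The operations as word maps. -/
def opWord : M.carrier →ₗ[K] wordMaps K (A.ext K) M.carrier := wordMap ∘ₗ M.m

@[simp] theorem opWord_apply (x : M.carrier) (l : List (A.ext K)) : (M.opWord x).1 l = M.op x l :=
  rfl

variable {M}

theorem IsAInfty.relation_words (hM : M.IsAInfty) (x : M.carrier) (l : List (A.ext K)) :
    wordMaps.splitAt M.opWord l (M.opWord x) + wordMaps.derivAt (A.dExt K) l (M.opWord x) +
      wordMaps.mulAt l (M.opWord x) = 0 := by
  rw [wordMaps.splitAt_eq_sum, wordMaps.derivAt_eq_sum, wordMaps.mulAt_eq_sum]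
  exact hM.relation x l

end AData

theorem boxTerm_tmul (M : AData A K) (N : DData A K) (k : ℕ) (x : M.carrier) (y : N.carrier) :
    boxTerm M N k (x ⊗ₜ y) = iterEval M.carrier N.δ k (M.opWord x) y := by
  have : boxTerm M N k (x ⊗ₜ y) = (M.m x).rTensor N.carrier (N.Δ k y) := by
    simp only [boxTerm, LinearMap.comp_apply, LinearMap.lTensor_tmul]
    generalize N.Δ k y = w
    induction w using TensorProduct.induction_on with
    | zero => simp
    | tmul a y => simp
    | add s t hs ht => simp only [map_add, TensorProduct.tmul_add, hs, ht]
  rw [this, DData.rTensor_Δ]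
  rfl

theorem boxTerm_eq_lift (M : AData A K) (N : DData A K) (k : ℕ) :
    boxTerm M N k = TensorProduct.lift (iterEval M.carrier N.δ k ∘ₗ M.opWord) := by
  ext x y
  simp [boxTerm_tmul]

/-- The sum over the words of length `k` produced by the iterates of `δ` with one application of
`c` inserted. -/
def insertTerm (M : AData A K) (N : DData A K) (c : N.carrier →ₗ[K] A.ext K ⊗[K] N.carrier)
    (k : ℕ) : M.carrier ⊗[K] N.carrier →ₗ[K] M.carrier ⊗[K] N.carrier :=
  TensorProduct.lift (insertEval M.carrier N.δ c N.δ k ∘ₗ M.opWord)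

@[simp] theorem insertTerm_tmul (M : AData A K) (N : DData A K)
    (c : N.carrier →ₗ[K] A.ext K ⊗[K] N.carrier) (k : ℕ) (x : M.carrier) (y : N.carrier) :
    insertTerm M N c k (x ⊗ₜ y) = insertEval M.carrier N.δ c N.δ k (M.opWord x) y := rfl

/-- Either the operations vanish on long words, or no long words are produced. Without this
`linearSum` could take its default value zero. -/
theorem eventuallyZero_boxTerm {M : AData A K} {N : DData A K} (h : M.Bounded ∨ N.Bounded) :
    EventuallyZero (boxTerm M N) := by
  refine EventuallyZero.of_tmul fun x y => ?_
  rcases h with h | h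
  · obtain ⟨n, hn⟩ := h x
    refine ⟨n, fun k hk => ?_⟩
    rw [boxTerm_tmul, iterEval_eq_zero _ _ _ fun l hl => hn l (hl ▸ hk), LinearMap.zero_apply]
  · obtain ⟨n, hn⟩ := h y
    refine ⟨n, fun k hk => ?_⟩
    rw [boxTerm_tmul, AData.opWord, LinearMap.comp_apply, ← DData.rTensor_Δ, hn k hk, map_zero]

theorem eventuallyZero_insertTerm {M : AData A K} {N : DData A K} (h : M.Bounded ∨ N.Bounded)
    (c : N.carrier →ₗ[K] A.ext K ⊗[K] N.carrier) : EventuallyZero (insertTerm M N c) := by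
  refine EventuallyZero.of_tmul fun x y => ?_
  rcases h with h | h
  · obtain ⟨n, hn⟩ := h x
    refine ⟨n, fun k hk => ?_⟩
    rw [insertTerm_tmul, insertEval_eq_zero _ _ _ _ _ fun l hl => hn l (hl ▸ hk),
      LinearMap.zero_apply]
  · obtain ⟨n, hn⟩ := h.insertΔ c y
    refine ⟨n, fun k hk => ?_⟩
    rw [insertTerm_tmul, AData.opWord, LinearMap.comp_apply, ← DData.rTensor_insertΔ, hn k hk,
      map_zero]

/-- The operator `∑ₖ (m_{k+1} ⊗ 1)(1 ⊗ Δₖ)` on `M ⊗_K N`. -/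
def boxD (M : AData A K) (N : DData A K) :
    M.carrier ⊗[K] N.carrier →ₗ[K] M.carrier ⊗[K] N.carrier := linearSum (boxTerm M N)

theorem charP_two_of_algebra (K : Type*) [Field K] [Algebra (ZMod 2) K] : CharP K 2 :=
  charP_of_injective_algebraMap (algebraMap (ZMod 2) K).injective 2

/-- The square of `boxD` is computed by the curvature of `δ`. -/
theorem boxD_boxD {M : AData A K} (hM : M.IsAInfty) {N : DData A K} (h : M.Bounded ∨ N.Bounded)
    (v : M.carrier ⊗[K] N.carrier) :
    ∃ n, ∀ k, n ≤ k → boxD M N (boxD M N v) =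
      ∑ i ∈ Finset.range k, insertTerm M N (curvature (A.dExt K) N.δ) i v := by
  have := charP_two_of_algebra K
  refine linearSum_linearSum (eventuallyZero_boxTerm h)
    (eventuallyZero_insertTerm h ((A.dExt K).rTensor N.carrier ∘ₗ N.δ)) ?_ ?_ ?_ v
  · ext; simp [insertEval_zero]
  · intro v
    induction v using TensorProduct.induction_on with
    | zero => simp
    | tmul x y =>
      -- The telescoping starts from m₁m₁ = 0, the `A∞` relation of the empty word.
      have := hM.relation_words x []
      simp only [wordMaps.splitAt, wordMaps.derivAt, wordMaps.mulAt, LinearMap.comp_apply,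
        wordMaps.evalAt_apply, AData.opWord_apply, LinearMap.zero_apply, add_zero] at this
      simp [boxTerm_tmul, iterEval_zero, this]
    | add s t hs ht => simp [hs, ht]
  · intro n v
    induction v using TensorProduct.induction_on with
    | zero => simp
    | tmul x y =>
      simp only [insertTerm_tmul, boxTerm_eq_lift]
      exact sum_lift_iterEval M.opWord (A.dExt K) hM.relation_words N.δ n x y
    | add s t hs ht =>
      simp only [map_add, Finset.sum_add_distrib, hs, ht]; abel

end Structures

/-! ### The projection onto the tensor product over the idempotents. -/

section TensorI

variable {ι K M N M' N' : Type*} [Fintype ι] [Field K] [AddCommGroup M] [Module K M]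
  [AddCommGroup N] [Module K N] [AddCommGroup M'] [Module K M'] [AddCommGroup N'] [Module K N']

@[simp] theorem tensorProj_tmul (p : ι → Module.End K M) (q : ι → Module.End K N) (x : M) (y : N) :
    tensorProj p q (x ⊗ₜ[K] y) = ∑ i, p i x ⊗ₜ q i y := by
  simp [tensorProj]

theorem tensorProj_tensorProj {p : ι → Module.End K M} {q : ι → Module.End K N}
    (hp : CompleteOrthogonalIdempotents p) (hq : CompleteOrthogonalIdempotents q) (v : M ⊗[K] N) :
    tensorProj p q (tensorProj p q v) = tensorProj p q v := by
  classical
  induction v using TensorProduct.induction_on with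
  | zero => simp
  | tmul x y =>
    simp only [tensorProj_tmul, map_sum]
    refine Finset.sum_congr rfl fun i _ => ?_
    rw [Finset.sum_eq_single i]
    · rw [show p i (p i x) = p i x from LinearMap.congr_fun (hp.idem i) x,
        show q i (q i y) = q i y from LinearMap.congr_fun (hq.idem i) y]
    · intro j _ hj
      rw [show p j (p i x) = 0 from LinearMap.congr_fun (hp.ortho hj) x, TensorProduct.zero_tmul]
    · simp
  | add s t hs ht => simp only [map_add, hs, ht]

theorem tensorProj_of_mem {p : ι → Module.End K M} {q : ι → Module.End K N}
    (hp : CompleteOrthogonalIdempotents p) (hq : CompleteOrthogonalIdempotents q) {v : M ⊗[K] N}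
    (hv : v ∈ tensorI p q) : tensorProj p q v = v := by
  obtain ⟨w, rfl⟩ := hv
  exact tensorProj_tensorProj hp hq w

theorem tensorProj_lTensor {p : ι → Module.End K M} {q : ι → Module.End K N}
    {q' : ι → Module.End K N'} {f : N →ₗ[K] N'} (hf : ∀ i y, f (q i y) = q' i (f y))
    (v : M ⊗[K] N) :
    tensorProj p q' (f.lTensor M v) = f.lTensor M (tensorProj p q v) := by
  induction v using TensorProduct.induction_on with
  | zero => simp
  | tmul x y => simp [hf]
  | add s t hs ht => simp only [map_add, hs, ht]

end TensorI

/-! ### The total grading of a tensor product. -/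

section TensorGr

variable {Γ K M N M' N' : Type*} [AddCommGroup Γ] [Field K] [AddCommGroup M] [Module K M]
  [AddCommGroup N] [Module K N] [AddCommGroup M'] [Module K M'] [AddCommGroup N'] [Module K N']
  {gM : Γ → Submodule K M} {gN : Γ → Submodule K N} {gM' : Γ → Submodule K M'}
  {gN' : Γ → Submodule K N'}

theorem tensorGr_eq_span (gM : Γ → Submodule K M) (gN : Γ → Submodule K N) (k : Γ) :
    tensorGr gM gN k = Submodule.span K
      {t | ∃ i j, i + j = k ∧ ∃ x ∈ gM i, ∃ y ∈ gN j, t = x ⊗ₜ[K] y} := by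
  apply le_antisymm
  · refine iSup_le fun i => iSup_le fun j => iSup_le fun hij => ?_
    rintro _ ⟨v, rfl⟩
    induction v using TensorProduct.induction_on with
    | zero => simp
    | tmul x y =>
      exact Submodule.subset_span ⟨i, j, hij, x, x.2, y, y.2, by simp [TensorProduct.mapIncl]⟩
    | add s t hs ht => rw [map_add]; exact Submodule.add_mem _ hs ht
  · rw [Submodule.span_le]
    rintro _ ⟨i, j, hij, x, hx, y, hy, rfl⟩
    refine Submodule.mem_iSup_of_mem i (Submodule.mem_iSup_of_mem j
      (Submodule.mem_iSup_of_mem hij ⟨⟨x, hx⟩ ⊗ₜ ⟨y, hy⟩, by simp [TensorProduct.mapIncl]⟩))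

theorem tmul_mem_tensorGr {i j k : Γ} (h : i + j = k) {x : M} (hx : x ∈ gM i) {y : N}
    (hy : y ∈ gN j) : x ⊗ₜ[K] y ∈ tensorGr gM gN k := by
  rw [tensorGr_eq_span]
  exact Submodule.subset_span ⟨i, j, h, x, hx, y, hy, rfl⟩

/-- A linear map sends `tensorGr` into a subspace if it does so on homogeneous pure tensors. -/
theorem map_mem_of_mem_tensorGr {V : Type*} [AddCommGroup V] [Module K V] {f : M ⊗[K] N →ₗ[K] V}
    {p : Submodule K V} {k : Γ}
    (h : ∀ i j, i + j = k → ∀ x ∈ gM i, ∀ y ∈ gN j, f (x ⊗ₜ y) ∈ p) {v : M ⊗[K] N}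
    (hv : v ∈ tensorGr gM gN k) : f v ∈ p := by
  rw [tensorGr_eq_span] at hv
  have : Submodule.span K {t | ∃ i j, i + j = k ∧ ∃ x ∈ gM i, ∃ y ∈ gN j, t = x ⊗ₜ[K] y} ≤
      p.comap f := by
    rw [Submodule.span_le]
    rintro _ ⟨i, j, hij, x, hx, y, hy, rfl⟩
    exact h i j hij x hx y hy
  exact this hv

theorem lTensor_mem_tensorGr {f : N →ₗ[K] N'} {e : Γ} (hf : ∀ g, ∀ y ∈ gN g, f y ∈ gN' (g + e))
    {k : Γ} {v : M ⊗[K] N} (hv : v ∈ tensorGr gM gN k) :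
    f.lTensor M v ∈ tensorGr gM gN' (k + e) :=
  map_mem_of_mem_tensorGr (fun i j hij x hx y hy =>
    tmul_mem_tensorGr (by rw [← hij, add_assoc]) hx (hf j y hy)) hv

theorem tensorProj_mem_tensorGr {ι : Type*} [Fintype ι] {p : ι → Module.End K M}
    {q : ι → Module.End K N} (hp : ∀ i g, ∀ x ∈ gM g, p i x ∈ gM g)
    (hq : ∀ i g, ∀ x ∈ gN g, q i x ∈ gN g) {k : Γ} {v : M ⊗[K] N} (hv : v ∈ tensorGr gM gN k) :
    tensorProj p q v ∈ tensorGr gM gN k :=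
  map_mem_of_mem_tensorGr (fun i j hij x hx y hy => by
    rw [tensorProj_tmul]
    exact Submodule.sum_mem _ fun l _ => tmul_mem_tensorGr hij (hp l i x hx) (hq l j y hy)) hv

end TensorGr

/-! ### The box operator against idempotents, gradings and the unit. -/

section Structures

variable {Γ : Type*} [AddCommGroup Γ] {s : Γ} {A : DGA Γ s} {K : Type*} [Field K]
  [Algebra (ZMod 2) K]

open wordMaps

namespace DGA

theorem eExt_mul_self (A : DGA Γ s) (K : Type*) [Field K] [Algebra (ZMod 2) K] (i : A.idx) :
    A.eExt K i * A.eExt K i = A.eExt K i := by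
  simp only [eExt, Algebra.TensorProduct.tmul_mul_tmul, mul_one]
  rw [(A.e_idem.idem i).eq]

theorem sum_eExt (A : DGA Γ s) (K : Type*) [Field K] [Algebra (ZMod 2) K] :
    ∑ i, A.eExt K i = 1 := by
  simp only [eExt, ← TensorProduct.tmul_sum, A.e_idem.complete]
  rfl

theorem sum_eLeft (A : DGA Γ s) (K : Type*) [Field K] [Algebra (ZMod 2) K] :
    ∑ i, A.eLeft K i = LinearMap.id := by
  ext x
  simp [eLeft, ← Finset.sum_mul, sum_eExt]

end DGA

variable {M : AData A K} {N : DData A K}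

theorem boxTerm_zero_tmul (M : AData A K) (N : DData A K) (x : M.carrier) (y : N.carrier) :
    boxTerm M N 0 (x ⊗ₜ y) = M.op x [] ⊗ₜ y := by
  rw [boxTerm_tmul, iterEval_zero, AData.opWord_apply]

theorem shift_opWord_proj (hM : M.IsAInfty) (i : A.idx) (x : M.carrier) (a : A.ext K) :
    shift (M.opWord (M.proj i x)) a = shift (M.opWord x) (A.eExt K i * a) :=
  Subtype.ext (funext fun l => hM.balanced_left x i a l)

/-- With at least one letter, the idempotents on x and on y both move onto the first letter, where
eᵢeᵢ = eᵢ; then ∑ eᵢ = 1 removes them. -/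
theorem boxTerm_succ_tensorProj (hM : M.IsAInfty)
    (hδ : ∀ i y, N.δ (N.proj i y) = (A.eLeft K i).rTensor N.carrier (N.δ y)) (n : ℕ)
    (v : M.carrier ⊗[K] N.carrier) :
    boxTerm M N (n + 1) (tensorProj M.proj N.proj v) = boxTerm M N (n + 1) v := by
  induction v using TensorProduct.induction_on with
  | zero => simp
  | tmul x y =>
    have key : ∀ i, boxTerm M N (n + 1) (M.proj i x ⊗ₜ N.proj i y) =
        contract (iterEval M.carrier N.δ n) (M.opWord x)
          ((A.eLeft K i).rTensor N.carrier (N.δ y)) := by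
      intro i
      rw [boxTerm_tmul, iterEval_succ, hδ]
      generalize N.δ y = t
      induction t using TensorProduct.induction_on with
      | zero => simp
      | tmul a z =>
        simp only [LinearMap.rTensor_tmul, contract_tmul, shift_opWord_proj hM, DGA.eLeft,
          LinearMap.mulLeft_apply]
        rw [← mul_assoc, DGA.eExt_mul_self]
      | add s t hs ht => simp only [map_add, hs, ht]
    rw [tensorProj_tmul, map_sum]
    simp only [key]
    rw [← map_sum, ← LinearMap.sum_apply, boxTerm_tmul, iterEval_succ]
    congr 1
    have := congrArg (fun f : A.ext K →ₗ[K] A.ext K => f.rTensor N.carrier (N.δ y)) (A.sum_eLeft K)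
    simp only [LinearMap.rTensor_id, LinearMap.id_apply] at this
    refine Eq.trans ?_ this
    simp only [← LinearMap.coe_rTensorHom, map_sum]
  | add s t hs ht => simp only [map_add, hs, ht]

/-- The last letter and the element of N after it lie in the tensor product over I. By `hF` the
idempotent on that letter moves to the output in M, so the result is already projected. -/
theorem tensorProj_iterEval_succ (hp : CompleteOrthogonalIdempotents M.proj)
    (hq : CompleteOrthogonalIdempotents N.proj)
    (hδ : ∀ y, N.δ y ∈ tensorI (A.eRight K) N.proj) (n : ℕ)
    (F : wordMaps K (A.ext K) M.carrier)
    (hF : ∀ l a i, F.1 (l ++ [a * A.eExt K i]) = M.proj i (F.1 (l ++ [a]))) (y : N.carrier) :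
    tensorProj M.proj N.proj (iterEval M.carrier N.δ (n + 1) F y) =
      iterEval M.carrier N.δ (n + 1) F y := by
  induction n generalizing F y with
  | zero =>
    obtain ⟨w, hw⟩ := hδ y
    have key : ∀ w, contract (iterEval M.carrier N.δ 0) F (tensorProj (A.eRight K) N.proj w) =
        tensorProj M.proj N.proj (contract (iterEval M.carrier N.δ 0) F w) := by
      intro w
      induction w using TensorProduct.induction_on with
      | zero => simp
      | tmul a z =>
        simp only [tensorProj_tmul, map_sum, contract_tmul, iterEval_zero, shift_apply]
        exact Finset.sum_congr rfl fun i _ => congrArg (· ⊗ₜ[K] _) (hF [] a i)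
      | add s t hs ht =>
        simp only [map_add, hs, ht]
    rw [iterEval_succ, ← hw, key, tensorProj_tensorProj hp hq]
  | succ n ih =>
    rw [iterEval_succ]
    generalize N.δ y = t
    induction t using TensorProduct.induction_on with
    | zero => simp
    | tmul a z => exact ih _ (fun l b i => hF (a :: l) b i) z
    | add s t hs ht => simp only [map_add, hs, ht]

theorem tensorProj_boxTerm_succ (hM : M.IsAInfty) (hq : CompleteOrthogonalIdempotents N.proj)
    (hδ : ∀ y, N.δ y ∈ tensorI (A.eRight K) N.proj) (n : ℕ) (v : M.carrier ⊗[K] N.carrier) :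
    tensorProj M.proj N.proj (boxTerm M N (n + 1) v) = boxTerm M N (n + 1) v := by
  induction v using TensorProduct.induction_on with
  | zero => simp
  | tmul x y =>
    rw [boxTerm_tmul]
    exact tensorProj_iterEval_succ hM.proj_idem hq hδ n _ (hM.map_proj x) y
  | add s t hs ht => simp only [map_add, hs, ht]

theorem tensorProj_boxTerm (hM : M.IsAInfty) (hq : CompleteOrthogonalIdempotents N.proj)
    {c : Γ} (hδ : DData.IsGradedMap N N c N.δ) (n : ℕ) (v : M.carrier ⊗[K] N.carrier) :
    tensorProj M.proj N.proj (boxTerm M N n v) = boxTerm M N n (tensorProj M.proj N.proj v) := by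
  cases n with
  | zero =>
    induction v using TensorProduct.induction_on with
    | zero => simp
    | tmul x y => simp [boxTerm_zero_tmul, hM.map_proj_one]
    | add s t hs ht => simp only [map_add, hs, ht]
  | succ n =>
    rw [tensorProj_boxTerm_succ hM hq hδ.mem_tensorI, boxTerm_succ_tensorProj hM hδ.map_proj]

theorem tensorProj_boxD (hM : M.IsAInfty) (hq : CompleteOrthogonalIdempotents N.proj)
    {c : Γ} (hδ : DData.IsGradedMap N N c N.δ) (h : M.Bounded ∨ N.Bounded)
    (v : M.carrier ⊗[K] N.carrier) :
    tensorProj M.proj N.proj (boxD M N v) = boxD M N (tensorProj M.proj N.proj v) :=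
  (linearSum_natural (eventuallyZero_boxTerm h) (eventuallyZero_boxTerm h)
    (tensorProj M.proj N.proj) (tensorProj M.proj N.proj).toAddMonoidHom
    (fun k v => (tensorProj_boxTerm hM hq hδ k v).symm) v).symm

/-- Word maps that are homogeneous of degree `i` up to the shift by the length of the word. -/
def IsHomogeneousWord (M : AData A K) (i : Γ) (F : wordMaps K (A.ext K) M.carrier) : Prop :=
  ∀ l : List (Γ × A.ext K), (∀ p ∈ l, p.2 ∈ A.grExt K p.1) →
    F.1 (l.map Prod.snd) ∈ M.gr (i + (l.map Prod.fst).sum + l.length • s)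

theorem isHomogeneousWord_opWord (hM : M.IsAInfty) {g : Γ} {x : M.carrier} (hx : x ∈ M.gr g) :
    IsHomogeneousWord M (g - s) (M.opWord x) := by
  intro l hl
  have := hM.degree g x hx l hl
  rw [sub_smul, one_smul, natCast_zsmul] at this
  rw [AData.opWord_apply]
  convert this using 2
  abel

theorem IsHomogeneousWord.shift {i h : Γ} {F : wordMaps K (A.ext K) M.carrier}
    (hF : IsHomogeneousWord M i F) {a : A.ext K} (ha : a ∈ A.grExt K h) :
    IsHomogeneousWord M (i + h + s) (shift F a) := by
  intro l hl
  have := hF ((h, a) :: l) (by simpa using ⟨ha, fun p q hp => hl (p, q) hp⟩)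
  rw [shift_apply, show a :: l.map Prod.snd = ((h, a) :: l).map Prod.snd from rfl]
  convert this using 2
  simp only [List.map_cons, List.sum_cons, List.length_cons, succ_nsmul]
  abel

/-- Each letter raises the degree of the word map by an extra s, which compensates the degree -s of
the δ that produced it. The total therefore does not depend on n. -/
theorem iterEval_mem_tensorGr
    (hδ : ∀ g, ∀ y ∈ N.gr g, N.δ y ∈ tensorGr (A.grExt K) N.gr (g + -s)) (n : ℕ) {i j : Γ}
    {F : wordMaps K (A.ext K) M.carrier} (hF : IsHomogeneousWord M i F) {y : N.carrier}
    (hy : y ∈ N.gr j) : iterEval M.carrier N.δ n F y ∈ tensorGr M.gr N.gr (i + j) := by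
  induction n generalizing i j F y with
  | zero =>
    rw [iterEval_zero]
    have := hF [] (by simp)
    exact tmul_mem_tensorGr rfl (by simpa using this) hy
  | succ n ih =>
    rw [iterEval_succ]
    refine map_mem_of_mem_tensorGr (fun h k hhk a ha z hz => ?_) (hδ j y hy)
    rw [contract_tmul]
    convert ih (hF.shift ha) hz using 1
    rw [show i + h + s + k = i + (h + k) + s by abel, hhk]
    congr 1
    abel

theorem boxTerm_mem_tensorGr (hM : M.IsAInfty)
    (hδ : DData.IsGradedMap N N (-s) N.δ) (n : ℕ) {g : Γ} {v : M.carrier ⊗[K] N.carrier}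
    (hv : v ∈ tensorGr M.gr N.gr g) : boxTerm M N n v ∈ tensorGr M.gr N.gr (g + -s) := by
  refine map_mem_of_mem_tensorGr (fun i j hij x hx y hy => ?_) hv
  rw [boxTerm_tmul]
  convert iterEval_mem_tensorGr hδ.degree n (isHomogeneousWord_opWord hM hx) hy using 1
  rw [← hij]
  congr 1
  abel

theorem boxD_mem_tensorGr (hM : M.IsAInfty) (hδ : DData.IsGradedMap N N (-s) N.δ)
    (h : M.Bounded ∨ N.Bounded) {g : Γ} {v : M.carrier ⊗[K] N.carrier}
    (hv : v ∈ tensorGr M.gr N.gr g) : boxD M N v ∈ tensorGr M.gr N.gr (g + -s) :=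
  linearSum_mem (eventuallyZero_boxTerm h) fun k => boxTerm_mem_tensorGr hM hδ k hv

/-- Naturality of `boxD` for strict maps. -/
theorem lTensor_boxD {N' : DData A K} (h : M.Bounded ∨ N.Bounded) (h' : M.Bounded ∨ N'.Bounded)
    {f : N.carrier →ₗ[K] N'.carrier} (hf : ∀ y, N'.δ (f y) = f.lTensor (A.ext K) (N.δ y))
    (v : M.carrier ⊗[K] N.carrier) :
    boxD M N' (f.lTensor M.carrier v) = f.lTensor M.carrier (boxD M N v) := by
  refine linearSum_natural (eventuallyZero_boxTerm h) (eventuallyZero_boxTerm h')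
    (f.lTensor M.carrier) (f.lTensor M.carrier).toAddMonoidHom (fun k v => ?_) v
  induction v using TensorProduct.induction_on with
  | zero => simp
  | tmul x y => simp [boxTerm_tmul, iterEval_map f hf]
  | add s t hs ht => simp only [map_add, hs, ht]

/-- Write eᵢ as 1 · eᵢ and move the idempotent to the next letter, or out of the operation if there
is none. This leaves a letter 1 in a word of length at least two. Strict unitality, stated only for
the letter 1, thus covers each idempotent separately. -/
theorem op_idempotent_letter (hM : M.IsAInfty) (hM1 : M.StrictlyUnital) (x : M.carrier)
    (l l' : List (A.ext K)) (i : A.idx) (h : 2 ≤ l.length + l'.length + 1) :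
    M.op x (l ++ A.eExt K i :: l') = 0 := by
  cases l' with
  | nil =>
    have := hM.map_proj x l 1 i
    rw [one_mul] at this
    rw [this, hM1.op_eq_zero x _ (by simpa using h) (by simp), map_zero]
  | cons b l' =>
    have := hM.balanced x l i 1 b l'
    rw [one_mul] at this
    rw [this, hM1.op_eq_zero x _ (by simp; omega) (by simp)]

theorem op_idempotent (hM : M.IsAInfty) (hM1 : M.StrictlyUnital) (x : M.carrier) (i : A.idx) :
    M.op x [A.eExt K i] = M.proj i x := by
  have := hM.map_proj x [] 1 i
  rwa [one_mul, List.nil_append, List.nil_append, hM1.op_one] at this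

theorem idHom_apply (N : DData A K) (y : N.carrier) :
    DData.idHom N y = ∑ i, A.eExt K i ⊗ₜ N.proj i y := by
  simp [DData.idHom, DGA.eRight]

/-- Strict unitality: the insertion of the identity morphism. -/
theorem sum_insertTerm_idHom (hM : M.IsAInfty) (hM1 : M.StrictlyUnital)
    (J : N.carrier →ₗ[K] N.carrier) {k : ℕ} (hk : 2 ≤ k) (v : M.carrier ⊗[K] N.carrier) :
    ∑ i ∈ Finset.range k, insertTerm M N (J.lTensor (A.ext K) ∘ₗ DData.idHom N) i v =
      J.lTensor M.carrier (tensorProj M.proj N.proj v) := by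
  have hc : ∀ y, (J.lTensor (A.ext K) ∘ₗ DData.idHom N) y =
      ∑ i, A.eExt K i ⊗ₜ (J ∘ₗ N.proj i) y := fun y => by
    simp [idHom_apply]
  -- Only the one-letter word eᵢ survives, with m₂(x ⊗ eᵢ) = x eᵢ. Length zero leaves no place for
  -- an insertion, and longer words vanish by `op_idempotent_letter`.
  rw [Finset.sum_eq_single 1]
  · induction v using TensorProduct.induction_on with
    | zero => simp
    | tmul x y =>
      rw [insertTerm_tmul, insertEval_succ, hc]
      rw [contract_eq_zero (Φ := insertEval _ _ _ _ 0) (fun a y => rfl)]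
      simp [iterEval_zero, op_idempotent hM hM1]
    | add s t hs ht => simp only [map_add, hs, ht]
  · intro n _ hn
    induction v using TensorProduct.induction_on with
    | zero => simp
    | tmul x y =>
      rw [insertTerm_tmul]
      rcases Nat.lt_or_ge n 2 with h | h
      · obtain rfl : n = 0 := by omega
        rfl
      · rw [insertEval_letters_eq_zero _ _ _ hc]
        · rfl
        · intro l l' i hl
          exact op_idempotent_letter hM hM1 x l l' i (by omega)
    | add s t hs ht => simp only [map_add, hs, ht, add_zero]
  · intro h
    exact absurd (Finset.mem_range.2 (by omega)) h

end Structures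

/-! ### Bilinearity and naturality of composition for maps N → A ⊗ N'. -/

section MulComp

variable {K B N N' N'' N''' : Type*} [Field K] [Ring B] [Algebra K B] [AddCommGroup N] [Module K N]
  [AddCommGroup N'] [Module K N'] [AddCommGroup N''] [Module K N''] [AddCommGroup N''']
  [Module K N''']

theorem mulComp_apply (g : N' →ₗ[K] B ⊗[K] N'') (f : N →ₗ[K] B ⊗[K] N') (y : N) :
    mulComp g f y = (LinearMap.mul' K B).rTensor N''
      ((TensorProduct.assoc K B B N'').symm (g.lTensor B (f y))) := rfl

theorem mulComp_comp (g : N' →ₗ[K] B ⊗[K] N'') (f : N →ₗ[K] B ⊗[K] N') (p : N''' →ₗ[K] N) :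
    mulComp g (f ∘ₗ p) = mulComp g f ∘ₗ p := rfl

theorem mulComp_lTensor_right (g : N' →ₗ[K] B ⊗[K] N'') (i : N''' →ₗ[K] N')
    (f : N →ₗ[K] B ⊗[K] N''') : mulComp g (i.lTensor B ∘ₗ f) = mulComp (g ∘ₗ i) f := by
  ext y
  simp [mulComp_apply, LinearMap.lTensor_comp_apply]

theorem mulComp_lTensor_left (i : N'' →ₗ[K] N''') (g : N' →ₗ[K] B ⊗[K] N'')
    (f : N →ₗ[K] B ⊗[K] N') : mulComp (i.lTensor B ∘ₗ g) f = i.lTensor B ∘ₗ mulComp g f := by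
  ext y
  simp only [mulComp_apply, LinearMap.comp_apply]
  generalize f y = t
  induction t using TensorProduct.induction_on with
  | zero => simp
  | tmul a z =>
    simp only [LinearMap.lTensor_tmul, LinearMap.comp_apply]
    generalize g z = w
    induction w using TensorProduct.induction_on with
    | zero => simp
    | tmul b z => simp
    | add s t hs ht => simp only [map_add, TensorProduct.tmul_add, hs, ht]
  | add s t hs ht => simp only [map_add, hs, ht]

theorem mulComp_add_left (g h : N' →ₗ[K] B ⊗[K] N'') (f : N →ₗ[K] B ⊗[K] N') :
    mulComp (g + h) f = mulComp g f + mulComp h f := by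
  ext y; simp [mulComp_apply, LinearMap.lTensor_add]

theorem mulComp_add_right (g : N' →ₗ[K] B ⊗[K] N'') (f h : N →ₗ[K] B ⊗[K] N') :
    mulComp g (f + h) = mulComp g f + mulComp g h := by
  ext y; simp [mulComp_apply]

theorem rTensor_comp_lTensor_comp (d : B →ₗ[K] B) (i : N' →ₗ[K] N'') (f : N →ₗ[K] B ⊗[K] N') :
    d.rTensor N'' ∘ₗ (i.lTensor B ∘ₗ f) = i.lTensor B ∘ₗ (d.rTensor N' ∘ₗ f) := by
  rw [← LinearMap.comp_assoc, ← LinearMap.comp_assoc, LinearMap.rTensor_comp_lTensor,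
    LinearMap.lTensor_comp_rTensor]

theorem inl_fst_add_inr_snd {U : Type*} [AddCommGroup U] [Module K U] (v : U ⊗[K] (N × N')) :
    (LinearMap.inl K N N').lTensor U ((LinearMap.fst K N N').lTensor U v) +
      (LinearMap.inr K N N').lTensor U ((LinearMap.snd K N N').lTensor U v) = v := by
  rw [← LinearMap.lTensor_comp_apply, ← LinearMap.lTensor_comp_apply, ← LinearMap.add_apply,
    ← LinearMap.lTensor_add]
  have : LinearMap.inl K N N' ∘ₗ LinearMap.fst K N N' + LinearMap.inr K N N' ∘ₗ
      LinearMap.snd K N N' = LinearMap.id := by ext <;> simp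
  rw [this, LinearMap.lTensor_id_apply]

section Simps

variable {U : Type*} [AddCommGroup U] [Module K U]

@[simp] theorem lTensor_fst_inl (v : U ⊗[K] N) :
    (LinearMap.fst K N N').lTensor U ((LinearMap.inl K N N').lTensor U v) = v := by
  rw [← LinearMap.lTensor_comp_apply, LinearMap.fst_comp_inl, LinearMap.lTensor_id_apply]

@[simp] theorem lTensor_snd_inr (v : U ⊗[K] N') :
    (LinearMap.snd K N N').lTensor U ((LinearMap.inr K N N').lTensor U v) = v := by
  rw [← LinearMap.lTensor_comp_apply, LinearMap.snd_comp_inr, LinearMap.lTensor_id_apply]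

@[simp] theorem lTensor_fst_inr (v : U ⊗[K] N') :
    (LinearMap.fst K N N').lTensor U ((LinearMap.inr K N N').lTensor U v) = 0 := by
  rw [← LinearMap.lTensor_comp_apply, LinearMap.fst_comp_inr, LinearMap.lTensor_zero,
    LinearMap.zero_apply]

@[simp] theorem lTensor_snd_inl (v : U ⊗[K] N) :
    (LinearMap.snd K N N').lTensor U ((LinearMap.inl K N N').lTensor U v) = 0 := by
  rw [← LinearMap.lTensor_comp_apply, LinearMap.snd_comp_inl, LinearMap.lTensor_zero,
    LinearMap.zero_apply]

end Simps

theorem append_lTensor {δ : N →ₗ[K] B ⊗[K] N} {δ' : N' →ₗ[K] B ⊗[K] N'} {f : N →ₗ[K] N'}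
    (hf : ∀ y, δ' (f y) = f.lTensor B (δ y)) (z : TensorAlgebra K B ⊗[K] N) :
    append δ' (f.lTensor _ z) = f.lTensor _ (append δ z) := by
  induction z using TensorProduct.induction_on with
  | zero => simp
  | tmul u y =>
    simp only [append, LinearMap.comp_apply, LinearMap.lTensor_tmul, hf]
    generalize δ y = w
    induction w using TensorProduct.induction_on with
    | zero => simp
    | tmul a y => simp
    | add s t hs ht => simp only [map_add, TensorProduct.tmul_add, hs, ht]
  | add s t hs ht => simp only [map_add, hs, ht]

end MulComp

/-! ### Cones, their curvature, and the null homotopy of the cone of an equivalence. -/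

section Structures

variable {Γ : Type*} [AddCommGroup Γ] {s : Γ} {A : DGA Γ s} {K : Type*} [Field K]
  [Algebra (ZMod 2) K]

theorem add_self_eq_zero (K : Type*) [Field K] [Algebra (ZMod 2) K] {V : Type*} [AddCommGroup V]
    [Module K V] (v : V) : v + v = 0 := by
  have := charP_two_of_algebra K
  rw [← two_smul K, CharTwo.two_eq_zero, zero_smul]

theorem eq_add_of_add_eq_linearMap {V V' : Type*} [AddCommGroup V] [Module K V] [AddCommGroup V']
    [Module K V'] {f g h : V →ₗ[K] V'} (e : f + g = h) : g = h + f := by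
  ext x
  rw [← e, LinearMap.add_apply, LinearMap.add_apply, add_right_comm, add_self_eq_zero K, zero_add]

theorem eq_of_add_eq_zero (K : Type*) [Field K] [Algebra (ZMod 2) K] {V : Type*} [AddCommGroup V]
    [Module K V] {a b : V} (h : a + b = 0) : a = b := by
  rw [← add_zero a, ← add_self_eq_zero K b, ← add_assoc, h, zero_add]

namespace DData

theorem diff_eq {N₁ N₂ : DData A K} (f : N₁.carrier →ₗ[K] A.ext K ⊗[K] N₂.carrier) :
    diff f = mulComp N₂.δ f + mulComp f N₁.δ + (A.dExt K).rTensor N₂.carrier ∘ₗ f := rfl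

theorem comp_eq_mulComp {N₁ N₂ N₃ : DData A K} (g : N₂.carrier →ₗ[K] A.ext K ⊗[K] N₃.carrier)
    (f : N₁.carrier →ₗ[K] A.ext K ⊗[K] N₂.carrier) : comp g f = mulComp g f := rfl

theorem IsGradedMap.add {N N' : DData A K} {c : Γ} {f g : N.carrier →ₗ[K] A.ext K ⊗[K] N'.carrier}
    (hf : IsGradedMap N N' c f) (hg : IsGradedMap N N' c g) : IsGradedMap N N' c (f + g) where
  mem_tensorI x := add_mem (hf.mem_tensorI x) (hg.mem_tensorI x)
  map_proj i x := by simp [hf.map_proj, hg.map_proj]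
  degree k x hx := add_mem (hf.degree k x hx) (hg.degree k x hx)

theorem IsGradedMap.comp_right {N N' N'' : DData A K} {c e k : Γ}
    {f : N.carrier →ₗ[K] A.ext K ⊗[K] N'.carrier} (hf : IsGradedMap N N' c f)
    {p : N''.carrier →ₗ[K] N.carrier} (hp : ∀ i x, p (N''.proj i x) = N.proj i (p x))
    (hp' : ∀ g, ∀ x ∈ N''.gr g, p x ∈ N.gr (g + e)) (hk : e + c = k) :
    IsGradedMap N'' N' k (f ∘ₗ p) where
  mem_tensorI x := hf.mem_tensorI _
  map_proj i x := by simp [hp, hf.map_proj]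
  degree g x hx := by
    have := hf.degree _ _ (hp' g x hx)
    rwa [add_assoc, hk] at this

theorem IsGradedMap.comp_left {N N' N'' : DData A K} {c e k : Γ}
    {f : N.carrier →ₗ[K] A.ext K ⊗[K] N'.carrier} (hf : IsGradedMap N N' c f)
    {p : N'.carrier →ₗ[K] N''.carrier} (hp : ∀ i x, p (N'.proj i x) = N''.proj i (p x))
    (hp' : ∀ g, ∀ x ∈ N'.gr g, p x ∈ N''.gr (g + e)) (hk : c + e = k) :
    IsGradedMap N N'' k (p.lTensor (A.ext K) ∘ₗ f) where
  mem_tensorI x := by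
    obtain ⟨w, hw⟩ := hf.mem_tensorI x
    exact ⟨p.lTensor _ w, by rw [tensorProj_lTensor hp, hw]; rfl⟩
  map_proj i x := by
    simp only [LinearMap.comp_apply, hf.map_proj]
    rw [← LinearMap.comp_apply (p.lTensor _), LinearMap.lTensor_comp_rTensor,
      ← LinearMap.rTensor_comp_lTensor, LinearMap.comp_apply]
  degree g x hx := by
    have := lTensor_mem_tensorGr hp' (hf.degree g x hx)
    rwa [add_assoc, hk] at this

/-- The cone of `f : N₁ → A ⊗ N₂`, with the grading of `N₂` shifted by `t`. -/
def cone (N₁ N₂ : DData A K) (f : N₁.carrier →ₗ[K] A.ext K ⊗[K] N₂.carrier) (t : Γ) :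
    DData A K where
  carrier := N₁.carrier × N₂.carrier
  gr g := (N₁.gr g).prod (N₂.gr (g + t))
  proj i := (N₁.proj i).prodMap (N₂.proj i)
  δ := (LinearMap.inl K N₁.carrier N₂.carrier).lTensor (A.ext K) ∘ₗ N₁.δ ∘ₗ
      LinearMap.fst K N₁.carrier N₂.carrier +
    (LinearMap.inr K N₁.carrier N₂.carrier).lTensor (A.ext K) ∘ₗ f ∘ₗ
      LinearMap.fst K N₁.carrier N₂.carrier +
    (LinearMap.inr K N₁.carrier N₂.carrier).lTensor (A.ext K) ∘ₗ N₂.δ ∘ₗ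
      LinearMap.snd K N₁.carrier N₂.carrier

section Cone

variable (N₁ N₂ : DData A K) (f : N₁.carrier →ₗ[K] A.ext K ⊗[K] N₂.carrier) (t : Γ)

/-- The inclusion of the first summand of a cone. -/
def coneInl : N₁.carrier →ₗ[K] (cone N₁ N₂ f t).carrier := LinearMap.inl K _ _

/-- The inclusion of the second summand of a cone. -/
def coneInr : N₂.carrier →ₗ[K] (cone N₁ N₂ f t).carrier := LinearMap.inr K _ _

/-- The projection to the first summand of a cone. -/
def coneFst : (cone N₁ N₂ f t).carrier →ₗ[K] N₁.carrier := LinearMap.fst K _ _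

/-- The projection to the second summand of a cone. -/
def coneSnd : (cone N₁ N₂ f t).carrier →ₗ[K] N₂.carrier := LinearMap.snd K _ _

variable {N₁ N₂ f t}

theorem coneInl_proj (i : A.idx) (x : N₁.carrier) : coneInl N₁ N₂ f t (N₁.proj i x) =
    (cone N₁ N₂ f t).proj i (coneInl N₁ N₂ f t x) :=
  Prod.ext rfl (map_zero (N₂.proj i)).symm

theorem coneInr_proj (i : A.idx) (x : N₂.carrier) : coneInr N₁ N₂ f t (N₂.proj i x) =
    (cone N₁ N₂ f t).proj i (coneInr N₁ N₂ f t x) :=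
  Prod.ext (map_zero (N₁.proj i)).symm rfl

theorem coneFst_proj (i : A.idx) (x : (cone N₁ N₂ f t).carrier) :
    coneFst N₁ N₂ f t ((cone N₁ N₂ f t).proj i x) = N₁.proj i (coneFst N₁ N₂ f t x) := rfl

theorem coneSnd_proj (i : A.idx) (x : (cone N₁ N₂ f t).carrier) :
    coneSnd N₁ N₂ f t ((cone N₁ N₂ f t).proj i x) = N₂.proj i (coneSnd N₁ N₂ f t x) := rfl

theorem coneInl_mem (g : Γ) (x : N₁.carrier) (hx : x ∈ N₁.gr g) :
    coneInl N₁ N₂ f t x ∈ (cone N₁ N₂ f t).gr (g + 0) := by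
  rw [add_zero]; exact ⟨hx, zero_mem _⟩

theorem coneInr_mem (g : Γ) (x : N₂.carrier) (hx : x ∈ N₂.gr g) :
    coneInr N₁ N₂ f t x ∈ (cone N₁ N₂ f t).gr (g + -t) :=
  ⟨zero_mem _, by rw [neg_add_cancel_right]; exact hx⟩

theorem coneFst_mem (g : Γ) (x : (cone N₁ N₂ f t).carrier) (hx : x ∈ (cone N₁ N₂ f t).gr g) :
    coneFst N₁ N₂ f t x ∈ N₁.gr (g + 0) := by
  rw [add_zero]; exact hx.1

theorem coneSnd_mem (g : Γ) (x : (cone N₁ N₂ f t).carrier) (hx : x ∈ (cone N₁ N₂ f t).gr g) :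
    coneSnd N₁ N₂ f t x ∈ N₂.gr (g + t) := hx.2

theorem coneFst_comp_coneInl : coneFst N₁ N₂ f t ∘ₗ coneInl N₁ N₂ f t = LinearMap.id := rfl

theorem coneSnd_comp_coneInr : coneSnd N₁ N₂ f t ∘ₗ coneInr N₁ N₂ f t = LinearMap.id := rfl

theorem coneFst_comp_coneInr : coneFst N₁ N₂ f t ∘ₗ coneInr N₁ N₂ f t = 0 := rfl

theorem coneSnd_comp_coneInl : coneSnd N₁ N₂ f t ∘ₗ coneInl N₁ N₂ f t = 0 := rfl

theorem cone_hom_ext {V : Type*} [AddCommGroup V] [Module K V]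
    {g h : (cone N₁ N₂ f t).carrier →ₗ[K] V}
    (h₁ : g ∘ₗ coneInl N₁ N₂ f t = h ∘ₗ coneInl N₁ N₂ f t)
    (h₂ : g ∘ₗ coneInr N₁ N₂ f t = h ∘ₗ coneInr N₁ N₂ f t) : g = h :=
  LinearMap.prod_ext h₁ h₂

theorem cone_δ : (cone N₁ N₂ f t).δ =
    (coneInl N₁ N₂ f t).lTensor (A.ext K) ∘ₗ N₁.δ ∘ₗ coneFst N₁ N₂ f t +
    (coneInr N₁ N₂ f t).lTensor (A.ext K) ∘ₗ f ∘ₗ coneFst N₁ N₂ f t +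
    (coneInr N₁ N₂ f t).lTensor (A.ext K) ∘ₗ N₂.δ ∘ₗ coneSnd N₁ N₂ f t := rfl

theorem cone_δ_inl : (cone N₁ N₂ f t).δ ∘ₗ coneInl N₁ N₂ f t =
    (coneInl N₁ N₂ f t).lTensor (A.ext K) ∘ₗ N₁.δ +
      (coneInr N₁ N₂ f t).lTensor (A.ext K) ∘ₗ f := by
  simp only [cone_δ, LinearMap.add_comp, LinearMap.comp_assoc, coneFst_comp_coneInl,
    coneSnd_comp_coneInl, LinearMap.comp_id, LinearMap.comp_zero, add_zero]

theorem cone_δ_inr : (cone N₁ N₂ f t).δ ∘ₗ coneInr N₁ N₂ f t =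
    (coneInr N₁ N₂ f t).lTensor (A.ext K) ∘ₗ N₂.δ := by
  simp only [cone_δ, LinearMap.add_comp, LinearMap.comp_assoc, coneFst_comp_coneInr,
    coneSnd_comp_coneInr, LinearMap.comp_id, LinearMap.comp_zero, zero_add]

/-- The matrix of δ is triangular, so the second summand is a strict subobject. By `coneFst_δ` the
first summand is a strict quotient. All naturality arguments for cones use these two facts. -/
theorem cone_δ_coneInr (y : N₂.carrier) : (cone N₁ N₂ f t).δ (coneInr N₁ N₂ f t y) =
    (coneInr N₁ N₂ f t).lTensor (A.ext K) (N₂.δ y) := LinearMap.congr_fun cone_δ_inr y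

theorem coneFst_δ (y : (cone N₁ N₂ f t).carrier) : N₁.δ (coneFst N₁ N₂ f t y) =
    (coneFst N₁ N₂ f t).lTensor (A.ext K) ((cone N₁ N₂ f t).δ y) := by
  have : (coneFst N₁ N₂ f t).lTensor (A.ext K) ∘ₗ (cone N₁ N₂ f t).δ =
      N₁.δ ∘ₗ coneFst N₁ N₂ f t := by
    rw [cone_δ]
    simp only [LinearMap.comp_add, ← LinearMap.comp_assoc, ← LinearMap.lTensor_comp,
      coneFst_comp_coneInl, coneFst_comp_coneInr, LinearMap.lTensor_id, LinearMap.lTensor_zero,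
      LinearMap.zero_comp, LinearMap.id_comp, add_zero]
  exact (LinearMap.congr_fun this y).symm

/-- The inclusion of the second summand has degree -t, so an f of degree t - s contributes an entry
of degree -s. It is applied with t = s to a morphism and with t = 2s to a map of degree s. -/
theorem isGradedMap_cone_δ (h₁ : IsGradedMap N₁ N₁ (-s) N₁.δ) (h₂ : IsGradedMap N₂ N₂ (-s) N₂.δ)
    (hf : IsGradedMap N₁ N₂ (t - s) f) :
    IsGradedMap (cone N₁ N₂ f t) (cone N₁ N₂ f t) (-s) (cone N₁ N₂ f t).δ := by
  rw [cone_δ]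
  refine IsGradedMap.add (IsGradedMap.add ?_ ?_) ?_
  · exact (h₁.comp_right coneFst_proj coneFst_mem (k := -s) (by abel)).comp_left coneInl_proj
      coneInl_mem (by abel)
  · exact (hf.comp_right coneFst_proj coneFst_mem (k := t - s) (by abel)).comp_left coneInr_proj
      coneInr_mem (by abel)
  · exact (h₂.comp_right coneSnd_proj coneSnd_mem (k := t - s) (by abel)).comp_left coneInr_proj
      coneInr_mem (by abel)

theorem cone_proj_idem (h₁ : CompleteOrthogonalIdempotents N₁.proj)
    (h₂ : CompleteOrthogonalIdempotents N₂.proj) :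
    CompleteOrthogonalIdempotents (cone N₁ N₂ f t).proj where
  idem i := by
    refine LinearMap.ext fun x => Prod.ext ?_ ?_
    · exact LinearMap.congr_fun (h₁.idem i) x.1
    · exact LinearMap.congr_fun (h₂.idem i) x.2
  ortho i j hij := by
    refine LinearMap.ext fun x => Prod.ext ?_ ?_
    · exact LinearMap.congr_fun (h₁.ortho hij) x.1
    · exact LinearMap.congr_fun (h₂.ortho hij) x.2
  complete := by
    refine cone_hom_ext (LinearMap.ext fun x => ?_) (LinearMap.ext fun x => ?_)
    · have := LinearMap.congr_fun h₁.complete x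
      simp only [LinearMap.sum_apply, LinearMap.comp_apply, ← coneInl_proj] at this ⊢
      rw [← map_sum, this]; rfl
    · have := LinearMap.congr_fun h₂.complete x
      simp only [LinearMap.sum_apply, LinearMap.comp_apply, ← coneInr_proj] at this ⊢
      rw [← map_sum, this]; rfl

theorem Δ_lTensor {N N' : DData A K} {f : N.carrier →ₗ[K] N'.carrier}
    (hf : ∀ y, N'.δ (f y) = f.lTensor (A.ext K) (N.δ y)) (n : ℕ) (y : N.carrier) :
    N'.Δ n (f y) = f.lTensor _ (N.Δ n y) := by
  induction n with
  | zero => rfl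
  | succ n ih =>
    rw [Δ_succ, Δ_succ, LinearMap.comp_apply, LinearMap.comp_apply, ih, append_lTensor hf]

theorem Δ_add (N : DData A K) (n k : ℕ) (y : N.carrier) :
    N.Δ (n + k) y = (append N.δ)^[k] (N.Δ n y) := by
  induction k with
  | zero => rfl
  | succ k ih =>
    rw [← Nat.add_assoc, Δ_succ, LinearMap.comp_apply, ih, Function.iterate_succ_apply']

/-- The component in the quotient N₁ dies after finitely many iterates. What remains is a single
tensor over the subobject N₂, where the iterates die as well. -/
theorem Bounded.cone (h₁ : N₁.Bounded) (h₂ : N₂.Bounded) : (cone N₁ N₂ f t).Bounded := by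
  intro v
  obtain ⟨n, hn⟩ := h₁ (coneFst N₁ N₂ f t v)
  have h := inl_fst_add_inr_snd ((DData.cone N₁ N₂ f t).Δ n v)
  have h0 : (LinearMap.fst K N₁.carrier N₂.carrier).lTensor _ ((DData.cone N₁ N₂ f t).Δ n v) = 0 :=
    (Δ_lTensor coneFst_δ n v).symm.trans (hn n le_rfl)
  rw [h0, map_zero, zero_add] at h
  obtain ⟨m, hm⟩ := h₂.append_iterate
    ((LinearMap.snd K N₁.carrier N₂.carrier).lTensor _ ((DData.cone N₁ N₂ f t).Δ n v))
  have key : ∀ k, (append (DData.cone N₁ N₂ f t).δ)^[k] ((DData.cone N₁ N₂ f t).Δ n v) =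
      (coneInr N₁ N₂ f t).lTensor _ ((append N₂.δ)^[k] ((coneSnd N₁ N₂ f t).lTensor _
        ((DData.cone N₁ N₂ f t).Δ n v))) := by
    intro k
    induction k with
    | zero => exact h.symm
    | succ k ih =>
      rw [Function.iterate_succ_apply', ih, Function.iterate_succ_apply',
        append_lTensor cone_δ_coneInr]
  refine ⟨n + m, fun k hk => ?_⟩
  obtain ⟨j, rfl⟩ := Nat.exists_eq_add_of_le (show n ≤ k by omega)
  rw [Δ_add, key]
  exact (congrArg _ (hm j (by omega))).trans (map_zero _)

/-- A product of triangular matrices: the diagonal entries are the two curvatures, and the cross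
terms with μ₁f make up `diff f`. No type `D` equation is assumed, so it also applies to a cone that
fails to be a type `D` structure. -/
theorem curvature_cone : curvature (A.dExt K) (cone N₁ N₂ f t).δ =
    (coneInl N₁ N₂ f t).lTensor (A.ext K) ∘ₗ curvature (A.dExt K) N₁.δ ∘ₗ coneFst N₁ N₂ f t +
    (coneInr N₁ N₂ f t).lTensor (A.ext K) ∘ₗ diff f ∘ₗ coneFst N₁ N₂ f t +
    (coneInr N₁ N₂ f t).lTensor (A.ext K) ∘ₗ curvature (A.dExt K) N₂.δ ∘ₗ
      coneSnd N₁ N₂ f t := by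
  refine cone_hom_ext ?_ ?_
  · simp only [LinearMap.add_comp, LinearMap.comp_assoc, coneFst_comp_coneInl,
      coneSnd_comp_coneInl, LinearMap.comp_id, LinearMap.comp_zero, add_zero]
    rw [diff_eq]
    simp only [curvature, LinearMap.add_comp, LinearMap.comp_assoc, ← mulComp_comp, cone_δ_inl,
      cone_δ_inr, mulComp_add_right, mulComp_lTensor_right, mulComp_add_left, mulComp_lTensor_left,
      LinearMap.comp_add, rTensor_comp_lTensor_comp]
    abel
  · simp only [LinearMap.add_comp, LinearMap.comp_assoc, coneFst_comp_coneInr,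
      coneSnd_comp_coneInr, LinearMap.comp_id, LinearMap.comp_zero, zero_add]
    simp only [curvature, LinearMap.add_comp, LinearMap.comp_assoc, ← mulComp_comp,
      cone_δ_inr, mulComp_lTensor_right, mulComp_lTensor_left,
      LinearMap.comp_add, rTensor_comp_lTensor_comp]

end Cone

theorem IsTypeD.curvature_eq_zero {N : DData A K} (hN : N.IsTypeD) :
    curvature (A.dExt K) N.δ = 0 := hN.structure_eq

variable {N N' : DData A K}

/-- The null homotopy of the cone of a homotopy equivalence. -/
def coneHomotopy (ψ : N.carrier →ₗ[K] A.ext K ⊗[K] N'.carrier)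
    (φ : N'.carrier →ₗ[K] A.ext K ⊗[K] N.carrier) (H : N.carrier →ₗ[K] A.ext K ⊗[K] N.carrier)
    (H' : N'.carrier →ₗ[K] A.ext K ⊗[K] N'.carrier) (t : Γ) :
    (cone N N' ψ t).carrier →ₗ[K] A.ext K ⊗[K] (cone N N' ψ t).carrier :=
  (coneInl N N' ψ t).lTensor (A.ext K) ∘ₗ H ∘ₗ coneFst N N' ψ t +
  (coneInl N N' ψ t).lTensor (A.ext K) ∘ₗ φ ∘ₗ coneSnd N N' ψ t +
  (coneInr N N' ψ t).lTensor (A.ext K) ∘ₗ H' ∘ₗ coneSnd N N' ψ t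

theorem coneHomotopy_inl {ψ : N.carrier →ₗ[K] A.ext K ⊗[K] N'.carrier}
    {φ : N'.carrier →ₗ[K] A.ext K ⊗[K] N.carrier} {H : N.carrier →ₗ[K] A.ext K ⊗[K] N.carrier}
    {H' : N'.carrier →ₗ[K] A.ext K ⊗[K] N'.carrier} {t : Γ} :
    coneHomotopy ψ φ H H' t ∘ₗ coneInl N N' ψ t =
      (coneInl N N' ψ t).lTensor (A.ext K) ∘ₗ H := by
  simp only [coneHomotopy, LinearMap.add_comp, LinearMap.comp_assoc, coneFst_comp_coneInl,
    coneSnd_comp_coneInl, LinearMap.comp_id, LinearMap.comp_zero, add_zero]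

theorem coneHomotopy_inr {ψ : N.carrier →ₗ[K] A.ext K ⊗[K] N'.carrier}
    {φ : N'.carrier →ₗ[K] A.ext K ⊗[K] N.carrier} {H : N.carrier →ₗ[K] A.ext K ⊗[K] N.carrier}
    {H' : N'.carrier →ₗ[K] A.ext K ⊗[K] N'.carrier} {t : Γ} :
    coneHomotopy ψ φ H H' t ∘ₗ coneInr N N' ψ t =
      (coneInl N N' ψ t).lTensor (A.ext K) ∘ₗ φ + (coneInr N N' ψ t).lTensor (A.ext K) ∘ₗ H' := by
  simp only [coneHomotopy, LinearMap.add_comp, LinearMap.comp_assoc, coneFst_comp_coneInr,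
    coneSnd_comp_coneInr, LinearMap.comp_id, LinearMap.comp_zero, zero_add]

theorem isGradedMap_coneHomotopy {ψ : N.carrier →ₗ[K] A.ext K ⊗[K] N'.carrier}
    {φ : N'.carrier →ₗ[K] A.ext K ⊗[K] N.carrier} {H : N.carrier →ₗ[K] A.ext K ⊗[K] N.carrier}
    {H' : N'.carrier →ₗ[K] A.ext K ⊗[K] N'.carrier} (hφ : IsGradedMap N' N 0 φ)
    (hH : IsGradedMap N N s H) (hH' : IsGradedMap N' N' s H') :
    IsGradedMap (cone N N' ψ s) (cone N N' ψ s) s (coneHomotopy ψ φ H H' s) := by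
  refine IsGradedMap.add (IsGradedMap.add ?_ ?_) ?_
  · exact (hH.comp_right coneFst_proj coneFst_mem (k := s) (by abel)).comp_left coneInl_proj
      coneInl_mem (by abel)
  · exact (hφ.comp_right coneSnd_proj coneSnd_mem (k := s) (by abel)).comp_left coneInl_proj
      coneInl_mem (by abel)
  · exact (hH'.comp_right coneSnd_proj coneSnd_mem (k := s + s) (by abel)).comp_left coneInr_proj
      coneInr_mem (by abel)

theorem idHom_cone {f : N.carrier →ₗ[K] A.ext K ⊗[K] N'.carrier} {t : Γ} :
    idHom (cone N N' f t) =
      (coneInl N N' f t).lTensor (A.ext K) ∘ₗ idHom N ∘ₗ coneFst N N' f t +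
      (coneInr N N' f t).lTensor (A.ext K) ∘ₗ idHom N' ∘ₗ coneSnd N N' f t := by
  refine cone_hom_ext ?_ ?_
  · simp only [LinearMap.add_comp, LinearMap.comp_assoc, coneFst_comp_coneInl,
      coneSnd_comp_coneInl, LinearMap.comp_id, LinearMap.comp_zero, add_zero]
    ext x
    simp [idHom_apply, coneInl_proj]
  · simp only [LinearMap.add_comp, LinearMap.comp_assoc, coneFst_comp_coneInr,
      coneSnd_comp_coneInr, LinearMap.comp_id, LinearMap.comp_zero, zero_add]
    ext x
    simp [idHom_apply, coneInr_proj]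

/-- The diagonal entries are diff H + φψ and diff H' + ψφ, which are identities by the homotopies;
the upper right entry is diff φ = 0. The lower left entry ψH + H'ψ need not vanish and is carried
along. -/
theorem diff_coneHomotopy {ψ : N.carrier →ₗ[K] A.ext K ⊗[K] N'.carrier}
    {φ : N'.carrier →ₗ[K] A.ext K ⊗[K] N.carrier} {H : N.carrier →ₗ[K] A.ext K ⊗[K] N.carrier}
    {H' : N'.carrier →ₗ[K] A.ext K ⊗[K] N'.carrier} {t : Γ} (hφ : diff φ = 0)
    (h : comp φ ψ + idHom N = diff H) (h' : comp ψ φ + idHom N' = diff H') :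
    diff (coneHomotopy ψ φ H H' t) = idHom (cone N N' ψ t) +
      (coneInr N N' ψ t).lTensor (A.ext K) ∘ₗ (comp ψ H + comp H' ψ) ∘ₗ coneFst N N' ψ t := by
  have e1 : idHom N = diff H + comp φ ψ := eq_add_of_add_eq_linearMap h
  have e2 : idHom N' = diff H' + comp ψ φ := eq_add_of_add_eq_linearMap h'
  have e3 : (coneInl N N' ψ t).lTensor (A.ext K) ∘ₗ diff φ = 0 := by rw [hφ, LinearMap.comp_zero]
  rw [idHom_cone, e1, e2, diff_eq]
  refine cone_hom_ext ?_ ?_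
  · simp only [LinearMap.add_comp, LinearMap.comp_assoc, coneFst_comp_coneInl,
      coneSnd_comp_coneInl, LinearMap.comp_id, LinearMap.comp_zero, add_zero]
    rw [diff_eq, comp_eq_mulComp, comp_eq_mulComp, comp_eq_mulComp]
    simp only [← mulComp_comp, cone_δ_inl, coneHomotopy_inl, coneHomotopy_inr, mulComp_add_right,
      mulComp_lTensor_right, mulComp_add_left, mulComp_lTensor_left, LinearMap.comp_add,
      rTensor_comp_lTensor_comp]
    abel
  · simp only [LinearMap.add_comp, LinearMap.comp_assoc, coneFst_comp_coneInr,
      coneSnd_comp_coneInr, LinearMap.comp_id, LinearMap.comp_zero, zero_add, add_zero]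
    rw [diff_eq] at e3
    rw [diff_eq, comp_eq_mulComp]
    simp only [← mulComp_comp, cone_δ_inl, cone_δ_inr, coneHomotopy_inr, mulComp_add_right,
      mulComp_lTensor_right, mulComp_add_left, mulComp_lTensor_left, LinearMap.comp_add,
      rTensor_comp_lTensor_comp] at e3 ⊢
    rw [← sub_eq_zero]
    refine Eq.trans ?_ e3
    abel

end DData

end Structures

/-! ### Chain maps and homotopies as entries of box operators of cones. -/

section Structures

variable {Γ : Type*} [AddCommGroup Γ] {s : Γ} {A : DGA Γ s} {K : Type*} [Field K]
  [Algebra (ZMod 2) K]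

open DData

theorem boxD_boxD_eq_zero {M : AData A K} (hM : M.IsAInfty) {N : DData A K}
    (h : M.Bounded ∨ N.Bounded) (hN : curvature (A.dExt K) N.δ = 0)
    (v : M.carrier ⊗[K] N.carrier) : boxD M N (boxD M N v) = 0 := by
  obtain ⟨n, hn⟩ := boxD_boxD hM h v
  rw [hn n le_rfl, hN]
  refine Finset.sum_eq_zero fun i _ => ?_
  rw [insertTerm, insertEval_zero_middle, LinearMap.zero_comp]
  exact LinearMap.congr_fun (TensorProduct.ext' fun x y => rfl :
    TensorProduct.lift (0 : M.carrier →ₗ[K] N.carrier →ₗ[K] M.carrier ⊗[K] N.carrier) = 0) v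

section BoxCone

variable {M : AData A K} {N₁ N₂ : DData A K} {f : N₁.carrier →ₗ[K] A.ext K ⊗[K] N₂.carrier} {t : Γ}

theorem Bounded.or_cone (h₁ : M.Bounded ∨ N₁.Bounded) (h₂ : M.Bounded ∨ N₂.Bounded) :
    M.Bounded ∨ (cone N₁ N₂ f t).Bounded := by
  rcases h₁ with h₁ | h₁
  · exact Or.inl h₁
  · exact h₂.imp_right h₁.cone

/-- The off-diagonal entry of `boxD` of a cone. -/
def coneEntry (M : AData A K) (f : N₁.carrier →ₗ[K] A.ext K ⊗[K] N₂.carrier) (t : Γ) :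
    M.carrier ⊗[K] N₁.carrier →ₗ[K] M.carrier ⊗[K] N₂.carrier :=
  (coneSnd N₁ N₂ f t).lTensor M.carrier ∘ₗ boxD M (cone N₁ N₂ f t) ∘ₗ
    (coneInl N₁ N₂ f t).lTensor M.carrier

theorem lTensor_coneFst_coneInl (v : M.carrier ⊗[K] N₁.carrier) :
    (coneFst N₁ N₂ f t).lTensor M.carrier ((coneInl N₁ N₂ f t).lTensor M.carrier v) = v :=
  lTensor_fst_inl v

theorem lTensor_coneSnd_coneInr (v : M.carrier ⊗[K] N₂.carrier) :
    (coneSnd N₁ N₂ f t).lTensor M.carrier ((coneInr N₁ N₂ f t).lTensor M.carrier v) = v :=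
  lTensor_snd_inr v

theorem lTensor_coneFst_coneInr (v : M.carrier ⊗[K] N₂.carrier) :
    (coneFst N₁ N₂ f t).lTensor M.carrier ((coneInr N₁ N₂ f t).lTensor M.carrier v) = 0 :=
  lTensor_fst_inr v

theorem lTensor_coneSnd_coneInl (v : M.carrier ⊗[K] N₁.carrier) :
    (coneSnd N₁ N₂ f t).lTensor M.carrier ((coneInl N₁ N₂ f t).lTensor M.carrier v) = 0 :=
  lTensor_snd_inl v

theorem cone_decomposition (v : M.carrier ⊗[K] (cone N₁ N₂ f t).carrier) :
    (coneInl N₁ N₂ f t).lTensor M.carrier ((coneFst N₁ N₂ f t).lTensor M.carrier v) +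
      (coneInr N₁ N₂ f t).lTensor M.carrier ((coneSnd N₁ N₂ f t).lTensor M.carrier v) = v :=
  inl_fst_add_inr_snd v

theorem boxD_coneInr (h₁ : M.Bounded ∨ N₁.Bounded) (h₂ : M.Bounded ∨ N₂.Bounded)
    (v : M.carrier ⊗[K] N₂.carrier) :
    boxD M (cone N₁ N₂ f t) ((coneInr N₁ N₂ f t).lTensor M.carrier v) =
      (coneInr N₁ N₂ f t).lTensor M.carrier (boxD M N₂ v) :=
  lTensor_boxD h₂ (Bounded.or_cone h₁ h₂) cone_δ_coneInr v

theorem coneFst_boxD (h₁ : M.Bounded ∨ N₁.Bounded) (h₂ : M.Bounded ∨ N₂.Bounded)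
    (v : M.carrier ⊗[K] (cone N₁ N₂ f t).carrier) :
    (coneFst N₁ N₂ f t).lTensor M.carrier (boxD M (cone N₁ N₂ f t) v) =
      boxD M N₁ ((coneFst N₁ N₂ f t).lTensor M.carrier v) :=
  (lTensor_boxD (Bounded.or_cone h₁ h₂) h₁ coneFst_δ v).symm

/-- With `boxD_coneInr`, this is the triangular matrix form of the box operator of a cone. -/
theorem boxD_coneInl (h₁ : M.Bounded ∨ N₁.Bounded) (h₂ : M.Bounded ∨ N₂.Bounded)
    (v : M.carrier ⊗[K] N₁.carrier) :
    boxD M (cone N₁ N₂ f t) ((coneInl N₁ N₂ f t).lTensor M.carrier v) =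
      (coneInl N₁ N₂ f t).lTensor M.carrier (boxD M N₁ v) +
        (coneInr N₁ N₂ f t).lTensor M.carrier (coneEntry M f t v) := by
  rw [← cone_decomposition (boxD M (cone N₁ N₂ f t) ((coneInl N₁ N₂ f t).lTensor M.carrier v)),
    coneFst_boxD h₁ h₂, lTensor_coneFst_coneInl]
  rfl

/-- The square of `boxD` of a cone. -/
theorem coneSnd_boxD_boxD_coneInl (h₁ : M.Bounded ∨ N₁.Bounded) (h₂ : M.Bounded ∨ N₂.Bounded)
    (v : M.carrier ⊗[K] N₁.carrier) :
    (coneSnd N₁ N₂ f t).lTensor M.carrier (boxD M (cone N₁ N₂ f t)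
      (boxD M (cone N₁ N₂ f t) ((coneInl N₁ N₂ f t).lTensor M.carrier v))) =
    coneEntry M f t (boxD M N₁ v) + boxD M N₂ (coneEntry M f t v) := by
  rw [boxD_coneInl h₁ h₂, map_add, boxD_coneInl h₁ h₂, boxD_coneInr h₁ h₂]
  simp only [map_add, lTensor_coneSnd_coneInl, lTensor_coneSnd_coneInr, zero_add]

theorem tensorProj_coneEntry (hM : M.IsAInfty) (h₁ : M.Bounded ∨ N₁.Bounded)
    (h₂ : M.Bounded ∨ N₂.Bounded) (hp₁ : CompleteOrthogonalIdempotents N₁.proj)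
    (hp₂ : CompleteOrthogonalIdempotents N₂.proj) (hδ₁ : IsGradedMap N₁ N₁ (-s) N₁.δ)
    (hδ₂ : IsGradedMap N₂ N₂ (-s) N₂.δ) (hf : IsGradedMap N₁ N₂ (t - s) f)
    (v : M.carrier ⊗[K] N₁.carrier) :
    tensorProj M.proj N₂.proj (coneEntry M f t v) =
      coneEntry M f t (tensorProj M.proj N₁.proj v) := by
  simp only [coneEntry, LinearMap.comp_apply]
  rw [tensorProj_lTensor coneSnd_proj, tensorProj_boxD hM (cone_proj_idem hp₁ hp₂)
    (isGradedMap_cone_δ hδ₁ hδ₂ hf) (Bounded.or_cone h₁ h₂), tensorProj_lTensor coneInl_proj]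

theorem coneEntry_mem_tensorGr (hM : M.IsAInfty) (h₁ : M.Bounded ∨ N₁.Bounded)
    (h₂ : M.Bounded ∨ N₂.Bounded) (hδ₁ : IsGradedMap N₁ N₁ (-s) N₁.δ)
    (hδ₂ : IsGradedMap N₂ N₂ (-s) N₂.δ) (hf : IsGradedMap N₁ N₂ (t - s) f) {g : Γ}
    {v : M.carrier ⊗[K] N₁.carrier} (hv : v ∈ tensorGr M.gr N₁.gr g) :
    coneEntry M f t v ∈ tensorGr M.gr N₂.gr (g + (t - s)) := by
  have := lTensor_mem_tensorGr (gM := M.gr) (coneSnd_mem (N₁ := N₁) (N₂ := N₂) (f := f) (t := t))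
    (boxD_mem_tensorGr hM (isGradedMap_cone_δ hδ₁ hδ₂ hf) (Bounded.or_cone h₁ h₂)
      (lTensor_mem_tensorGr coneInl_mem hv))
  rwa [show g + 0 + -s + t = g + (t - s) by abel] at this

end BoxCone

variable {M : AData A K} {N N' : DData A K}

/-- Homotopy equivalences of boxes from maps on the tensor products over the field. -/
theorem box_homotopyEquivalent_of_maps (hM : M.IsAInfty)
    (hN : CompleteOrthogonalIdempotents N.proj) (hN' : CompleteOrthogonalIdempotents N'.proj)
    (hd : ∀ v, tensorProj M.proj N.proj (boxD M N v) = boxD M N (tensorProj M.proj N.proj v))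
    (hd' : ∀ v, tensorProj M.proj N'.proj (boxD M N' v) =
      boxD M N' (tensorProj M.proj N'.proj v))
    (f : M.carrier ⊗[K] N.carrier →ₗ[K] M.carrier ⊗[K] N'.carrier)
    (g : M.carrier ⊗[K] N'.carrier →ₗ[K] M.carrier ⊗[K] N.carrier)
    (h : M.carrier ⊗[K] N.carrier →ₗ[K] M.carrier ⊗[K] N.carrier)
    (h' : M.carrier ⊗[K] N'.carrier →ₗ[K] M.carrier ⊗[K] N'.carrier)
    (hf : ∀ v, tensorProj M.proj N'.proj (f v) = f (tensorProj M.proj N.proj v))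
    (hg : ∀ v, tensorProj M.proj N.proj (g v) = g (tensorProj M.proj N'.proj v))
    (hh : ∀ v, tensorProj M.proj N.proj (h v) = h (tensorProj M.proj N.proj v))
    (hh' : ∀ v, tensorProj M.proj N'.proj (h' v) = h' (tensorProj M.proj N'.proj v))
    (gf : ∀ k, ∀ v ∈ tensorGr M.gr N.gr k, f v ∈ tensorGr M.gr N'.gr (k + 0))
    (gg : ∀ k, ∀ v ∈ tensorGr M.gr N'.gr k, g v ∈ tensorGr M.gr N.gr (k + 0))
    (gh : ∀ k, ∀ v ∈ tensorGr M.gr N.gr k, h v ∈ tensorGr M.gr N.gr (k + s))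
    (gh' : ∀ k, ∀ v ∈ tensorGr M.gr N'.gr k, h' v ∈ tensorGr M.gr N'.gr (k + s))
    (ef : ∀ v, f (boxD M N v) + boxD M N' (f v) = 0)
    (eg : ∀ v, g (boxD M N' v) + boxD M N (g v) = 0)
    (eh : ∀ v, g (f v) + tensorProj M.proj N.proj v = boxD M N (h v) + h (boxD M N v))
    (eh' : ∀ v, f (g v) + tensorProj M.proj N'.proj v = boxD M N' (h' v) + h' (boxD M N' v)) :
    CData.HomotopyEquivalent s (box M N) (box M N') := by
  have fix : ∀ {v}, v ∈ tensorI M.proj N.proj → tensorProj M.proj N.proj v = v :=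
    fun hv => tensorProj_of_mem hM.proj_idem hN hv
  have fix' : ∀ {v}, v ∈ tensorI M.proj N'.proj → tensorProj M.proj N'.proj v = v :=
    fun hv => tensorProj_of_mem hM.proj_idem hN' hv
  -- The projection built into the differential of `box` acts trivially here, because `boxD`
  -- preserves the projected subspace.
  have cd : ∀ v : tensorI M.proj N.proj, ((box M N).d v : M.carrier ⊗[K] N.carrier) =
      boxD M N v := fun v => by
    change tensorProj M.proj N.proj (boxD M N v) = _
    rw [hd, fix v.2]
  have cd' : ∀ v : tensorI M.proj N'.proj, ((box M N').d v : M.carrier ⊗[K] N'.carrier) =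
      boxD M N' v := fun v => by
    change tensorProj M.proj N'.proj (boxD M N' v) = _
    rw [hd', fix' v.2]
  have hfI : ∀ v ∈ tensorI M.proj N.proj, f v ∈ tensorI M.proj N'.proj :=
    fun v hv => ⟨f v, by rw [hf, fix hv]⟩
  have hgI : ∀ v ∈ tensorI M.proj N'.proj, g v ∈ tensorI M.proj N.proj :=
    fun v hv => ⟨g v, by rw [hg, fix' hv]⟩
  have hhI : ∀ v ∈ tensorI M.proj N.proj, h v ∈ tensorI M.proj N.proj :=
    fun v hv => ⟨h v, by rw [hh, fix hv]⟩
  have hhI' : ∀ v ∈ tensorI M.proj N'.proj, h' v ∈ tensorI M.proj N'.proj :=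
    fun v hv => ⟨h' v, by rw [hh', fix' hv]⟩
  refine ⟨f.restrict hfI, g.restrict hgI, h.restrict hhI, h'.restrict hhI',
    fun k v hv => gf k v hv, fun k v hv => gg k v hv, fun k v hv => gh k v hv,
    fun k v hv => gh' k v hv, ?_, ?_, ?_, ?_⟩
  · refine LinearMap.ext fun v => Subtype.ext ?_
    refine (cd' _).trans (Eq.trans ?_ (congrArg f (cd v)).symm)
    exact (eq_of_add_eq_zero K (ef v)).symm
  · refine LinearMap.ext fun v => Subtype.ext ?_
    refine (cd _).trans (Eq.trans ?_ (congrArg g (cd' v)).symm)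
    exact (eq_of_add_eq_zero K (eg v)).symm
  · refine LinearMap.ext fun v => Subtype.ext ?_
    refine Eq.trans ?_ (Eq.trans (eh v) (congrArg₂ (· + ·) (cd (h.restrict hhI v)).symm
      (congrArg h (cd v)).symm))
    rw [fix v.2]
    rfl
  · refine LinearMap.ext fun v => Subtype.ext ?_
    refine Eq.trans ?_ (Eq.trans (eh' v) (congrArg₂ (· + ·) (cd' (h'.restrict hhI' v)).symm
      (congrArg h' (cd' v)).symm))
    rw [fix' v.2]
    rfl

theorem curvature_cone_eq_zero (hN : N.IsTypeD) (hN' : N'.IsTypeD)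
    {ψ : N.carrier →ₗ[K] A.ext K ⊗[K] N'.carrier} (hψ : diff ψ = 0) (t : Γ) :
    curvature (A.dExt K) (cone N N' ψ t).δ = 0 := by
  rw [curvature_cone, hψ, hN.curvature_eq_zero, hN'.curvature_eq_zero]
  simp only [LinearMap.zero_comp, LinearMap.comp_zero, add_zero]

/-- The cone of a morphism is flat, so its box operator squares to zero, and the off-diagonal entry
of the square is the asserted sum. -/
theorem coneEntry_comm (hM : M.IsAInfty) (hN : N.IsTypeD) (hN' : N'.IsTypeD)
    (h : M.Bounded ∨ N.Bounded) (h' : M.Bounded ∨ N'.Bounded)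
    {ψ : N.carrier →ₗ[K] A.ext K ⊗[K] N'.carrier} (hψ : diff ψ = 0) (t : Γ)
    (v : M.carrier ⊗[K] N.carrier) :
    coneEntry M ψ t (boxD M N v) + boxD M N' (coneEntry M ψ t v) = 0 := by
  rw [← coneSnd_boxD_boxD_coneInl h h', boxD_boxD_eq_zero hM (Bounded.or_cone h h')
    (curvature_cone_eq_zero hN hN' hψ t), map_zero]

/-- A map whose differential is the identity up to a map that factors through a strict quotient and
a strict subobject induces a null homotopy of the identity, up to a corner term. -/
theorem exists_coneEntry_of_diff {C : DData A K} (hM : M.IsAInfty) (hM1 : M.StrictlyUnital)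
    (hC : M.Bounded ∨ C.Bounded) (hC0 : curvature (A.dExt K) C.δ = 0)
    {f : C.carrier →ₗ[K] A.ext K ⊗[K] C.carrier} {e : N.carrier →ₗ[K] A.ext K ⊗[K] N'.carrier}
    {p : C.carrier →ₗ[K] N.carrier} (hp : ∀ y, N.δ (p y) = p.lTensor (A.ext K) (C.δ y))
    {i : N'.carrier →ₗ[K] C.carrier} (hi : ∀ y, C.δ (i y) = i.lTensor (A.ext K) (N'.δ y))
    (hdiff : diff f = idHom C + i.lTensor (A.ext K) ∘ₗ e ∘ₗ p) (u : Γ)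
    (w : M.carrier ⊗[K] C.carrier) :
    ∃ z, (p.lTensor M.carrier w = 0 → z = 0) ∧
      coneEntry M f u (boxD M C w) + boxD M C (coneEntry M f u w) =
        tensorProj M.proj C.proj w + i.lTensor M.carrier z := by
  -- As C is flat, only the off-diagonal entry `diff f` is left. Its identity part is rewritten with
  -- the identity morphism of the outer cone, the form required by `sum_insertTerm_idHom`.
  have hcurv : curvature (A.dExt K) (cone C C f u).δ =
      (coneInr C C f u ∘ₗ coneFst C C f u).lTensor (A.ext K) ∘ₗ idHom (cone C C f u) +
        (coneInr C C f u ∘ₗ i).lTensor (A.ext K) ∘ₗ e ∘ₗ p ∘ₗ coneFst C C f u := by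
    rw [curvature_cone, hC0, hdiff, idHom_cone (N := C) (N' := C) (f := f)]
    simp only [LinearMap.zero_comp, LinearMap.comp_zero, add_zero, zero_add,
      LinearMap.lTensor_comp, LinearMap.comp_add, LinearMap.add_comp]
    have e1 : ∀ (k : (cone C C f u).carrier →ₗ[K] A.ext K ⊗[K] C.carrier),
        (coneFst C C f u).lTensor (A.ext K) ∘ₗ (coneInl C C f u).lTensor (A.ext K) ∘ₗ k = k :=
      fun k => by
        rw [← LinearMap.comp_assoc, ← LinearMap.lTensor_comp, coneFst_comp_coneInl,
          LinearMap.lTensor_id, LinearMap.id_comp]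
    have e2 : ∀ (k : (cone C C f u).carrier →ₗ[K] A.ext K ⊗[K] C.carrier),
        (coneFst C C f u).lTensor (A.ext K) ∘ₗ (coneInr C C f u).lTensor (A.ext K) ∘ₗ k = 0 :=
      fun k => by
        rw [← LinearMap.comp_assoc, ← LinearMap.lTensor_comp, coneFst_comp_coneInr,
          LinearMap.lTensor_zero, LinearMap.zero_comp]
    simp only [LinearMap.comp_assoc, e1, e2, LinearMap.comp_zero, add_zero]
  have hpstrict : ∀ y, N.δ ((p ∘ₗ coneFst C C f u) y) =
      (p ∘ₗ coneFst C C f u).lTensor (A.ext K) ((cone C C f u).δ y) := fun y => by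
    rw [LinearMap.comp_apply, hp, coneFst_δ, LinearMap.lTensor_comp_apply]
  have histrict : ∀ y, (cone C C f u).δ ((coneInr C C f u ∘ₗ i) y) =
      (coneInr C C f u ∘ₗ i).lTensor (A.ext K) (N'.δ y) := fun y => by
    rw [LinearMap.comp_apply, cone_δ_coneInr, hi, LinearMap.lTensor_comp_apply]
  -- The corner factors through the strict maps p and i, so inserting it amounts to inserting e
  -- between N and N'. Its total contribution depends on w only through p, and it lies in the image
  -- of i.
  let Q : ℕ → M.carrier ⊗[K] N.carrier →ₗ[K] M.carrier ⊗[K] N'.carrier := fun n =>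
    TensorProduct.lift (insertEval M.carrier N.δ e N'.δ n ∘ₗ M.opWord)
  have hQ : ∀ n v, insertTerm M (cone C C f u) (curvature (A.dExt K) (cone C C f u).δ) n v =
      insertTerm M (cone C C f u) ((coneInr C C f u ∘ₗ coneFst C C f u).lTensor (A.ext K) ∘ₗ
        idHom (cone C C f u)) n v + (coneInr C C f u ∘ₗ i).lTensor M.carrier
          (Q n ((p ∘ₗ coneFst C C f u).lTensor M.carrier v)) := by
    intro n v
    induction v using TensorProduct.induction_on with
    | zero => simp
    | tmul x y =>
      rw [insertTerm_tmul, hcurv, insertEval_add, LinearMap.add_apply, LinearMap.add_apply,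
        insertTerm_tmul, insertEval_map _ hpstrict _ histrict]
      rfl
    | add s t hs ht => simp only [map_add, hs, ht]; abel
  obtain ⟨n, hn⟩ := boxD_boxD hM (Bounded.or_cone (f := f) (t := u) hC hC)
    ((coneInl C C f u).lTensor M.carrier w)
  -- Any cutoff past n gives the same square; n + 2 also ensures that the term of word length one is
  -- included.
  have hsq := (hn (n + 2) (by omega)).trans
    ((Finset.sum_congr rfl fun k _ => hQ k _).trans Finset.sum_add_distrib)
  rw [sum_insertTerm_idHom hM hM1 _ (by omega), ← map_sum] at hsq
  refine ⟨∑ k ∈ Finset.range (n + 2), Q k (p.lTensor M.carrier w), ?_, ?_⟩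
  · intro hw
    rw [hw]
    simp
  · rw [← coneSnd_boxD_boxD_coneInl (f := f) (t := u) hC hC w, hsq, map_add,
      tensorProj_lTensor coneInl_proj]
    simp only [LinearMap.lTensor_comp_apply, lTensor_coneFst_coneInl, lTensor_coneSnd_coneInr]

/-- Pairing with a strictly unital `A∞` module preserves homotopy equivalences. -/
theorem box_homotopyEquivalent (hM : M.IsAInfty) (hM1 : M.StrictlyUnital)
    (hN : N.IsTypeD) (hN' : N'.IsTypeD) (h : M.Bounded ∨ N.Bounded) (h' : M.Bounded ∨ N'.Bounded)
    (hNN' : DData.HomotopyEquivalent N N') :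
    CData.HomotopyEquivalent s (box M N) (box M N') := by
  obtain ⟨ψ, φ, hψ, hφ, ⟨H, hHg, hH⟩, ⟨H', hHg', hH'⟩⟩ := hNN'
  set C := cone N N' ψ s with hC
  -- The matrix has degree s, so the outer cone needs the shift t with t - s = s.
  set k := coneEntry M (coneHomotopy ψ φ H H' s) (s + s) with hk
  have hψg : IsGradedMap N N' (s - s) ψ := by rw [sub_self]; exact hψ.isGradedMap
  have hCg : IsGradedMap C C (-s) C.δ :=
    isGradedMap_cone_δ hN.isGradedMap hN'.isGradedMap hψg
  have hfg : IsGradedMap C C (s + s - s) (coneHomotopy ψ φ H H' s) := by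
    rw [add_sub_cancel_right]
    exact isGradedMap_coneHomotopy hφ.isGradedMap hHg hHg'
  have hCb : M.Bounded ∨ C.Bounded := Bounded.or_cone h h'
  have hCp : CompleteOrthogonalIdempotents C.proj := cone_proj_idem hN.proj_idem hN'.proj_idem
  have hkE : ∀ v, tensorProj M.proj C.proj (k v) = k (tensorProj M.proj C.proj v) :=
    tensorProj_coneEntry hM hCb hCb hCp hCp hCg hCg hfg
  have hkg : ∀ {g v}, v ∈ tensorGr M.gr C.gr g → k v ∈ tensorGr M.gr C.gr (g + (s + s - s)) :=
    fun hv => coneEntry_mem_tensorGr hM hCb hCb hCg hCg hfg hv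
  have key := exists_coneEntry_of_diff hM hM1 hCb (curvature_cone_eq_zero hN hN' hψ.diff_eq s)
    coneFst_δ cone_δ_coneInr (diff_coneHomotopy (t := s) hφ.diff_eq hH hH') (s + s)
  set inl := (coneInl N N' ψ s).lTensor M.carrier with hinl
  set inr := (coneInr N N' ψ s).lTensor M.carrier with hinr
  set fst := (coneFst N N' ψ s).lTensor M.carrier with hfst
  set snd := (coneSnd N N' ψ s).lTensor M.carrier with hsnd
  have fi : ∀ v, fst (inl v) = v := lTensor_coneFst_coneInl
  have sr : ∀ v, snd (inr v) = v := lTensor_coneSnd_coneInr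
  have fr : ∀ v, fst (inr v) = 0 := lTensor_coneFst_coneInr
  have si : ∀ v, snd (inl v) = 0 := lTensor_coneSnd_coneInl
  have dec : ∀ v, inl (fst v) + inr (snd v) = v := cone_decomposition
  have fd : ∀ v, fst (boxD M C v) = boxD M N (fst v) := coneFst_boxD h h'
  have dr : ∀ v, boxD M C (inr v) = inr (boxD M N' v) := boxD_coneInr h h'
  have di : ∀ v, boxD M C (inl v) = inl (boxD M N v) + inr (coneEntry M ψ s v) :=
    boxD_coneInl h h'
  have Ei : ∀ v, tensorProj M.proj C.proj (inl v) = inl (tensorProj M.proj N.proj v) :=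
    fun v => tensorProj_lTensor coneInl_proj v
  have Er : ∀ v, tensorProj M.proj C.proj (inr v) = inr (tensorProj M.proj N'.proj v) :=
    fun v => tensorProj_lTensor coneInr_proj v
  have Ef : ∀ v, tensorProj M.proj N.proj (fst v) = fst (tensorProj M.proj C.proj v) :=
    fun v => tensorProj_lTensor coneFst_proj v
  have Es : ∀ v, tensorProj M.proj N'.proj (snd v) = snd (tensorProj M.proj C.proj v) :=
    fun v => tensorProj_lTensor coneSnd_proj v
  -- The entries of k are placed as in the matrix with rows (H, φ) and (0, H'): φ yields the inverse
  -- chain map, H and H' the homotopies. The lower left entry of k is not needed.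
  refine box_homotopyEquivalent_of_maps hM hN.proj_idem hN'.proj_idem
    (tensorProj_boxD hM hN.proj_idem hN.isGradedMap h)
    (tensorProj_boxD hM hN'.proj_idem hN'.isGradedMap h')
    (coneEntry M ψ s) (fst ∘ₗ k ∘ₗ inr) (fst ∘ₗ k ∘ₗ inl) (snd ∘ₗ k ∘ₗ inr)
    (tensorProj_coneEntry hM h h' hN.proj_idem hN'.proj_idem hN.isGradedMap hN'.isGradedMap hψg)
    (fun v => ?_) (fun v => ?_) (fun v => ?_) (fun g v hv => ?_) (fun g v hv => ?_)
    (fun g v hv => ?_) (fun g v hv => ?_)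
    (coneEntry_comm hM hN hN' h h' hψ.diff_eq s) (fun v => ?_) (fun v => ?_) (fun v => ?_)
  · simp only [LinearMap.comp_apply, Ef, hkE, Er]
  · simp only [LinearMap.comp_apply, Ef, hkE, Ei]
  · simp only [LinearMap.comp_apply, Es, hkE, Er]
  · have := coneEntry_mem_tensorGr hM h h' hN.isGradedMap hN'.isGradedMap hψg hv
    rwa [sub_self] at this
  · have := lTensor_mem_tensorGr coneFst_mem (hkg (lTensor_mem_tensorGr coneInr_mem hv))
    rwa [show g + -s + (s + s - s) + 0 = g + 0 by abel] at this
  · have := lTensor_mem_tensorGr coneFst_mem (hkg (lTensor_mem_tensorGr coneInl_mem hv))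
    rwa [show g + 0 + (s + s - s) + 0 = g + s by abel] at this
  · have := lTensor_mem_tensorGr coneSnd_mem (hkg (lTensor_mem_tensorGr coneInr_mem hv))
    rwa [show g + -s + (s + s - s) + s = g + s by abel] at this
  -- Upper right entry of ∂k + k∂: the identity has none and the corner vanishes on `inr v`, so the
  -- inverse map is a chain map.
  · obtain ⟨z, hz, e⟩ := key (inr v)
    have := congrArg fst e
    rw [hz (fr v), map_zero, add_zero, Er, fr, map_add, dr, fd] at this
    exact this
  -- Upper left entry: the corner lies in the image of `inr` and is killed by `fst`. The path from
  -- `inl` to `inr` contributes the composite gf.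
  · obtain ⟨z, -, e⟩ := key (inl v)
    have := congrArg fst e
    rw [map_add, map_add, fr, add_zero, Ei, fi, fd, di, map_add, map_add] at this
    simp only [LinearMap.comp_apply]
    rw [← this]
    have := add_self_eq_zero K (fst (k (inr (coneEntry M ψ s v))))
    calc _ = (fst (k (inr (coneEntry M ψ s v))) + fst (k (inr (coneEntry M ψ s v)))) +
        (boxD M N (fst (k (inl v))) + fst (k (inl (boxD M N v)))) := by abel
      _ = _ := by rw [this, zero_add]
  -- Lower right entry: the corner vanishes on `inr v`, and the part of k(`inr v`) in the first
  -- summand contributes fg.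
  · obtain ⟨z, hz, e⟩ := key (inr v)
    have := congrArg snd e
    rw [hz (fr v), map_zero, add_zero, Er, sr, map_add, dr, ← hk, ← dec (k (inr v)), map_add, di,
      dr, map_add, map_add, si, zero_add, sr, sr] at this
    simp only [LinearMap.comp_apply]
    rw [← this]
    have := add_self_eq_zero K (coneEntry M ψ s (fst (k (inr v))))
    calc _ = (coneEntry M ψ s (fst (k (inr v))) + coneEntry M ψ s (fst (k (inr v)))) +
        (boxD M N' (snd (k (inr v))) + snd (k (inr (boxD M N' v)))) := by abel
      _ = _ := by rw [this, zero_add]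

end Structures

/-! ### Gradings described by homogeneous bases. -/

section Grading

variable {Γ K V : Type*} [Field K] [AddCommGroup V] [Module K V]

theorem isGrading_of_basis {ι : Type*} (b : Module.Basis ι K V) (deg : ι → Γ) :
    IsGrading fun g => Submodule.span K (b '' {i | deg i = g}) := by
  constructor
  · intro g
    have h : (⨆ (j : Γ) (_ : j ≠ g), Submodule.span K (b '' {i | deg i = j})) ≤
        Submodule.span K (b '' {i | deg i ≠ g}) :=
      iSup_le fun j => iSup_le fun hj => Submodule.span_mono
        (Set.image_mono fun i (hi : deg i = j) => by simpa [hi] using hj)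
    exact (b.linearIndependent.disjoint_span_image
      (Set.disjoint_left.2 fun i (h1 : deg i = g) (h2 : deg i ≠ g) => h2 h1)).mono_right h
  · rw [eq_top_iff, ← b.span_eq, Submodule.span_le]
    rintro _ ⟨i, rfl⟩
    exact Submodule.mem_iSup_of_mem (deg i) (Submodule.subset_span ⟨i, rfl, rfl⟩)

universe a b in
-- Together with `isGrading_of_basis` this reduces gradings to bases with degrees, a form that
-- passes at once to tensor products and to extensions of scalars.
theorem IsGrading.exists_basis {Γ : Type a} {K : Type*} {V : Type b} [Field K] [AddCommGroup V]
    [Module K V] {gr : Γ → Submodule K V} (h : IsGrading gr) :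
    ∃ (ι : Type (max a b)) (b : Module.Basis ι K V) (deg : ι → Γ),
      ∀ g, gr g = Submodule.span K (b '' {i | deg i = g}) := by
  classical
  have hi : DirectSum.IsInternal gr :=
    (DirectSum.isInternal_submodule_iff_iSupIndep_and_iSup_eq_top gr).2 h
  let c := hi.collectedBasis fun g => Module.Basis.ofVectorSpace K (gr g)
  have hc : ∀ i, c i = Module.Basis.ofVectorSpace K (gr i.1) i.2 := fun i => by
    simp [c]
  refine ⟨_, c, Sigma.fst, fun g => ?_⟩
  have := congrArg (Submodule.map (gr g).subtype) (Module.Basis.ofVectorSpace K (gr g)).span_eq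
  rw [Submodule.map_span, Submodule.map_top, Submodule.range_subtype] at this
  rw [← this]
  congr 1
  ext v
  constructor
  · rintro ⟨_, ⟨i, rfl⟩, rfl⟩
    exact ⟨⟨g, i⟩, rfl, hc _⟩
  · rintro ⟨⟨g', i⟩, rfl, rfl⟩
    exact ⟨_, ⟨i, rfl⟩, (hc _).symm⟩

/-- The restriction of a grading to the range of a homogeneous idempotent. -/
theorem IsGrading.comap_range {gr : Γ → Submodule K V} (h : IsGrading gr) {e : V →ₗ[K] V}
    (he : ∀ v, e (e v) = e v) (hgr : ∀ g, ∀ v ∈ gr g, e v ∈ gr g) :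
    IsGrading fun g => (gr g).comap (LinearMap.range e).subtype := by
  constructor
  · intro g
    rw [Submodule.disjoint_def]
    intro x hx hx'
    apply Subtype.ext
    refine Submodule.disjoint_def.1 (h.1 g) x.1 hx ?_
    have : Submodule.map (LinearMap.range e).subtype
        (⨆ (j : Γ) (_ : j ≠ g), (gr j).comap (LinearMap.range e).subtype) ≤
        ⨆ (j : Γ) (_ : j ≠ g), gr j := by
      simp only [Submodule.map_iSup]
      exact iSup₂_mono fun j _ => Submodule.map_comap_le _ _
    exact this ⟨x, hx', rfl⟩
  · rw [eq_top_iff]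
    intro x _
    have h1 : (⨆ g, gr g) ≤
        (⨆ g, (gr g).comap (LinearMap.range e).subtype).comap e.rangeRestrict :=
      iSup_le fun g v hv => Submodule.mem_iSup_of_mem g (hgr g v hv)
    have h2 : x = e.rangeRestrict x.1 := by
      obtain ⟨_, w, rfl⟩ := x
      exact Subtype.ext (he w).symm
    rw [h2]
    exact h1 (h.2 ▸ Submodule.mem_top)

theorem span_tmul_basis {Γ K M N ι κ : Type*} [AddCommGroup Γ] [Field K] [AddCommGroup M]
    [Module K M] [AddCommGroup N] [Module K N] (b : Module.Basis ι K M) (c : Module.Basis κ K N)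
    (deg : ι → Γ) (deg' : κ → Γ) (k : Γ) :
    tensorGr (fun g => Submodule.span K (b '' {i | deg i = g}))
        (fun g => Submodule.span K (c '' {i | deg' i = g})) k =
      Submodule.span K (b.tensorProduct c '' {i | deg i.1 + deg' i.2 = k}) := by
  apply le_antisymm
  · rw [tensorGr_eq_span, Submodule.span_le]
    rintro _ ⟨g, h, hk, x, hx, y, hy, rfl⟩
    rw [SetLike.mem_coe]
    induction hx using Submodule.span_induction with
    | zero => simp
    | add x x' _ _ hx hx' => rw [TensorProduct.add_tmul]; exact add_mem hx hx'
    | smul r x _ hx => rw [← TensorProduct.smul_tmul']; exact Submodule.smul_mem _ _ hx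
    | mem x hx =>
      obtain ⟨i, hi, rfl⟩ := hx
      induction hy using Submodule.span_induction with
      | zero => simp
      | add x x' _ _ hx hx' => rw [TensorProduct.tmul_add]; exact add_mem hx hx'
      | smul r x _ hx => rw [TensorProduct.tmul_smul]; exact Submodule.smul_mem _ _ hx
      | mem y hy =>
        obtain ⟨j, hj, rfl⟩ := hy
        refine Submodule.subset_span ⟨(i, j), ?_, by simp⟩
        rw [Set.mem_ofPred_eq] at hi hj ⊢
        rw [hi, hj, hk]
  · rw [Submodule.span_le]
    rintro _ ⟨⟨i, j⟩, hij, rfl⟩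
    rw [Module.Basis.tensorProduct_apply]
    have hi : b i ∈ Submodule.span K (b '' {i' | deg i' = deg i}) :=
      Submodule.subset_span ⟨i, rfl, rfl⟩
    have hj : c j ∈ Submodule.span K (c '' {j' | deg' j' = deg' j}) :=
      Submodule.subset_span ⟨j, rfl, rfl⟩
    exact tmul_mem_tensorGr (gM := fun g => Submodule.span K (b '' {i | deg i = g}))
      (gN := fun g => Submodule.span K (c '' {i | deg' i = g})) hij hi hj

theorem IsGrading.tensorGr {Γ K M N : Type*} [AddCommGroup Γ] [Field K] [AddCommGroup M]
    [Module K M] [AddCommGroup N] [Module K N] {gM : Γ → Submodule K M} {gN : Γ → Submodule K N}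
    (hM : IsGrading gM) (hN : IsGrading gN) : IsGrading (tensorGr gM gN) := by
  obtain ⟨ι, b, deg, hb⟩ := hM.exists_basis
  obtain ⟨κ, c, deg', hc⟩ := hN.exists_basis
  obtain rfl : gM = _ := funext hb
  obtain rfl : gN = _ := funext hc
  have : StablePairing.tensorGr _ _ = _ := funext (span_tmul_basis b c deg deg')
  rw [this]
  exact isGrading_of_basis (b.tensorProduct c) fun i => deg i.1 + deg' i.2

end Grading

/-! ### The pairing is a complex. -/

section Structures

variable {Γ : Type*} [AddCommGroup Γ] {s : Γ} {A : DGA Γ s} {K : Type*} [Field K]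
  [Algebra (ZMod 2) K]

theorem box_isComplex {M : AData A K} (hM : M.IsAInfty) {N : DData A K} (hN : N.IsTypeD)
    (h : M.Bounded ∨ N.Bounded) : (box M N).IsComplex s where
  isGrading := (hM.isGrading.tensorGr hN.isGrading).comap_range
    (tensorProj_tensorProj hM.proj_idem hN.proj_idem)
    fun _ _ hv => tensorProj_mem_tensorGr hM.proj_mem hN.proj_mem hv
  degree g v hv := tensorProj_mem_tensorGr hM.proj_mem hN.proj_mem
    (boxD_mem_tensorGr hM hN.isGradedMap h hv)
  d_d := by
    refine LinearMap.ext fun v => Subtype.ext ?_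
    change tensorProj M.proj N.proj (boxD M N (tensorProj M.proj N.proj (boxD M N v))) = 0
    rw [← tensorProj_boxD hM hN.proj_idem hN.isGradedMap h, boxD_boxD_eq_zero hM h
      hN.curvature_eq_zero, map_zero, map_zero]

end Structures

/-! ### Extension of scalars characterized by semilinear maps. -/

section IsExt

variable {K L : Type*} [Field K] [Field L] {σ : K →+* L} {V V' U U' : Type*}
  [AddCommGroup V] [Module K V] [AddCommGroup V'] [Module L V']
  [AddCommGroup U] [Module K U] [AddCommGroup U'] [Module L U']

/-- The semilinear map `j : V → V'` exhibits `V'` as the extension of scalars of `V` along the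
field extension `σ`. -/
structure IsExt (j : V →ₛₗ[σ] V') : Prop where
  span_range : Submodule.span L (Set.range j) = ⊤
  exists_functional : ∀ f : V →ₗ[K] K, ∃ f' : V' →ₗ[L] L, ∀ x, f' (j x) = σ (f x)

namespace IsExt

theorem induction {j : V →ₛₗ[σ] V'} (h : IsExt j) {p : V' → Prop} (h0 : p 0)
    (hadd : ∀ x y, p x → p y → p (x + y)) (hsmul : ∀ (c : L) x, p x → p (c • x))
    (hj : ∀ x, p (j x)) (x : V') : p x := by
  have hx : x ∈ Submodule.span L (Set.range j) := h.span_range ▸ Submodule.mem_top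
  induction hx using Submodule.span_induction with
  | mem x hx => obtain ⟨y, rfl⟩ := hx; exact hj y
  | zero => exact h0
  | add x y _ _ hx hy => exact hadd x y hx hy
  | smul c x _ hx => exact hsmul c x hx

theorem hom_ext {M R : Type*} [Semiring R] {τ : L →+* R} [AddCommMonoid M] [Module R M]
    {j : V →ₛₗ[σ] V'} (h : IsExt j) {f g : V' →ₛₗ[τ] M} (hfg : ∀ x, f (j x) = g (j x)) :
    f = g :=
  LinearMap.ext (h.induction (by simp) (fun x y hx hy => by simp [hx, hy])
    (fun c x hx => by simp [hx]) hfg)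

/-- The images of the elements of a basis form a basis. -/
def basis {j : V →ₛₗ[σ] V'} (h : IsExt j) {ι : Type*} (b : Module.Basis ι K V) :
    Module.Basis ι L V' :=
  .mk (v := fun i => j (b i))
    (by
      rw [linearIndependent_iff']
      intro t c hc i hi
      -- The extended coordinate functional applied to a relation returns its i-th coefficient.
      obtain ⟨f, hf⟩ := h.exists_functional (b.coord i)
      have h1 := congrArg f hc
      classical
      simpa [hf, Finsupp.single_apply, apply_ite σ, hi] using h1)
    (by
      rw [← h.span_range, Submodule.span_le]
      rintro _ ⟨x, rfl⟩
      have hx : x ∈ Submodule.span K (Set.range b) := b.span_eq ▸ Submodule.mem_top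
      rw [SetLike.mem_coe]
      induction hx using Submodule.span_induction with
      | mem x hx => obtain ⟨i, rfl⟩ := hx; exact Submodule.subset_span ⟨i, rfl⟩
      | zero => simp
      | add x y _ _ hx hy => rw [map_add]; exact add_mem hx hy
      | smul c x _ hx => rw [LinearMap.map_smulₛₗ]; exact Submodule.smul_mem _ _ hx)

@[simp]
theorem basis_apply {j : V →ₛₗ[σ] V'} (h : IsExt j) {ι : Type*} (b : Module.Basis ι K V) (i : ι) :
    h.basis b i = j (b i) := by
  simp [basis]

/-- Converse of `basis`: carrying one basis to a basis already characterizes an extension. Tensor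
products, composites and factorizations of extensions follow from it. -/
theorem of_basis {j : V →ₛₗ[σ] V'} {ι : Type*} (b : Module.Basis ι K V)
    (b' : Module.Basis ι L V') (h : ∀ i, b' i = j (b i)) : IsExt j where
  span_range := by
    rw [eq_top_iff, ← b'.span_eq]
    exact Submodule.span_mono (by rintro _ ⟨i, rfl⟩; exact ⟨b i, (h i).symm⟩)
  exists_functional f := by
    refine ⟨b'.constr L fun i => σ (f (b i)), fun x => ?_⟩
    have hx : x ∈ Submodule.span K (Set.range b) := b.span_eq ▸ Submodule.mem_top
    induction hx using Submodule.span_induction with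
    | mem x hx => obtain ⟨i, rfl⟩ := hx; rw [← h, Module.Basis.constr_basis]
    | zero => simp
    | add x y _ _ hx hy => simp [hx, hy]
    | smul c x _ hx => simp [hx]

theorem exists_lift {j : V →ₛₗ[σ] V'} (h : IsExt j) (f : V →ₛₗ[σ] U') :
    ∃ f' : V' →ₗ[L] U', ∀ x, f' (j x) = f x := by
  let b := Module.Basis.ofVectorSpace K V
  refine ⟨(h.basis b).constr L fun i => f (b i), fun x => ?_⟩
  have hx : x ∈ Submodule.span K (Set.range b) := b.span_eq ▸ Submodule.mem_top
  induction hx using Submodule.span_induction with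
  | mem x hx => obtain ⟨i, rfl⟩ := hx; rw [← h.basis_apply, Module.Basis.constr_basis]
  | zero => simp
  | add x y _ _ hx hy => simp [hx, hy]
  | smul c x _ hx => simp [hx]

theorem tensor {j : V →ₛₗ[σ] V'} (hj : IsExt j) {k : U →ₛₗ[σ] U'} (hk : IsExt k) :
    IsExt (TensorProduct.map j k) :=
  let b := Module.Basis.ofVectorSpace K V
  let c := Module.Basis.ofVectorSpace K U
  of_basis (b.tensorProduct c) ((hj.basis b).tensorProduct (hk.basis c)) fun i => by
    rw [Module.Basis.tensorProduct_apply', Module.Basis.tensorProduct_apply', basis_apply,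
      basis_apply, TensorProduct.map_tmul]

/-- The extension of scalars restricts to the ranges of compatible idempotents. -/
theorem range {j : V →ₛₗ[σ] V'} (h : IsExt j) {e : V →ₗ[K] V} {e' : V' →ₗ[L] V'}
    (he : ∀ x, e (e x) = e x) (hj : ∀ x, e' (j x) = j (e x))
    (k : LinearMap.range e →ₛₗ[σ] LinearMap.range e') (hk : ∀ x, (k x : V') = j x) : IsExt k where
  span_range := by
    rw [eq_top_iff]
    rintro ⟨_, x, rfl⟩ -
    change e'.rangeRestrict x ∈ _
    induction x using h.induction with
    | h0 => simp
    | hadd x y hx hy => rw [map_add]; exact add_mem hx hy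
    | hsmul c x hx => rw [map_smul]; exact Submodule.smul_mem _ _ hx
    | hj x => exact Submodule.subset_span ⟨e.rangeRestrict x, Subtype.ext ((hk _).trans (hj x).symm)⟩
  exists_functional f := by
    obtain ⟨f', hf'⟩ := h.exists_functional (f ∘ₗ e.rangeRestrict)
    refine ⟨f' ∘ₗ (LinearMap.range e').subtype, fun x => ?_⟩
    simp only [LinearMap.comp_apply, Submodule.subtype_apply, hk, hf']
    congr 2
    obtain ⟨_, x, rfl⟩ := x
    exact Subtype.ext (he x)

theorem isGrading {Γ : Type*} {j : V →ₛₗ[σ] V'} (h : IsExt j) {gr : Γ → Submodule K V}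
    {gr' : Γ → Submodule L V'} (hg : ∀ g, gr' g = Submodule.span L (j '' gr g))
    (hgr : IsGrading gr) : IsGrading gr' := by
  obtain ⟨ι, b, deg, hb⟩ := hgr.exists_basis
  have : gr' = fun g => Submodule.span L (h.basis b '' {i | deg i = g}) := by
    funext g
    rw [hg, hb]
    apply le_antisymm
    · rw [Submodule.span_le]
      rintro _ ⟨x, hx, rfl⟩
      rw [SetLike.mem_coe] at hx ⊢
      induction hx using Submodule.span_induction with
      | mem x hx => obtain ⟨i, hi, rfl⟩ := hx; exact Submodule.subset_span ⟨i, hi, by simp⟩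
      | zero => simp
      | add x y _ _ hx hy => rw [map_add]; exact add_mem hx hy
      | smul c x _ hx => rw [LinearMap.map_smulₛₗ]; exact Submodule.smul_mem _ _ hx
    · rw [Submodule.span_le]
      rintro _ ⟨i, hi, rfl⟩
      exact Submodule.subset_span ⟨b i, Submodule.subset_span ⟨i, hi, rfl⟩, by simp⟩
  rw [this]
  exact isGrading_of_basis _ deg

theorem trans {L' V'' : Type*} [Field L'] {τ : L →+* L'} {ρ : K →+* L'} [AddCommGroup V'']
    [Module L' V''] {j : V →ₛₗ[σ] V'} (hj : IsExt j) {k : V' →ₛₗ[τ] V''} (hk : IsExt k)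
    (l : V →ₛₗ[ρ] V'') (hl : ∀ x, l x = k (j x)) : IsExt l :=
  let b := Module.Basis.ofVectorSpace K V
  of_basis b (hk.basis (hj.basis b)) fun i => by simp [hl]

/-- An extension of scalars along a composite factors through an extension along the first
factor. -/
theorem exists_factor {L' V'' : Type*} [Field L'] {τ : L →+* L'} {ρ : K →+* L'} [AddCommGroup V'']
    [Module L' V''] {j : V →ₛₗ[σ] V'} (hj : IsExt j) {k : V →ₛₗ[ρ] V''} (hk : IsExt k)
    (hρ : ∀ c, ρ c = τ (σ c)) : ∃ l : V' →ₛₗ[τ] V'', IsExt l ∧ ∀ x, l (j x) = k x := by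
  let b := Module.Basis.ofVectorSpace K V
  -- Apply τ to the coordinates in the basis j(b) and read them in the basis k(b).
  let l : V' →ₛₗ[τ] V'' :=
    { toFun := fun x =>
        (hk.basis b).repr.symm (Finsupp.mapRange τ (map_zero τ) ((hj.basis b).repr x))
      map_add' := fun x y => by
        rw [map_add, Finsupp.mapRange_add (map_add τ), map_add]
      map_smul' := fun c x => by
        rw [← map_smul]
        congr 1
        ext i
        simp }
  have hl : ∀ i, l (j (b i)) = k (b i) := fun i => by
    simp [l, ← hj.basis_apply, ← hk.basis_apply, -basis_apply]
  refine ⟨l, of_basis (hj.basis b) (hk.basis b) fun i => by simp [hl], fun x => ?_⟩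
  have hx : x ∈ Submodule.span K (Set.range b) := b.span_eq ▸ Submodule.mem_top
  induction hx using Submodule.span_induction with
  | mem x hx => obtain ⟨i, rfl⟩ := hx; exact hl i
  | zero => simp
  | add x y _ _ hx hy => simp [hx, hy]
  | smul c x _ hx => simp [hx, hρ]

/-- Two extensions of scalars along the same field extension are isomorphic. -/
theorem exists_equiv {V'' : Type*} [AddCommGroup V''] [Module L V''] {j : V →ₛₗ[σ] V'}
    (hj : IsExt j) {k : V →ₛₗ[σ] V''} (hk : IsExt k) :
    ∃ e : V' ≃ₗ[L] V'', ∀ x, e (j x) = k x := by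
  obtain ⟨f, hf⟩ := hj.exists_lift k
  obtain ⟨g, hg⟩ := hk.exists_lift j
  exact ⟨LinearEquiv.ofLinearMap f g (hk.hom_ext fun x => by simp [hf, hg])
    (hj.hom_ext fun x => by simp [hf, hg]), hf⟩

theorem mk_one [Algebra K L] : IsExt (σ := algebraMap K L)
    ({ toFun := fun x => 1 ⊗ₜ x
       map_add' := TensorProduct.tmul_add 1
       map_smul' := fun c x => by
         rw [TensorProduct.tmul_smul, algebraMap_smul] } : V →ₛₗ[algebraMap K L] L ⊗[K] V) :=
  of_basis (Module.Basis.ofVectorSpace K V) (Algebra.TensorProduct.basis L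
    (Module.Basis.ofVectorSpace K V)) fun i => by simp

end IsExt

end IsExt

/-! ### Projections and total gradings under extension of scalars. -/

section Tensor

variable {K L : Type*} [Field K] [Field L] {σ : K →+* L} {M M' N N' : Type*}
  [AddCommGroup M] [Module K M] [AddCommGroup M'] [Module L M']
  [AddCommGroup N] [Module K N] [AddCommGroup N'] [Module L N']
  {j : M →ₛₗ[σ] M'} {k : N →ₛₗ[σ] N'}

theorem tensorProj_map {ι : Type*} [Fintype ι] {p : ι → Module.End K M} {q : ι → Module.End K N}
    {p' : ι → Module.End L M'} {q' : ι → Module.End L N'} (hp : ∀ i x, p' i (j x) = j (p i x))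
    (hq : ∀ i x, q' i (k x) = k (q i x)) (v : M ⊗[K] N) :
    tensorProj p' q' (TensorProduct.map j k v) = TensorProduct.map j k (tensorProj p q v) := by
  induction v using TensorProduct.induction_on with
  | zero => simp
  | tmul x y => simp [tensorProj_tmul, hp, hq]
  | add v w hv hw => simp [hv, hw]

theorem tensorGr_span {Γ : Type*} [AddCommGroup Γ] {gM : Γ → Submodule K M}
    {gN : Γ → Submodule K N} {gM' : Γ → Submodule L M'} {gN' : Γ → Submodule L N'}
    (hM : ∀ g, gM' g = Submodule.span L (j '' gM g))
    (hN : ∀ g, gN' g = Submodule.span L (k '' gN g)) (g : Γ) :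
    tensorGr gM' gN' g = Submodule.span L (TensorProduct.map j k '' tensorGr gM gN g) := by
  apply le_antisymm
  · rw [tensorGr_eq_span, Submodule.span_le]
    rintro _ ⟨a, b, hab, x, hx, y, hy, rfl⟩
    rw [SetLike.mem_coe]
    rw [hM] at hx
    rw [hN] at hy
    induction hx using Submodule.span_induction with
    | zero => simp
    | add x x' _ _ hx hx' => rw [TensorProduct.add_tmul]; exact add_mem hx hx'
    | smul r x _ hx => rw [← TensorProduct.smul_tmul']; exact Submodule.smul_mem _ _ hx
    | mem x hx =>
      obtain ⟨x, hx, rfl⟩ := hx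
      induction hy using Submodule.span_induction with
      | zero => simp
      | add x x' _ _ hx hx' => rw [TensorProduct.tmul_add]; exact add_mem hx hx'
      | smul r x _ hx => rw [TensorProduct.tmul_smul]; exact Submodule.smul_mem _ _ hx
      | mem y hy =>
        obtain ⟨y, hy, rfl⟩ := hy
        exact Submodule.subset_span ⟨x ⊗ₜ y, tmul_mem_tensorGr hab hx hy, by simp⟩
  · rw [Submodule.span_le]
    rintro _ ⟨v, hv, rfl⟩
    rw [SetLike.mem_coe, tensorGr_eq_span] at hv
    rw [SetLike.mem_coe]
    induction hv using Submodule.span_induction with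
    | zero => simp
    | add x x' _ _ hx hx' => rw [map_add]; exact add_mem hx hx'
    | smul r x _ hx => rw [LinearMap.map_smulₛₗ]; exact Submodule.smul_mem _ _ hx
    | mem v hv =>
      obtain ⟨a, b, hab, x, hx, y, hy, rfl⟩ := hv
      rw [TensorProduct.map_tmul]
      exact tmul_mem_tensorGr hab (hM a ▸ Submodule.subset_span ⟨x, hx, rfl⟩)
        (hN b ▸ Submodule.subset_span ⟨y, hy, rfl⟩)

end Tensor

/-! ### Type `D` structures under extension of scalars. -/

section

section Span

variable {K L : Type*} [Field K] [Field L] {σ : K →+* L} {V V' U' : Type*}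
  [AddCommGroup V] [Module K V] [AddCommGroup V'] [Module L V'] [AddCommGroup U'] [Module L U']

theorem map_mem_of_mem_span_image {j : V →ₛₗ[σ] V'} {p : Set V} {q : Submodule L U'}
    {f : V' →ₗ[L] U'} (h : ∀ x ∈ p, f (j x) ∈ q) {x : V'} (hx : x ∈ Submodule.span L (j '' p)) :
    f x ∈ q := by
  have : Submodule.span L (j '' p) ≤ q.comap f := by
    rw [Submodule.span_le]
    rintro _ ⟨y, hy, rfl⟩
    exact h y hy
  exact this hx

theorem span_image_of_factor {L' V'' : Type*} [Field L'] {τ : L →+* L'} {ρ : K →+* L'}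
    [AddCommGroup V''] [Module L' V''] {j : V →ₛₗ[σ] V'} {k : V' →ₛₗ[τ] V''} {l : V →ₛₗ[ρ] V''}
    (h : ∀ x, k (j x) = l x) (p : Set V) :
    Submodule.span L' (l '' p) =
      Submodule.span L' (k '' (Submodule.span L (j '' p) : Submodule L V')) := by
  apply le_antisymm
  · rw [Submodule.span_le]
    rintro _ ⟨x, hx, rfl⟩
    exact Submodule.subset_span ⟨j x, Submodule.subset_span ⟨x, hx, rfl⟩, h x⟩
  · rw [Submodule.span_le]
    rintro _ ⟨x, hx, rfl⟩
    rw [SetLike.mem_coe] at hx ⊢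
    induction hx using Submodule.span_induction with
    | mem x hx =>
      obtain ⟨x, hx, rfl⟩ := hx
      rw [h]
      exact Submodule.subset_span ⟨x, hx, rfl⟩
    | zero => simp
    | add x y _ _ hx hy => rw [map_add]; exact add_mem hx hy
    | smul c x _ hx => rw [LinearMap.map_smulₛₗ]; exact Submodule.smul_mem _ _ hx

theorem IsExt.completeOrthogonalIdempotents {j : V →ₛₗ[σ] V'} (h : IsExt j) {ι : Type*} [Fintype ι]
    {p : ι → Module.End K V} {p' : ι → Module.End L V'} (hj : ∀ i x, p' i (j x) = j (p i x))
    (hp : CompleteOrthogonalIdempotents p) : CompleteOrthogonalIdempotents p' where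
  idem i := h.hom_ext fun x => by
    simp only [Module.End.mul_apply, hj]
    exact congrArg j (LinearMap.congr_fun (hp.idem i) x)
  ortho i k hik := h.hom_ext fun x => by
    simp only [Module.End.mul_apply, hj]
    exact (congrArg j (LinearMap.congr_fun (hp.ortho hik) x)).trans (map_zero j)
  complete := h.hom_ext fun x => by
    simp only [LinearMap.sum_apply, hj, ← map_sum, Module.End.one_apply]
    congr 1
    simpa using LinearMap.congr_fun hp.complete x

end Span

variable {Γ : Type*} [AddCommGroup Γ] {s : Γ} {K L : Type*} [Field K] [Algebra (ZMod 2) K]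
  [Field L] [Algebra (ZMod 2) L]

namespace DGA

variable (A : DGA Γ s) (σ : K →+* L)

/-- The ring homomorphism `A_K → A_L`. -/
def inclHom : A.ext K →ₐ[ZMod 2] A.ext L :=
  Algebra.TensorProduct.map
    { σ with commutes' := fun r => RingHom.congr_fun (Subsingleton.elim
        (σ.comp (algebraMap (ZMod 2) K)) (algebraMap (ZMod 2) L)) r } (AlgHom.id _ _)

@[simp] theorem inclHom_tmul (c : K) (a : A.carrier) : A.inclHom σ (c ⊗ₜ a) = σ c ⊗ₜ a := rfl

/-- The semilinear map `A_K → A_L`. -/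
def incl : A.ext K →ₛₗ[σ] A.ext L where
  toFun := A.inclHom σ
  map_add' := map_add _
  map_smul' c x := by
    induction x using TensorProduct.induction_on with
    | zero => simp
    | tmul k a => simp [TensorProduct.smul_tmul']
    | add x y hx hy => simp [hx, hy]

@[simp] theorem incl_tmul (c : K) (a : A.carrier) : A.incl σ (c ⊗ₜ a) = σ c ⊗ₜ a := rfl

@[simp] theorem incl_mul (a b : A.ext K) : A.incl σ (a * b) = A.incl σ a * A.incl σ b :=
  map_mul (A.inclHom σ) a b

@[simp] theorem incl_one : A.incl σ 1 = 1 := map_one (A.inclHom σ)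

@[simp] theorem incl_eExt (i : A.idx) : A.incl σ (A.eExt K i) = A.eExt L i := by simp [eExt]

theorem incl_incl {L' : Type*} [Field L'] [Algebra (ZMod 2) L'] {σ : K →+* L} {τ : L →+* L'}
    {ρ : K →+* L'} (hρ : ∀ c, ρ c = τ (σ c)) (a : A.ext K) :
    A.incl τ (A.incl σ a) = A.incl ρ a := by
  induction a using TensorProduct.induction_on with
  | zero => simp
  | tmul c a => simp [hρ]
  | add u v hu hv => simp only [map_add, hu, hv]

theorem extEquiv_one_tmul [Algebra K L] [IsScalarTower (ZMod 2) K L] (a : A.ext K) :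
    A.extEquiv K L (1 ⊗ₜ a) = A.incl (algebraMap K L) a := by
  induction a using TensorProduct.induction_on with
  | zero => simp
  | tmul c a => simp [extEquiv, Algebra.smul_def]
  | add u v hu hv => rw [TensorProduct.tmul_add, map_add, map_add, hu, hv]

theorem isExt_incl : IsExt (A.incl σ) :=
  let b := Module.Basis.ofVectorSpace (ZMod 2) A.carrier
  .of_basis (Algebra.TensorProduct.basis K b) (Algebra.TensorProduct.basis L b) fun i => by simp

theorem dExt_incl (a : A.ext K) : A.dExt L (A.incl σ a) = A.incl σ (A.dExt K a) := by
  induction a using TensorProduct.induction_on with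
  | zero => simp
  | tmul k a => simp [dExt]
  | add x y hx hy => simp only [map_add, hx, hy]

theorem grExt_eq_span (g : Γ) : A.grExt L g = Submodule.span L (A.incl σ '' A.grExt K g) := by
  apply le_antisymm
  · rw [grExt, Submodule.baseChange_eq_span, Submodule.span_le]
    rintro _ ⟨a, ha, rfl⟩
    exact Submodule.subset_span ⟨1 ⊗ₜ a, Submodule.tmul_mem_baseChange_of_mem _ ha, by simp⟩
  · rw [Submodule.span_le]
    rintro _ ⟨a, ha, rfl⟩
    rw [grExt, Submodule.baseChange_eq_span] at ha
    rw [SetLike.mem_coe] at ha ⊢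
    induction ha using Submodule.span_induction with
    | mem x hx =>
      obtain ⟨a, ha, rfl⟩ := hx
      simpa [grExt] using Submodule.tmul_mem_baseChange_of_mem (1 : L) ha
    | zero => simp
    | add x y _ _ hx hy => rw [map_add]; exact add_mem hx hy
    | smul c x _ hx => rw [LinearMap.map_smulₛₗ]; exact Submodule.smul_mem _ _ hx

theorem eRight_incl (i : A.idx) (a : A.ext K) :
    A.eRight L i (A.incl σ a) = A.incl σ (A.eRight K i a) := by
  simp [eRight]

theorem eLeft_incl (i : A.idx) (a : A.ext K) :
    A.eLeft L i (A.incl σ a) = A.incl σ (A.eLeft K i a) := by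
  simp [eLeft]

end DGA

variable {A : DGA Γ s} {σ : K →+* L}

namespace DData

/-- `N'` is the extension of scalars of `N` along `σ`, with canonical map `j`. -/
structure IsExtension (N : DData A K) (N' : DData A L) (j : N.carrier →ₛₗ[σ] N'.carrier) :
    Prop where
  isExt : IsExt j
  gr : ∀ g, N'.gr g = Submodule.span L (j '' N.gr g)
  proj : ∀ i x, N'.proj i (j x) = j (N.proj i x)
  δ : ∀ x, N'.δ (j x) = TensorProduct.map (A.incl σ) j (N.δ x)

/-- `f'` is the extension of scalars of the map `f : N → A ⊗ N'`. -/
def Extends {N N₂ : DData A K} {N' N₂' : DData A L} (j : N.carrier →ₛₗ[σ] N'.carrier)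
    (k : N₂.carrier →ₛₗ[σ] N₂'.carrier) (f : N.carrier →ₗ[K] A.ext K ⊗[K] N₂.carrier)
    (f' : N'.carrier →ₗ[L] A.ext L ⊗[L] N₂'.carrier) : Prop :=
  ∀ x, f' (j x) = TensorProduct.map (A.incl σ) k (f x)

section

variable {N N₂ N₃ : DData A K} {N' N₂' N₃' : DData A L} {j : N.carrier →ₛₗ[σ] N'.carrier}
  {k : N₂.carrier →ₛₗ[σ] N₂'.carrier} {l : N₃.carrier →ₛₗ[σ] N₃'.carrier}
  {f f₂ : N.carrier →ₗ[K] A.ext K ⊗[K] N₂.carrier}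
  {f' f₂' : N'.carrier →ₗ[L] A.ext L ⊗[L] N₂'.carrier}
  {g : N₂.carrier →ₗ[K] A.ext K ⊗[K] N₃.carrier}
  {g' : N₂'.carrier →ₗ[L] A.ext L ⊗[L] N₃'.carrier}

theorem Extends.add (hf : Extends j k f f') (hf₂ : Extends j k f₂ f₂') :
    Extends j k (f + f₂) (f' + f₂') := fun x => by
  rw [LinearMap.add_apply, LinearMap.add_apply, hf, hf₂, map_add]

theorem Extends.comp (hg : Extends k l g g') (hf : Extends j k f f') :
    Extends j l (DData.comp g f) (DData.comp g' f') := fun x => by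
  simp only [DData.comp, LinearMap.comp_apply, hf x]
  generalize f x = t
  induction t using TensorProduct.induction_on with
  | zero => simp
  | tmul a y =>
    simp only [TensorProduct.map_tmul, LinearMap.lTensor_tmul, hg y]
    generalize g y = u
    induction u using TensorProduct.induction_on with
    | zero => simp
    | tmul b z => simp
    | add u v hu hv => simp only [map_add, TensorProduct.tmul_add, hu, hv]
  | add u v hu hv => simp only [map_add, hu, hv]

theorem Extends.dExt (hf : Extends j k f f') :
    Extends j k ((A.dExt K).rTensor N₂.carrier ∘ₗ f) ((A.dExt L).rTensor N₂'.carrier ∘ₗ f') :=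
  fun x => by
    simp only [LinearMap.comp_apply, hf x]
    generalize f x = t
    induction t using TensorProduct.induction_on with
    | zero => simp
    | tmul a y => simp [DGA.dExt_incl]
    | add u v hu hv => simp only [map_add, hu, hv]

/-- An L-linear map is determined on the image of j. Since `Extends` respects sums, composition and
μ₁, every equation between structure maps passes to the extension. -/
theorem Extends.eq (hj : IsExt j) (hf : Extends j k f f') (hf₂ : Extends j k f₂ f₂')
    (h : f = f₂) : f' = f₂' :=
  hj.hom_ext fun x => by rw [hf, hf₂, h]

theorem extends_zero : Extends j k 0 0 := fun x => by simp

theorem Extends.diff (hf : Extends j k f f') (hN : IsExtension N N' j)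
    (hN₂ : IsExtension N₂ N₂' k) : Extends j k (DData.diff f) (DData.diff f') :=
  ((Extends.comp hN₂.δ hf).add (Extends.comp hf hN.δ)).add hf.dExt

theorem IsExtension.exists_extends (hN : IsExtension N N' j)
    (f : N.carrier →ₗ[K] A.ext K ⊗[K] N₂.carrier) :
    ∃ f' : N'.carrier →ₗ[L] A.ext L ⊗[L] N₂'.carrier, Extends j k f f' :=
  hN.isExt.exists_lift ((TensorProduct.map (A.incl σ) k).comp f)

theorem IsExtension.isGradedMap (hN : IsExtension N N' j) (hN₂ : IsExtension N₂ N₂' k) {c : Γ}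
    (hf : Extends j k f f') (h : IsGradedMap N N₂ c f) : IsGradedMap N' N₂' c f' where
  mem_tensorI x := by
    induction x using hN.isExt.induction with
    | h0 => simp
    | hadd x y hx hy => rw [map_add]; exact add_mem hx hy
    | hsmul c x hx => rw [map_smul]; exact Submodule.smul_mem _ _ hx
    | hj x =>
      obtain ⟨w, hw⟩ := h.mem_tensorI x
      exact ⟨TensorProduct.map (A.incl σ) k w, by
        rw [hf, ← hw, tensorProj_map (A.eRight_incl σ) hN₂.proj]⟩
  map_proj i x := by
    refine LinearMap.congr_fun (f := f' ∘ₗ N'.proj i)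
      (g := (A.eLeft L i).rTensor N₂'.carrier ∘ₗ f') (hN.isExt.hom_ext fun x => ?_) x
    simp only [LinearMap.comp_apply, hN.proj, hf _, h.map_proj]
    generalize f x = t
    induction t using TensorProduct.induction_on with
    | zero => simp
    | tmul a y => simp [DGA.eLeft_incl]
    | add u v hu hv => simp only [map_add, hu, hv]
  degree d x hx := by
    rw [hN.gr] at hx
    refine map_mem_of_mem_span_image (fun y hy => ?_) hx
    rw [hf, tensorGr_span (A.grExt_eq_span σ) hN₂.gr]
    exact Submodule.subset_span ⟨_, h.degree d y hy, rfl⟩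

theorem IsExtension.isTypeD (h : IsExtension N N' j) (hN : N.IsTypeD) : N'.IsTypeD where
  isGrading := h.isExt.isGrading h.gr hN.isGrading
  proj_idem := h.isExt.completeOrthogonalIdempotents h.proj hN.proj_idem
  proj_mem i g x hx := by
    rw [h.gr] at hx
    refine map_mem_of_mem_span_image (fun y hy => ?_) hx
    rw [h.proj, h.gr]
    exact Submodule.subset_span ⟨_, hN.proj_mem i g y hy, rfl⟩
  isGradedMap := h.isGradedMap h h.δ hN.isGradedMap
  structure_eq := ((Extends.comp h.δ h.δ).add (Extends.dExt h.δ)).eq h.isExt extends_zero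
    hN.structure_eq

theorem IsExtension.isHom (hN : IsExtension N N' j) (hN₂ : IsExtension N₂ N₂' k)
    (hf : Extends j k f f') (h : IsHom N N₂ f) : IsHom N' N₂' f' where
  isGradedMap := hN.isGradedMap hN₂ hf h.isGradedMap
  diff_eq := (hf.diff hN hN₂).eq hN.isExt extends_zero h.diff_eq

theorem IsExtension.homotopic (hN : IsExtension N N' j) (hN₂ : IsExtension N₂ N₂' k)
    (hf : Extends j k f f') (hf₂ : Extends j k f₂ f₂') (h : Homotopic N N₂ f f₂) :
    Homotopic N' N₂' f' f₂' := by
  obtain ⟨H, hH, e⟩ := h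
  obtain ⟨H', hH'⟩ := hN.exists_extends (N₂' := N₂') (k := k) H
  exact ⟨H', hN.isGradedMap hN₂ hH' hH, (hf.add hf₂).eq hN.isExt (hH'.diff hN hN₂) e⟩

theorem IsExtension.idHom (hN : IsExtension N N' j) :
    Extends j j (DData.idHom N) (DData.idHom N') := fun x => by
  simp only [DData.idHom, LinearMap.comp_apply, TensorProduct.mk_apply]
  rw [← tensorProj_map (A.eRight_incl σ) hN.proj, TensorProduct.map_tmul, DGA.incl_one]

theorem IsExtension.homotopyEquivalent (hN : IsExtension N N' j) (hN₂ : IsExtension N₂ N₂' k)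
    (h : HomotopyEquivalent N N₂) : HomotopyEquivalent N' N₂' := by
  obtain ⟨ψ, φ, hψ, hφ, h1, h2⟩ := h
  obtain ⟨ψ', hψ'⟩ := hN.exists_extends (N₂' := N₂') (k := k) ψ
  obtain ⟨φ', hφ'⟩ := hN₂.exists_extends (N₂' := N') (k := j) φ
  exact ⟨ψ', φ', hN.isHom hN₂ hψ' hψ, hN₂.isHom hN hφ' hφ,
    hN.homotopic hN (hφ'.comp hψ') hN.idHom h1, hN₂.homotopic hN₂ (hψ'.comp hφ') hN₂.idHom h2⟩

/-- Compatibility with a letter on the right is enough, since the iterates `Δ` grow on that side. -/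
theorem exists_tensorAlgebra_map (A : DGA Γ s) (σ : K →+* L) :
    ∃ T : TensorAlgebra K (A.ext K) →ₛₗ[σ] TensorAlgebra L (A.ext L), T 1 = 1 ∧
      ∀ t a, T (t * TensorAlgebra.ι K a) = T t * TensorAlgebra.ι L (A.incl σ a) := by
  -- Regarding the target as a K-algebra along σ gives access to the universal property over K; the
  -- resulting map is σ-semilinear by construction.
  let _ : Algebra K (TensorAlgebra L (A.ext L)) := Algebra.compHom _ σ
  let f : A.ext K →ₗ[K] TensorAlgebra L (A.ext L) :=
    { toFun := fun a => TensorAlgebra.ι L (A.incl σ a)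
      map_add' := fun a b => by simp
      map_smul' := fun c a => by rw [LinearMap.map_smulₛₗ, map_smul]; rfl }
  let T := TensorAlgebra.lift K f
  exact ⟨{ toFun := T, map_add' := map_add T, map_smul' := map_smul T }, map_one T, fun t a =>
    (map_mul T t _).trans (congrArg (T t * ·) (TensorAlgebra.lift_ι_apply f a))⟩

theorem IsExtension.bounded (h : IsExtension N N' j) (hN : N.Bounded) : N'.Bounded := by
  obtain ⟨T, hT1, hT⟩ := exists_tensorAlgebra_map A σ
  have key : ∀ n y, N'.Δ n (j y) = TensorProduct.map T j (N.Δ n y) := by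
    intro n
    induction n with
    | zero => intro y; simp [Δ_zero_apply, hT1]
    | succ n ih =>
      intro y
      rw [Δ_succ, Δ_succ, LinearMap.comp_apply, LinearMap.comp_apply, ih]
      generalize N.Δ n y = t
      induction t using TensorProduct.induction_on with
      | zero => simp
      | tmul a y =>
        simp only [append, LinearMap.comp_apply, TensorProduct.map_tmul, LinearMap.lTensor_tmul,
          h.δ]
        generalize N.δ y = u
        induction u using TensorProduct.induction_on with
        | zero => simp
        | tmul b z => simp [hT]
        | add u v hu hv => simp only [map_add, TensorProduct.tmul_add, hu, hv]
      | add u v hu hv => simp only [map_add, hu, hv]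
  intro y
  induction y using h.isExt.induction with
  | h0 => exact ⟨0, by simp⟩
  | hadd x y hx hy =>
    obtain ⟨m, hm⟩ := hx
    obtain ⟨n, hn⟩ := hy
    exact ⟨max m n, fun k hk => by
      rw [map_add, hm k (le_of_max_le_left hk), hn k (le_of_max_le_right hk), add_zero]⟩
  | hsmul c x hx =>
    obtain ⟨m, hm⟩ := hx
    exact ⟨m, fun k hk => by rw [map_smul, hm k hk, smul_zero]⟩
  | hj x =>
    obtain ⟨m, hm⟩ := hN x
    exact ⟨m, fun k hk => by rw [key, hm k hk, map_zero]⟩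

theorem IsExtension.trans {L' : Type*} [Field L'] [Algebra (ZMod 2) L'] {τ : L →+* L'}
    {ρ : K →+* L'} {N'' : DData A L'} {i : N'.carrier →ₛₗ[τ] N''.carrier}
    (hj : IsExtension N N' j) (hi : IsExtension N' N'' i) (hρ : ∀ c, ρ c = τ (σ c)) :
    ∃ l : N.carrier →ₛₗ[ρ] N''.carrier, IsExtension N N'' l := by
  let l : N.carrier →ₛₗ[ρ] N''.carrier :=
    { toFun := fun x => i (j x)
      map_add' := fun x y => by simp
      map_smul' := fun c x => by simp [hρ] }
  have hl : ∀ x, l x = i (j x) := fun _ => rfl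
  refine ⟨l, hj.isExt.trans hi.isExt l hl, fun g => ?_, fun k x => ?_, fun x => ?_⟩
  · rw [hi.gr, hj.gr, span_image_of_factor (fun x => (hl x).symm)]
  · rw [hl, hl, hi.proj, hj.proj]
  · rw [hl, hi.δ, hj.δ]
    generalize N.δ x = t
    induction t using TensorProduct.induction_on with
    | zero => simp
    | tmul a y => simp [DGA.incl_incl A hρ, hl]
    | add u v hu hv => simp only [map_add, hu, hv]

/-- Factorization of an extension of scalars along a composite. -/
theorem IsExtension.exists_factor {L' : Type*} [Field L'] [Algebra (ZMod 2) L'] {τ : L →+* L'}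
    {ρ : K →+* L'} {N'' : DData A L'} {i : N.carrier →ₛₗ[ρ] N''.carrier}
    (hj : IsExtension N N' j) (hi : IsExtension N N'' i) (hρ : ∀ c, ρ c = τ (σ c)) :
    ∃ l : N'.carrier →ₛₗ[τ] N''.carrier, IsExtension N' N'' l := by
  obtain ⟨l, hl, hlj⟩ := hj.isExt.exists_factor hi.isExt hρ
  refine ⟨l, hl, fun g => ?_, fun k x => ?_, fun x => ?_⟩
  · rw [hi.gr, hj.gr, span_image_of_factor hlj]
  · refine LinearMap.congr_fun (f := (N''.proj k).comp l) (g := l.comp (N'.proj k))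
      (hj.isExt.hom_ext fun x => ?_) x
    simp only [LinearMap.comp_apply, hj.proj, hlj, hi.proj]
  · refine LinearMap.congr_fun (f := N''.δ.comp l) (g := (TensorProduct.map (A.incl τ) l).comp N'.δ)
      (hj.isExt.hom_ext fun x => ?_) x
    simp only [LinearMap.comp_apply, hj.δ, hlj, hi.δ]
    generalize N.δ x = t
    induction t using TensorProduct.induction_on with
    | zero => simp
    | tmul a y => simp [DGA.incl_incl A hρ, hlj]
    | add u v hu hv => simp only [map_add, hu, hv]

end

theorem isExtension_baseChange [Algebra K L] [IsScalarTower (ZMod 2) K L] (N : DData A K) :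
    ∃ j : N.carrier →ₛₗ[algebraMap K L] (N.baseChange L).carrier,
      IsExtension N (N.baseChange L) j := by
  refine ⟨_, IsExt.mk_one, fun g => ?_, fun i x => ?_, fun x => ?_⟩
  · exact Submodule.baseChange_eq_span _ _
  · simp
  · simp only [LinearMap.coe_mk, AddHom.coe_mk, LinearMap.comp_apply, LinearMap.baseChange_tmul]
    generalize N.δ x = t
    induction t using TensorProduct.induction_on with
    | zero => simp
    | tmul a y =>
      simp only [LinearEquiv.coe_coe, TensorProduct.AlgebraTensorModule.distribBaseChange_tmul,
        TensorProduct.map_tmul]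
      rw [LinearMap.rTensor_tmul]
      exact congrArg (· ⊗ₜ _) (A.extEquiv_one_tmul a)
    | add u v hu hv => simp only [map_add, TensorProduct.tmul_add, hu, hv]

end DData

end

/-! ### `A∞` modules under extension of scalars. -/

section

/-- A property compatible with linear combinations in each letter need only be checked on words over
B. The induction is on the part of the word not yet reduced, with a prefix already coming from B. -/
theorem IsExt.list_induction {K L B B' : Type*} [Field K] [Field L] {σ : K →+* L}
    [AddCommGroup B] [Module K B] [AddCommGroup B'] [Module L B'] {i : B →ₛₗ[σ] B'} (h : IsExt i)
    {P : List B' → Prop} (hmap : ∀ l : List B, P (l.map i)) (hzero : ∀ l l', P (l ++ 0 :: l'))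
    (hadd : ∀ l a b l', P (l ++ a :: l') → P (l ++ b :: l') → P (l ++ (a + b) :: l'))
    (hsmul : ∀ l (c : L) a l', P (l ++ a :: l') → P (l ++ (c • a) :: l')) (l : List B') : P l := by
  suffices H : ∀ (l' : List B') (l : List B), P (l.map i ++ l') from H l []
  intro l'
  induction l' with
  | nil => simpa using hmap
  | cons a l' ih =>
    intro l
    induction a using h.induction with
    | h0 => exact hzero _ _
    | hadd x y hx hy => exact hadd _ _ _ _ hx hy
    | hsmul c x hx => exact hsmul _ _ _ _ hx
    | hj x => simpa using ih (l ++ [x])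

theorem wordMaps.map_zero_letter {K B M : Type*} [Field K] [Ring B] [Algebra K B] [AddCommGroup M]
    [Module K M] (F : wordMaps K B M) (l l' : List B) : F.1 (l ++ 0 :: l') = 0 := by
  simpa using map_smul_letter F l 0 0 l'

variable {Γ : Type*} [AddCommGroup Γ] {s : Γ} {K L : Type*} [Field K] [Algebra (ZMod 2) K]
  [Field L] [Algebra (ZMod 2) L] {A : DGA Γ s} {σ : K →+* L}

/-- Insertion of an initial word. -/
def wordMaps.shiftWord {K B M : Type*} [Field K] [Ring B] [Algebra K B] [AddCommGroup M]
    [Module K M] (w : List B) (F : wordMaps K B M) : wordMaps K B M :=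
  ⟨fun l => F.1 (w ++ l), fun l a b l' => by
      simpa only [List.append_assoc] using F.2.1 (w ++ l) a b l', fun l c a l' => by
      simpa only [List.append_assoc] using F.2.2 (w ++ l) c a l'⟩

theorem wordMaps.eq_of_map_incl {V : Type*} [AddCommGroup V] [Module L V]
    {F G : wordMaps L (A.ext L) V}
    (h : ∀ l : List (A.ext K), F.1 (l.map (A.incl σ)) = G.1 (l.map (A.incl σ))) : F = G := by
  refine Subtype.ext (funext fun l => ?_)
  induction l using (A.isExt_incl σ).list_induction with
  | hmap l => exact h l
  | hzero l l' => rw [map_zero_letter, map_zero_letter]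
  | hadd l a b l' h1 h2 => rw [map_add_letter, map_add_letter, h1, h2]
  | hsmul l c a l' h1 => rw [map_smul_letter, map_smul_letter, h1]

namespace AData

section

variable (M : AData A K)

theorem op_add (x y : M.carrier) (l : List (A.ext K)) : M.op (x + y) l = M.op x l + M.op y l := by
  simp [op]

theorem op_smul (c : K) (x : M.carrier) (l : List (A.ext K)) : M.op (c • x) l = c • M.op x l := by
  simp [op]

theorem op_zero (l : List (A.ext K)) : M.op 0 l = 0 := by
  simp [op]

theorem op_add_letter (x : M.carrier) (l : List (A.ext K)) (a b : A.ext K) (l' : List (A.ext K)) :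
    M.op x (l ++ (a + b) :: l') = M.op x (l ++ a :: l') + M.op x (l ++ b :: l') :=
  wordMaps.map_add_letter (M.opWord x) l a b l'

theorem op_smul_letter (x : M.carrier) (l : List (A.ext K)) (c : K) (a : A.ext K)
    (l' : List (A.ext K)) : M.op x (l ++ (c • a) :: l') = c • M.op x (l ++ a :: l') :=
  wordMaps.map_smul_letter (M.opWord x) l c a l'

theorem op_zero_letter (x : M.carrier) (l l' : List (A.ext K)) : M.op x (l ++ 0 :: l') = 0 :=
  wordMaps.map_zero_letter (M.opWord x) l l'

end

/-- `M'` is the extension of scalars of `M` along `σ`, with canonical map `j`. -/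
structure IsExtension (M : AData A K) (M' : AData A L) (j : M.carrier →ₛₗ[σ] M'.carrier) :
    Prop where
  isExt : IsExt j
  gr : ∀ g, M'.gr g = Submodule.span L (j '' M.gr g)
  proj : ∀ i x, M'.proj i (j x) = j (M.proj i x)
  op : ∀ x l, M'.op (j x) (l.map (A.incl σ)) = j (M.op x l)

variable {M : AData A K} {M' : AData A L} {j : M.carrier →ₛₗ[σ] M'.carrier}

namespace IsExtension

theorem balanced_left (h : IsExtension M M' j) (hM : M.IsAInfty) (x : M'.carrier) (i : A.idx)
    (a : A.ext L) (l : List (A.ext L)) :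
    M'.op (M'.proj i x) (a :: l) = M'.op x (A.eExt L i * a :: l) := by
  induction x using h.isExt.induction with
  | h0 => simp [op_zero]
  | hadd x y hx hy => simp only [map_add, op_add, hx, hy]
  | hsmul c x hx => simp only [map_smul, op_smul, hx]
  | hj x =>
    rw [h.proj]
    have e : wordMaps.shift (M'.opWord (j (M.proj i x))) =
        wordMaps.shift (M'.opWord (j x)) ∘ₗ A.eLeft L i := by
      refine (A.isExt_incl σ).hom_ext fun a => wordMaps.eq_of_map_incl (σ := σ) fun l => ?_
      have h1 := h.op (M.proj i x) (a :: l)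
      have h2 := h.op x (A.eExt K i * a :: l)
      rw [← hM.balanced_left, ← h1] at h2
      simpa [DGA.eLeft] using h2.symm
    exact congrArg (fun F => (F a).1 l) e

theorem balanced (h : IsExtension M M' j) (hM : M.IsAInfty) (x : M'.carrier) (l : List (A.ext L))
    (i : A.idx) (a b : A.ext L) (l' : List (A.ext L)) :
    M'.op x (l ++ a * A.eExt L i :: b :: l') = M'.op x (l ++ a :: A.eExt L i * b :: l') := by
  induction x using h.isExt.induction with
  | h0 => simp [op_zero]
  | hadd x y hx hy => simp only [op_add, hx, hy]
  | hsmul c x hx => simp only [op_smul, hx]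
  | hj x =>
    induction l using (A.isExt_incl σ).list_induction with
    | hzero m m' => simp only [List.append_assoc, List.cons_append, op_zero_letter]
    | hadd m c d m' h1 h2 =>
      simp only [List.append_assoc, List.cons_append, op_add_letter] at h1 h2 ⊢
      rw [h1, h2]
    | hsmul m c d m' h1 =>
      simp only [List.append_assoc, List.cons_append, op_smul_letter] at h1 ⊢
      rw [h1]
    | hmap l =>
      let F := wordMaps.shiftWord (l.map (A.incl σ)) (M'.opWord (j x))
      have e : wordMaps.shift (wordMaps.shift F (a * A.eExt L i)) b =
          wordMaps.shift (wordMaps.shift F a) (A.eExt L i * b) := by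
        induction a using (A.isExt_incl σ).induction with
        | h0 => simp
        | hadd c d h1 h2 => simp only [add_mul, map_add, LinearMap.add_apply, h1, h2]
        | hsmul c d h1 => simp only [smul_mul_assoc, map_smul, LinearMap.smul_apply, h1]
        | hj a =>
          induction b using (A.isExt_incl σ).induction with
          | h0 => simp
          | hadd c d h1 h2 => simp only [mul_add, map_add, h1, h2]
          | hsmul c d h1 => simp only [mul_smul_comm, map_smul, h1]
          | hj b =>
            refine wordMaps.eq_of_map_incl (σ := σ) fun l' => ?_
            have h1 := h.op x (l ++ a * A.eExt K i :: b :: l')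
            rw [hM.balanced, ← h.op] at h1
            simpa [F, wordMaps.shiftWord] using h1
      exact congrArg (fun G => G.1 l') e

theorem map_proj_one (h : IsExtension M M' j) (hM : M.IsAInfty) (x : M'.carrier) (i : A.idx) :
    M'.op (M'.proj i x) [] = M'.proj i (M'.op x []) := by
  induction x using h.isExt.induction with
  | h0 => simp [op_zero]
  | hadd x y hx hy => simp only [map_add, op_add, hx, hy]
  | hsmul c x hx => simp only [map_smul, op_smul, hx]
  | hj x =>
    have h1 := h.op (M.proj i x) []
    have h2 := h.op x []
    rw [List.map_nil] at h1 h2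
    rw [h.proj, h1, h2, h.proj, hM.map_proj_one]

theorem map_proj (h : IsExtension M M' j) (hM : M.IsAInfty) (x : M'.carrier) (l : List (A.ext L))
    (a : A.ext L) (i : A.idx) :
    M'.op x (l ++ [a * A.eExt L i]) = M'.proj i (M'.op x (l ++ [a])) := by
  induction x using h.isExt.induction with
  | h0 => simp [op_zero]
  | hadd x y hx hy => simp only [map_add, op_add, hx, hy]
  | hsmul c x hx => simp only [map_smul, op_smul, hx]
  | hj x =>
    induction l using (A.isExt_incl σ).list_induction with
    | hzero m m' => simp only [List.append_assoc, List.cons_append, op_zero_letter, map_zero]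
    | hadd m c d m' h1 h2 =>
      simp only [List.append_assoc, List.cons_append, op_add_letter] at h1 h2 ⊢
      rw [h1, h2, map_add]
    | hsmul m c d m' h1 =>
      simp only [List.append_assoc, List.cons_append, op_smul_letter] at h1 ⊢
      rw [h1, map_smul]
    | hmap l =>
      induction a using (A.isExt_incl σ).induction with
      | h0 => simp only [zero_mul, op_zero_letter, map_zero]
      | hadd c d h1 h2 => simp only [add_mul, op_add_letter, h1, h2, map_add]
      | hsmul c d h1 => simp only [smul_mul_assoc, op_smul_letter, h1, map_smul]
      | hj a =>
        have h1 := h.op x (l ++ [a * A.eExt K i])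
        have h2 := h.op x (l ++ [a])
        rw [hM.map_proj, ← h.proj, ← h2] at h1
        simpa using h1

theorem degree (h : IsExtension M M' j) (hM : M.IsAInfty) (g : Γ) (x : M'.carrier)
    (hx : x ∈ M'.gr g) (l : List (Γ × A.ext L)) (hl : ∀ p ∈ l, p.2 ∈ A.grExt L p.1) :
    M'.op x (l.map Prod.snd) ∈
      M'.gr (g + (l.map Prod.fst).sum + ((l.length : ℤ) - 1) • s) := by
  rw [h.gr] at hx
  refine map_mem_of_mem_span_image
    (f := wordMaps.evalAt (l.map Prod.snd) ∘ₗ M'.opWord) (fun x hx => ?_) hx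
  -- A homogeneous letter over L is a combination of images of letters of the same degree over K, so
  -- letters move one at a time from l' to l without changing the target degree.
  suffices H : ∀ (l' : List (Γ × A.ext L)) (l : List (Γ × A.ext K)),
      (∀ p ∈ l', p.2 ∈ A.grExt L p.1) → (∀ p ∈ l, p.2 ∈ A.grExt K p.1) →
      M'.op (j x) ((l.map (Prod.map id (A.incl σ)) ++ l').map Prod.snd) ∈
        M'.gr (g + ((l.map (Prod.map id (A.incl σ)) ++ l').map Prod.fst).sum +
          (((l.map (Prod.map id (A.incl σ)) ++ l').length : ℤ) - 1) • s) from
    H l [] hl (by simp)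
  intro l'
  induction l' with
  | nil =>
    intro l _ hl
    have h1 := Submodule.subset_span (R := L) (Set.mem_image_of_mem j (hM.degree g x hx l hl))
    rw [← h.op, ← h.gr] at h1
    simpa [Function.comp_def] using h1
  | cons q l' ih =>
    obtain ⟨d, a⟩ := q
    intro l hl' hl
    have ha : a ∈ A.grExt L d := hl' (d, a) (by simp)
    have hl'' : ∀ p ∈ l', p.2 ∈ A.grExt L p.1 := fun p hp => hl' p (by simp [hp])
    clear hl'
    rw [A.grExt_eq_span σ] at ha
    induction ha using Submodule.span_induction with
    | mem a ha =>
      obtain ⟨a, ha, rfl⟩ := ha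
      have := ih (l ++ [(d, a)]) hl'' (by
        intro p hp
        rcases List.mem_append.1 hp with hp | hp
        · exact hl p hp
        · rw [List.mem_singleton.1 hp]; exact ha)
      simpa only [List.map_append, List.map_cons, List.map_nil, List.append_assoc,
        List.singleton_append, Prod.map_apply, id_eq] using this
    | zero =>
      simp only [List.map_append, List.map_cons, op_zero_letter]
      exact zero_mem _
    | add a b _ _ h1 h2 =>
      simp only [List.map_append, List.map_cons, List.length_append, List.length_cons,
        op_add_letter] at h1 h2 ⊢
      exact add_mem h1 h2
    | smul c a _ h1 =>
      simp only [List.map_append, List.map_cons, List.length_append, List.length_cons,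
        op_smul_letter] at h1 ⊢
      exact Submodule.smul_mem _ _ h1

/-- All three sums are word maps, so it suffices to take x and the letters from K, where the
relation is the image under j of the relation for M. -/
theorem relation (h : IsExtension M M' j) (hM : M.IsAInfty) (x : M'.carrier)
    (l : List (A.ext L)) :
    wordMaps.splitAt M'.opWord l (M'.opWord x) + wordMaps.derivAt (A.dExt L) l (M'.opWord x) +
      wordMaps.mulAt l (M'.opWord x) = 0 := by
  refine LinearMap.congr_fun (f := (wordMaps.splitAt M'.opWord l + wordMaps.derivAt (A.dExt L) l +
    wordMaps.mulAt l) ∘ₗ M'.opWord) (g := 0) (h.isExt.hom_ext fun x => ?_) x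
  have e : wordMaps.split M'.opWord (M'.opWord (j x)) + wordMaps.deriv (A.dExt L) (M'.opWord (j x)) +
      wordMaps.mul (M'.opWord (j x)) = 0 := by
    refine wordMaps.eq_of_map_incl (σ := σ) fun l => ?_
    have h1 := congrArg j (hM.relation_words x l)
    change wordMaps.splitAt M'.opWord _ (M'.opWord (j x)) + wordMaps.derivAt (A.dExt L) _
      (M'.opWord (j x)) + wordMaps.mulAt _ (M'.opWord (j x)) = 0
    rw [map_zero, map_add, map_add] at h1
    rw [← h1]
    simp only [wordMaps.splitAt_eq_sum, wordMaps.derivAt_eq_sum, wordMaps.mulAt_eq_sum, map_sum,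
      opWord_apply]
    congr 1
    · congr 1
      · simp only [List.length_map, ← List.map_take, ← List.map_drop, h.op]
      · refine Fintype.sum_equiv (finCongr (by simp)) _ _ fun k => ?_
        rw [← h.op]
        simp [DGA.dExt_incl, ← List.map_take, ← List.map_drop]
    · refine Fintype.sum_equiv (finCongr (by simp)) _ _ fun k => ?_
      rw [← h.op]
      simp [← List.map_take, ← List.map_drop]
  exact congrArg (fun G => G.1 l) e

theorem isAInfty (h : IsExtension M M' j) (hM : M.IsAInfty) : M'.IsAInfty where
  isGrading := h.isExt.isGrading h.gr hM.isGrading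
  proj_idem := h.isExt.completeOrthogonalIdempotents h.proj hM.proj_idem
  proj_mem i g x hx := by
    rw [h.gr] at hx
    refine map_mem_of_mem_span_image (fun y hy => ?_) hx
    rw [h.proj, h.gr]
    exact Submodule.subset_span ⟨_, hM.proj_mem i g y hy, rfl⟩
  balanced_left := h.balanced_left hM
  balanced := h.balanced hM
  map_proj_one := h.map_proj_one hM
  map_proj := h.map_proj hM
  degree := h.degree hM
  relation x l := by
    have := h.relation hM x l
    rwa [wordMaps.splitAt_eq_sum, wordMaps.derivAt_eq_sum, wordMaps.mulAt_eq_sum] at this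

theorem strictlyUnital (h : IsExtension M M' j) (hM : M.StrictlyUnital) : M'.StrictlyUnital where
  op_one x := by
    induction x using h.isExt.induction with
    | h0 => simp [op_zero]
    | hadd x y hx hy => simp only [op_add, hx, hy]
    | hsmul c x hx => simp only [op_smul, hx]
    | hj x =>
      have h1 := h.op x [1]
      rw [hM.op_one] at h1
      simpa using h1
  op_eq_zero x l hl h1 := by
    obtain ⟨l, l', rfl⟩ := List.append_of_mem h1
    clear h1
    induction x using h.isExt.induction with
    | h0 => simp [op_zero]
    | hadd x y hx hy => simp only [op_add, hx, hy, add_zero]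
    | hsmul c x hx => simp only [op_smul, hx, smul_zero]
    | hj x =>
      induction l using (A.isExt_incl σ).list_induction with
      | hzero m m' => simp only [List.append_assoc, List.cons_append, op_zero_letter]
      | hadd m c d m' h1 h2 =>
        simp only [List.append_assoc, List.cons_append, op_add_letter] at h1 h2 ⊢
        rw [h1 (by simpa using hl), h2 (by simpa using hl), add_zero]
      | hsmul m c d m' h1 =>
        simp only [List.append_assoc, List.cons_append, op_smul_letter] at h1 ⊢
        rw [h1 (by simpa using hl), smul_zero]
      | hmap l =>
        induction l' using (A.isExt_incl σ).list_induction with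
        | hzero m m' =>
          simp only [← List.cons_append, ← List.append_assoc, op_zero_letter]
        | hadd m c d m' h1 h2 =>
          simp only [← List.cons_append, ← List.append_assoc, op_add_letter] at h1 h2 ⊢
          rw [h1 (by simpa using hl), h2 (by simpa using hl), add_zero]
        | hsmul m c d m' h1 =>
          simp only [← List.cons_append, ← List.append_assoc, op_smul_letter] at h1 ⊢
          rw [h1 (by simpa using hl), smul_zero]
        | hmap l' =>
          have h1 := h.op x (l ++ 1 :: l')
          rw [hM.op_eq_zero x _ (by simpa using hl) (by simp), map_zero] at h1
          simpa using h1

theorem bounded (h : IsExtension M M' j) (hM : M.Bounded) : M'.Bounded := by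
  intro x
  induction x using h.isExt.induction with
  | h0 => exact ⟨0, fun l _ => M'.op_zero l⟩
  | hadd x y hx hy =>
    obtain ⟨m, hm⟩ := hx
    obtain ⟨n, hn⟩ := hy
    exact ⟨max m n, fun l hl => by
      rw [op_add, hm l (le_of_max_le_left hl), hn l (le_of_max_le_right hl), add_zero]⟩
  | hsmul c x hx =>
    obtain ⟨m, hm⟩ := hx
    exact ⟨m, fun l hl => by rw [op_smul, hm l hl, smul_zero]⟩
  | hj x =>
    obtain ⟨n, hn⟩ := hM x
    refine ⟨n, fun l hl => ?_⟩
    induction l using (A.isExt_incl σ).list_induction with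
    | hzero l l' => exact op_zero_letter ..
    | hadd l a b l' h1 h2 =>
      rw [op_add_letter, h1 (by simpa using hl), h2 (by simpa using hl), add_zero]
    | hsmul l c a l' h1 => rw [op_smul_letter, h1 (by simpa using hl), smul_zero]
    | hmap l => rw [h.op, hn l (by simpa using hl), map_zero]

/-- Factorization of an extension of scalars along a composite. -/
theorem exists_factor {L' : Type*} [Field L'] [Algebra (ZMod 2) L'] {τ : L →+* L'}
    {ρ : K →+* L'} {M'' : AData A L'} {i : M.carrier →ₛₗ[ρ] M''.carrier}
    (hj : IsExtension M M' j) (hi : IsExtension M M'' i) (hρ : ∀ c, ρ c = τ (σ c)) :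
    ∃ l : M'.carrier →ₛₗ[τ] M''.carrier, IsExtension M' M'' l := by
  obtain ⟨l, hl, hlj⟩ := hj.isExt.exists_factor hi.isExt hρ
  refine ⟨l, hl, fun g => ?_, fun k x => ?_, fun x w => ?_⟩
  · rw [hi.gr, hj.gr, span_image_of_factor hlj]
  · refine LinearMap.congr_fun (f := (M''.proj k).comp l) (g := l.comp (M'.proj k))
      (hj.isExt.hom_ext fun x => ?_) x
    simp only [LinearMap.comp_apply, hj.proj, hlj, hi.proj]
  · induction x using hj.isExt.induction with
    | h0 => simp [op_zero]
    | hadd x y hx hy => simp only [map_add, op_add, hx, hy]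
    | hsmul c x hx => simp only [LinearMap.map_smulₛₗ, op_smul, hx]
    | hj x =>
      rw [hlj]
      induction w using (A.isExt_incl σ).list_induction with
      | hzero l l' => simp [op_zero_letter]
      | hadd l a b l' h1 h2 =>
        simp only [List.map_append, List.map_cons, map_add, op_add_letter] at h1 h2 ⊢
        rw [h1, h2]
      | hsmul l c a l' h1 =>
        simp only [List.map_append, List.map_cons, LinearMap.map_smulₛₗ, op_smul_letter] at h1 ⊢
        rw [h1]
      | hmap w =>
        have : (w.map (A.incl σ)).map (A.incl τ) = w.map (A.incl ρ) := by
          simp [DGA.incl_incl A hρ]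
        rw [this, hi.op, hj.op, hlj]

end IsExtension

theorem isExtension_baseChange [Algebra K L] [IsScalarTower (ZMod 2) K L] (M : AData A K) :
    ∃ j : M.carrier →ₛₗ[algebraMap K L] (M.baseChange L).carrier,
      IsExtension M (M.baseChange L) j := by
  refine ⟨_, IsExt.mk_one, fun g => ?_, fun i x => ?_, fun x l => ?_⟩
  · exact Submodule.baseChange_eq_span _ _
  · simp
  -- On a word whose letters come from A_K, the inverse of the canonical map has the expected value
  -- 1 ⊗ word.
  · have hT : A.tensorAlgebraMap K L
        ((l.map (A.incl (algebraMap K L))).map (TensorAlgebra.ι L)).prod =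
        1 ⊗ₜ (l.map (TensorAlgebra.ι K)).prod := by
      induction l with
      | nil => simp [Algebra.TensorProduct.one_def]
      | cons a l ih =>
        have h1 : (A.extEquiv K L).symm (A.incl (algebraMap K L) a) = 1 ⊗ₜ a := by
          rw [LinearEquiv.symm_apply_eq, DGA.extEquiv_one_tmul]
        rw [List.map_cons, List.map_cons, List.prod_cons, map_mul, ih, DGA.tensorAlgebraMap,
          TensorAlgebra.lift_ι_apply, LinearMap.comp_apply, LinearEquiv.coe_coe, h1]
        simp
    simp only [op, LinearMap.compl₂_apply, AlgHom.toLinearMap_apply, hT]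
    simp

end AData

end

/-! ### Extension of scalars and isomorphism of complexes. -/

section Complexes

variable {Γ : Type*} {K L : Type*} [Field K] [Field L] {σ : K →+* L}

namespace CData

/-- `C'` is the extension of scalars of `C` along `σ`, with canonical map `j`. -/
structure IsExtension (C : CData Γ K) (C' : CData Γ L) (j : C.carrier →ₛₗ[σ] C'.carrier) :
    Prop where
  isExt : IsExt j
  gr : ∀ g, C'.gr g = Submodule.span L (j '' C.gr g)
  d : ∀ x, C'.d (j x) = j (C.d x)

/-- Isomorphism of complexes. -/
structure IsIso (C D : CData Γ K) (e : C.carrier ≃ₗ[K] D.carrier) : Prop where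
  map_d : ∀ x, e (C.d x) = D.d (e x)
  map_mem : ∀ g, ∀ x ∈ C.gr g, e x ∈ D.gr g
  symm_mem : ∀ g, ∀ x ∈ D.gr g, e.symm x ∈ C.gr g

theorem IsIso.symm_d {C D : CData Γ K} {e : C.carrier ≃ₗ[K] D.carrier} (h : IsIso C D e)
    (x : D.carrier) : e.symm (D.d x) = C.d (e.symm x) := by
  rw [LinearEquiv.symm_apply_eq, h.map_d, e.apply_symm_apply]

theorem IsExtension.exists_isIso {C : CData Γ K} {C' C'' : CData Γ L}
    {j : C.carrier →ₛₗ[σ] C'.carrier} {k : C.carrier →ₛₗ[σ] C''.carrier}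
    (hj : IsExtension C C' j) (hk : IsExtension C C'' k) : ∃ e, IsIso C' C'' e := by
  obtain ⟨e, he⟩ := hj.isExt.exists_equiv hk.isExt
  have he' : ∀ x, e.symm (k x) = j x := fun x => by rw [LinearEquiv.symm_apply_eq, he]
  refine ⟨e, fun x => ?_, fun g x hx => ?_, fun g x hx => ?_⟩
  · refine LinearMap.congr_fun (f := e.toLinearMap ∘ₗ C'.d) (g := C''.d ∘ₗ e.toLinearMap)
      (hj.isExt.hom_ext fun x => ?_) x
    simp [hj.d, he, hk.d]
  · rw [hj.gr] at hx
    refine map_mem_of_mem_span_image (f := e.toLinearMap) (fun y hy => ?_) hx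
    rw [LinearEquiv.coe_coe, he, hk.gr]
    exact Submodule.subset_span ⟨y, hy, rfl⟩
  · rw [hk.gr] at hx
    refine map_mem_of_mem_span_image (f := e.symm.toLinearMap) (fun y hy => ?_) hx
    rw [LinearEquiv.coe_coe, he', hj.gr]
    exact Submodule.subset_span ⟨y, hy, rfl⟩

theorem HomotopyEquivalent.of_isIso [AddCommGroup Γ] {s : Γ} {C D C' D' : CData Γ K} {a : C.carrier ≃ₗ[K] C'.carrier}
    {b : D.carrier ≃ₗ[K] D'.carrier} (ha : IsIso C C' a) (hb : IsIso D D' b)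
    (h : HomotopyEquivalent s C D) : HomotopyEquivalent s C' D' := by
  obtain ⟨f, g, p, q, hf, hg, hp, hq, hfd, hgd, hgf, hfg⟩ := h
  refine ⟨b.toLinearMap ∘ₗ f ∘ₗ a.symm.toLinearMap, a.toLinearMap ∘ₗ g ∘ₗ b.symm.toLinearMap,
    a.toLinearMap ∘ₗ p ∘ₗ a.symm.toLinearMap, b.toLinearMap ∘ₗ q ∘ₗ b.symm.toLinearMap,
    fun i x hx => hb.map_mem _ _ (hf _ _ (ha.symm_mem _ _ hx)),
    fun i x hx => ha.map_mem _ _ (hg _ _ (hb.symm_mem _ _ hx)),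
    fun i x hx => ha.map_mem _ _ (hp _ _ (ha.symm_mem _ _ hx)),
    fun i x hx => hb.map_mem _ _ (hq _ _ (hb.symm_mem _ _ hx)), ?_, ?_, ?_, ?_⟩
  · ext x
    have := LinearMap.congr_fun hfd (a.symm x)
    simp only [LinearMap.comp_apply, LinearEquiv.coe_coe, ha.symm_d, ← hb.map_d] at this ⊢
    rw [this]
  · ext x
    have := LinearMap.congr_fun hgd (b.symm x)
    simp only [LinearMap.comp_apply, LinearEquiv.coe_coe, hb.symm_d, ← ha.map_d] at this ⊢
    rw [this]
  · ext x
    have := congrArg a (LinearMap.congr_fun hgf (a.symm x))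
    simpa [ha.symm_d, ← ha.map_d] using this
  · ext x
    have := congrArg b (LinearMap.congr_fun hfg (b.symm x))
    simpa [hb.symm_d, ← hb.map_d] using this

theorem isExtension_baseChange [Algebra K L] (C : CData Γ K) :
    ∃ j : C.carrier →ₛₗ[algebraMap K L] (C.baseChange L).carrier,
      IsExtension C (C.baseChange L) j :=
  ⟨_, IsExt.mk_one, fun _ => Submodule.baseChange_eq_span _ _, fun x => by simp⟩

end CData

end Complexes

/-! ### Compatibility of the pairing with extension of scalars. -/

section Box

variable {Γ : Type*} [AddCommGroup Γ] {s : Γ} {K L : Type*} [Field K] [Algebra (ZMod 2) K]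
  [Field L] [Algebra (ZMod 2) L] {A : DGA Γ s} {σ : K →+* L}
  {M : AData A K} {M' : AData A L} {j : M.carrier →ₛₗ[σ] M'.carrier}
  {N : DData A K} {N' : DData A L} {k : N.carrier →ₛₗ[σ] N'.carrier}

theorem DData.IsExtension.iterEval {V V' : Type*} [AddCommGroup V] [Module K V] [AddCommGroup V']
    [Module L V'] {i : V →ₛₗ[σ] V'} (hN : DData.IsExtension N N' k) (n : ℕ)
    {F : wordMaps K (A.ext K) V} {F' : wordMaps L (A.ext L) V'}
    (hF : ∀ l, F'.1 (l.map (A.incl σ)) = i (F.1 l)) (y : N.carrier) :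
    iterEval V' N'.δ n F' (k y) = TensorProduct.map i k (iterEval V N.δ n F y) := by
  induction n generalizing F F' y with
  | zero =>
    have := hF []
    rw [List.map_nil] at this
    rw [iterEval_zero, iterEval_zero, this, TensorProduct.map_tmul]
  | succ n ih =>
    rw [iterEval_succ, iterEval_succ, hN.δ]
    generalize N.δ y = t
    induction t using TensorProduct.induction_on with
    | zero => simp
    | tmul a z =>
      have := ih (F := wordMaps.shift F a) (F' := wordMaps.shift F' (A.incl σ a))
        (fun l => by simpa using hF (a :: l)) z
      simpa using this
    | add u v hu hv => simp only [map_add, hu, hv]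

theorem boxTerm_map (hM : AData.IsExtension M M' j) (hN : DData.IsExtension N N' k) (n : ℕ)
    (v : M.carrier ⊗[K] N.carrier) :
    boxTerm M' N' n (TensorProduct.map j k v) = TensorProduct.map j k (boxTerm M N n v) := by
  induction v using TensorProduct.induction_on with
  | zero => simp
  | tmul x y =>
    rw [TensorProduct.map_tmul, boxTerm_tmul, boxTerm_tmul]
    exact hN.iterEval n (fun l => hM.op x l) y
  | add u v hu hv => simp only [map_add, hu, hv]

theorem boxD_map (hM : AData.IsExtension M M' j) (hN : DData.IsExtension N N' k)
    (h : M.Bounded ∨ N.Bounded) (v : M.carrier ⊗[K] N.carrier) :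
    boxD M' N' (TensorProduct.map j k v) = TensorProduct.map j k (boxD M N v) :=
  linearSum_natural (eventuallyZero_boxTerm h) (eventuallyZero_boxTerm (h.imp hM.bounded hN.bounded))
    (TensorProduct.map j k) (TensorProduct.map j k).toAddMonoidHom (boxTerm_map hM hN) v

/-- The pairing is compatible with extension of scalars. -/
theorem exists_isExtension_box (hM : AData.IsExtension M M' j) (hN : DData.IsExtension N N' k)
    (hp : CompleteOrthogonalIdempotents M.proj) (hq : CompleteOrthogonalIdempotents N.proj)
    (hMgr : ∀ i g, ∀ x ∈ M.gr g, M.proj i x ∈ M.gr g)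
    (hNgr : ∀ i g, ∀ x ∈ N.gr g, N.proj i x ∈ N.gr g) (h : M.Bounded ∨ N.Bounded) :
    ∃ J : (box M N).carrier →ₛₗ[σ] (box M' N').carrier,
      CData.IsExtension (box M N) (box M' N') J := by
  have hJ := tensorProj_map (j := j) (k := k) hM.proj hN.proj
  let J : tensorI M.proj N.proj →ₛₗ[σ] tensorI M'.proj N'.proj :=
    ((TensorProduct.map j k).comp (tensorI M.proj N.proj).subtype).codRestrict _ (by
      rintro ⟨_, w, rfl⟩
      exact ⟨_, hJ w⟩)
  have hJr : ∀ v, (tensorProj M'.proj N'.proj).rangeRestrict (TensorProduct.map j k v) =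
      J ((tensorProj M.proj N.proj).rangeRestrict v) := fun v => Subtype.ext (hJ v)
  refine ⟨J, (hM.isExt.tensor hN.isExt).range (tensorProj_tensorProj hp hq) hJ J fun _ => rfl,
    fun g => le_antisymm (fun x hx => ?_) ?_, fun x => ?_⟩
  · have hx1 : (tensorProj M'.proj N'.proj).rangeRestrict x.1 = x :=
      Subtype.ext (tensorProj_of_mem (hM.isExt.completeOrthogonalIdempotents hM.proj hp)
        (hN.isExt.completeOrthogonalIdempotents hN.proj hq) x.2)
    rw [← hx1]
    have hx2 : x.1 ∈ tensorGr M'.gr N'.gr g := hx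
    rw [tensorGr_span hM.gr hN.gr] at hx2
    refine map_mem_of_mem_span_image (fun v hv => ?_) hx2
    refine (hJr v).symm ▸ Submodule.subset_span ⟨_, ?_, rfl⟩
    exact tensorProj_mem_tensorGr hMgr hNgr hv
  · rw [Submodule.span_le]
    rintro _ ⟨x, hx, rfl⟩
    change TensorProduct.map j k x.1 ∈ tensorGr M'.gr N'.gr g
    rw [tensorGr_span hM.gr hN.gr]
    exact Submodule.subset_span ⟨_, hx, rfl⟩
  · change (tensorProj M'.proj N'.proj).rangeRestrict (boxD M' N' (TensorProduct.map j k x.1)) = _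
    rw [boxD_map hM hN h, hJr]
    rfl

end Box

/-! ### Field embeddings from linear injections, and the stable pairing. -/

section Stable

theorem fieldMap_algebraMap {W W' : Type*} [AddCommGroup W] [Module (ZMod 2) W] [AddCommGroup W']
    [Module (ZMod 2) W'] (φ : W →ₗ[ZMod 2] W') (hφ : Function.Injective φ)
    (a : SymmetricAlgebra (ZMod 2) W) :
    fieldMap φ hφ (algebraMap _ (FField W) a) = algebraMap _ (FField W') (symMap φ a) := by
  rw [fieldMap, IsFractionRing.map]
  exact IsLocalization.map_eq _ a

/-- Both sides are ring maps out of a fraction field, hence determined on the symmetric algebra, and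
there on its generators. -/
theorem fieldMap_fieldMap {W W' W'' : Type*} [AddCommGroup W] [Module (ZMod 2) W] [AddCommGroup W']
    [Module (ZMod 2) W'] [AddCommGroup W''] [Module (ZMod 2) W''] {φ : W →ₗ[ZMod 2] W'}
    {ψ : W' →ₗ[ZMod 2] W''} {χ : W →ₗ[ZMod 2] W''} (hφ : Function.Injective φ)
    (hψ : Function.Injective ψ) (hχ : Function.Injective χ) (h : ∀ x, ψ (φ x) = χ x)
    (c : FField W) : fieldMap ψ hψ (fieldMap φ hφ c) = fieldMap χ hχ c := by
  have h1 : (symMap ψ).comp (symMap φ) = symMap χ := by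
    apply SymmetricAlgebra.algHom_ext
    ext x
    simp [symMap, h]
  have h2 : (fieldMap ψ hψ).comp (fieldMap φ hφ) = fieldMap χ hχ := by
    refine IsLocalization.ringHom_ext (nonZeroDivisors (SymmetricAlgebra (ZMod 2) W)) ?_
    ext a
    simp only [RingHom.comp_apply, fieldMap_algebraMap]
    rw [← h1, AlgHom.comp_apply]
  exact RingHom.congr_fun h2 c

theorem CData.isExtension_extend {Γ W W' : Type*} [AddCommGroup W] [Module (ZMod 2) W]
    [AddCommGroup W'] [Module (ZMod 2) W'] (φ : W →ₗ[ZMod 2] W') (hφ : Function.Injective φ)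
    (C : CData Γ (FField W)) : ∃ j : C.carrier →ₛₗ[fieldMap φ hφ] (C.extend φ hφ).carrier,
      IsExtension C (C.extend φ hφ) j :=
  letI : Algebra (FField W) (FField W') := (fieldMap φ hφ).toAlgebra
  isExtension_baseChange C

variable {Γ : Type*} [AddCommGroup Γ] {s : Γ} {A : DGA Γ s} {W W' W₀ : Type*} [AddCommGroup W]
  [Module (ZMod 2) W] [AddCommGroup W'] [Module (ZMod 2) W'] [AddCommGroup W₀] [Module (ZMod 2) W₀]

theorem AData.isExtension_extend (φ : W →ₗ[ZMod 2] W') (hφ : Function.Injective φ)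
    (M : AData A (FField W)) : ∃ j : M.carrier →ₛₗ[fieldMap φ hφ] (M.extend φ hφ).carrier,
      IsExtension M (M.extend φ hφ) j :=
  letI : Algebra (FField W) (FField W') := (fieldMap φ hφ).toAlgebra
  haveI : IsScalarTower (ZMod 2) (FField W) (FField W') := isScalarTower_zmod
  isExtension_baseChange M

theorem DData.isExtension_extend (φ : W →ₗ[ZMod 2] W') (hφ : Function.Injective φ)
    (N : DData A (FField W)) : ∃ j : N.carrier →ₛₗ[fieldMap φ hφ] (N.extend φ hφ).carrier,
      IsExtension N (N.extend φ hφ) j :=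
  letI : Algebra (FField W) (FField W') := (fieldMap φ hφ).toAlgebra
  haveI : IsScalarTower (ZMod 2) (FField W) (FField W') := isScalarTower_zmod
  isExtension_baseChange N

theorem prodMap_id_injective {φ : W →ₗ[ZMod 2] W'} (hφ : Function.Injective φ) :
    Function.Injective (LinearMap.prodMap (LinearMap.id : W₀ →ₗ[ZMod 2] W₀) φ) :=
  Function.injective_id.prodMap hφ

/-- Extension of scalars of the pairing along `W₀ ⊕ W → W₀ ⊕ W'`. -/
theorem exists_isIso_boxStar_extend {M : AData A (FField W₀)} (hM : M.IsAInfty)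
    {N : DData A (FField W)} (hN : N.IsTypeD) (h : M.Bounded ∨ N.Bounded) {φ : W →ₗ[ZMod 2] W'}
    (hφ : Function.Injective φ) :
    ∃ e, CData.IsIso (boxStar M (N.extend φ hφ))
      ((boxStar M N).extend (LinearMap.prodMap LinearMap.id φ) (prodMap_id_injective hφ)) e := by
  obtain ⟨_, hM1⟩ := M.isExtension_extend (LinearMap.inl (ZMod 2) W₀ W) LinearMap.inl_injective
  obtain ⟨_, hM2⟩ := M.isExtension_extend (LinearMap.inl (ZMod 2) W₀ W') LinearMap.inl_injective
  obtain ⟨_, hN1⟩ := N.isExtension_extend (LinearMap.inr (ZMod 2) W₀ W) LinearMap.inr_injective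
  obtain ⟨_, hN2⟩ := N.isExtension_extend φ hφ
  obtain ⟨_, hN3⟩ := (N.extend φ hφ).isExtension_extend (LinearMap.inr (ZMod 2) W₀ W')
    LinearMap.inr_injective
  have hψ := prodMap_id_injective (W₀ := W₀) hφ
  -- Since (id ⊕ φ) ∘ inl = inl, M over W₀ ⊕ W' is also an extension of M over W₀ ⊕ W. For N the
  -- identity used below is (id ⊕ φ) ∘ inr = inr ∘ φ.
  obtain ⟨_, hM12⟩ := hM1.exists_factor hM2 (τ := fieldMap _ hψ) fun c =>
    (fieldMap_fieldMap LinearMap.inl_injective hψ LinearMap.inl_injective (by simp) c).symm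
  have hr : Function.Injective (LinearMap.inr (ZMod 2) W₀ W' ∘ₗ φ) :=
    LinearMap.inr_injective.comp hφ
  obtain ⟨_, hN23⟩ := hN2.trans hN3 (ρ := fieldMap _ hr) fun c =>
    (fieldMap_fieldMap hφ LinearMap.inr_injective hr (by simp) c).symm
  obtain ⟨_, hN13⟩ := hN1.exists_factor hN23 (τ := fieldMap _ hψ) fun c =>
    (fieldMap_fieldMap LinearMap.inr_injective hψ hr (by simp) c).symm
  have hME := hM1.isAInfty hM
  have hNE := hN1.isTypeD hN
  obtain ⟨_, hJ⟩ := exists_isExtension_box hM12 hN13 hME.proj_idem hNE.proj_idem hME.proj_mem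
    hNE.proj_mem (h.imp hM1.bounded hN1.bounded)
  obtain ⟨_, hE⟩ := (boxStar M N).isExtension_extend _ hψ
  exact hJ.exists_isIso hE

end Stable

end StablePairing

end

/-! ### The main theorem. -/

theorem mainTheorem2
    {Γ : Type*} [AddCommGroup Γ] {s : Γ} (A : StablePairing.DGA Γ s)
    {W W' W₀ : Type u} [AddCommGroup W] [Module (ZMod 2) W] [AddCommGroup W'] [Module (ZMod 2) W']
    [AddCommGroup W₀] [Module (ZMod 2) W₀]
    (M : StablePairing.AData A (StablePairing.FField W₀)) (hM : M.IsAInfty)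
    (hM1 : M.StrictlyUnital)
    (N : StablePairing.DData A (StablePairing.FField W)) (hN : N.IsTypeD)
    (N' : StablePairing.DData A (StablePairing.FField W')) (hN' : N'.IsTypeD)
    (hbdd : M.Bounded ∨ (N.Bounded ∧ N'.Bounded))
    (hNN' : N.StablyHomotopyEquivalent N') :
    (StablePairing.boxStar M N).IsComplex s ∧ (StablePairing.boxStar M N').IsComplex s ∧
      (StablePairing.boxStar M N).StablyHomotopyEquivalent s (StablePairing.boxStar M N') := by
  obtain ⟨W₁, _, _, φ, φ', hφ, hφ', hE⟩ := hNN'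
  have h : M.Bounded ∨ N.Bounded := hbdd.imp_right And.left
  have h' : M.Bounded ∨ N'.Bounded := hbdd.imp_right And.right
  obtain ⟨_, hME⟩ := M.isExtension_extend (LinearMap.inl (ZMod 2) W₀ W) LinearMap.inl_injective
  obtain ⟨_, hME'⟩ := M.isExtension_extend (LinearMap.inl (ZMod 2) W₀ W') LinearMap.inl_injective
  obtain ⟨_, hNE⟩ := N.isExtension_extend (LinearMap.inr (ZMod 2) W₀ W) LinearMap.inr_injective
  obtain ⟨_, hNE'⟩ := N'.isExtension_extend (LinearMap.inr (ZMod 2) W₀ W') LinearMap.inr_injective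
  refine ⟨StablePairing.box_isComplex (hME.isAInfty hM) (hNE.isTypeD hN)
      (h.imp hME.bounded hNE.bounded), StablePairing.box_isComplex (hME'.isAInfty hM)
      (hNE'.isTypeD hN') (h'.imp hME'.bounded hNE'.bounded), W₀ × W₁, inferInstance, inferInstance,
    LinearMap.prodMap LinearMap.id φ, LinearMap.prodMap LinearMap.id φ',
    StablePairing.prodMap_id_injective hφ, StablePairing.prodMap_id_injective hφ', ?_⟩
  obtain ⟨_, hi⟩ := StablePairing.exists_isIso_boxStar_extend hM hN h hφ
  obtain ⟨_, hi'⟩ := StablePairing.exists_isIso_boxStar_extend hM hN' h' hφ'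
  -- It remains to compare the pairings of M with the extensions of N and N' to W₁, both over the
  -- field of W₀ ⊕ W₁.
  refine .of_isIso hi hi' ?_
  obtain ⟨_, hML⟩ := M.isExtension_extend (LinearMap.inl (ZMod 2) W₀ W₁) LinearMap.inl_injective
  obtain ⟨_, hNF⟩ := N.isExtension_extend φ hφ
  obtain ⟨_, hNF'⟩ := N'.isExtension_extend φ' hφ'
  obtain ⟨_, hNL⟩ := (N.extend φ hφ).isExtension_extend (LinearMap.inr (ZMod 2) W₀ W₁)
    LinearMap.inr_injective
  obtain ⟨_, hNL'⟩ := (N'.extend φ' hφ').isExtension_extend (LinearMap.inr (ZMod 2) W₀ W₁)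
    LinearMap.inr_injective
  -- The given equivalence lives over the field of W₁ and is extended once more, along inr, to the
  -- field of the pairing.
  exact StablePairing.box_homotopyEquivalent (hML.isAInfty hM) (hML.strictlyUnital hM1)
    (hNL.isTypeD (hNF.isTypeD hN)) (hNL'.isTypeD (hNF'.isTypeD hN'))
    (h.imp hML.bounded fun hb => hNL.bounded (hNF.bounded hb))
    (h'.imp hML.bounded fun hb => hNL'.bounded (hNF'.bounded hb))
    (hNL.homotopyEquivalent hNL' hE)
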